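/- Separator logic $\mathsf{FO{+}conn}$ on graphs is first-order logic with equality, adjacency, and, for every $k\ge 0$, a predicate $\mathsf{conn}_k(s,t,u_1,\dots,u_k)$, which holds in a graph $G$ if some path of $G$ joins $s$ to $t$ and contains none of $u_1,\dots,u_k$. For a class $\mathscr C$ of finite simple graphs (closed under isomorphism), the model-checking problem for $\mathsf{FO{+}conn}$ on $\mathscr C$ is the parameterized problem whose instances are the pairs $(G,\varphi)$ of a graph $G\in\mathscr C$ and an $\mathsf{FO{+}conn}$ sentence $\varphi$, with parameter $|\varphi|$; the question is whether $G\models\varphi$. A graph $H$ is a depth-$r$ minor of $G$ if there are pairwise disjoint vertex sets $B_a$ in $G$ ($a\in V(H)$), each inducing a subgraph of radius at most $r$, with an edge of $G$ between $B_a$ and $B_b$ for all $ab\in E(H)$. The class $\mathscr C$ has bounded expansion if for every $r$ there is $c(r)$ such that $|E(H)|\le c(r)\cdot|V(H)|$ for all depth-$r$ minors $H$ of members of $\mathscr C$. $\mathsf{AW}[\star]=\bigcup_{t\ge1}\mathsf{AW}[t]$, where $\mathsf{AW}[t]$ is the class of parameterized problems fpt-reducible to the following problem: given a Boolean formula $F$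 with $t$ alternating layers of conjunctions and disjunctions over literals, a partition of its variables into blocks $s_1,\dots,s_r$, and integers $k_1,\dots,k_r$, with parameter $r+k_1+\dots+k_r$, decide whether there is a $k_1$-subset $T_1\subseteq s_1$ such that for every $k_2$-subset $T_2\subseteq s_2$ there is a $k_3$-subset $T_3\subseteq s_3$ such that $\dots$ $F$ becomes true when exactly the variables in $T_1\cup\dots\cup T_r$ are set to true. A parameterized problem is $\mathsf{AW}[\star]$-hard if every problem in $\mathsf{AW}[\star]$ is fpt-reducible to it. Here an fpt-reduction maps instances to equivalent instances, in time $f(k)\cdot n^{O(1)}$ for instances of size $n$ and parameter $k$, such that the new parameter is at most $g(k)$, with $f$ and $g$ computable. \textbf{Corollary.} There is a class $\mathscr{C}$ of graphs with bounded expansion such that the model-checking problem for $\mathsf{FO{+}conn}$ on $\mathscr{C}$ is $\mathsf{AW}[\star]$-hard. -/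

import Mathlib

namespace SepLogic

/-! ### Random access machines

The machine model is the uniform-cost random access machine over natural numbers with addition,
truncated subtraction and halving (no multiplication), finitely many registers and finitely many
arrays, and structured control flow.  It is polynomially equivalent to Turing machines. -/

/-- Programs. `r`, `s`, `t` are names of registers and `a` is the name of an array. -/
inductive Prog : Type
  /-- do nothing -/
  | skip : Prog
  /-- `R[r] := n` -/
  | const (r n : ℕ) : Prog
  /-- `R[r] := R[s] + R[t]` -/
  | add (r s t : ℕ) : Prog
  /-- `R[r] := max (R[s] - R[t]) 0` -/
  | sub (r s t : ℕ) : Prog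
  /-- `R[r] := ⌊R[s] / 2⌋` -/
  | half (r s : ℕ) : Prog
  /-- `R[r] := A_a[R[s]]` -/
  | load (r a s : ℕ) : Prog
  /-- `A_a[R[s]] := R[r]` -/
  | store (a s r : ℕ) : Prog
  /-- first `p`, then `q` -/
  | seq (p q : Prog) : Prog
  /-- if `R[r] ≠ 0` then `p` else `q` -/
  | ite (r : ℕ) (p q : Prog) : Prog
  /-- while `R[r] ≠ 0` do `p` -/
  | loop (r : ℕ) (p : Prog) : Prog

/-- A memory state: the contents of the registers and of the cells of the arrays. -/
structure State where
  reg : ℕ → ℕ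
  arr : ℕ → ℕ → ℕ

/-- Write `v` into register `r`. -/
def State.setReg (σ : State) (r v : ℕ) : State :=
  { σ with reg := Function.update σ.reg r v }

/-- Write `v` into cell `i` of array `a`. -/
def State.setArr (σ : State) (a i v : ℕ) : State :=
  { σ with arr := Function.update σ.arr a (Function.update (σ.arr a) i v) }

/-- `Exec p σ τ c`: started in the state `σ`, the program `p` halts in the state `τ` after
exactly `c` steps. Every instruction and every test costs one step. -/
inductive Exec : Prog → State → State → ℕ → Prop
  | skip (σ : State) : Exec .skip σ σ 1
  | const (σ : State) (r n : ℕ) : Exec (.const r n) σ (σ.setReg r n) 1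
  | add (σ : State) (r s t : ℕ) : Exec (.add r s t) σ (σ.setReg r (σ.reg s + σ.reg t)) 1
  | sub (σ : State) (r s t : ℕ) : Exec (.sub r s t) σ (σ.setReg r (σ.reg s - σ.reg t)) 1
  | half (σ : State) (r s : ℕ) : Exec (.half r s) σ (σ.setReg r (σ.reg s / 2)) 1
  | load (σ : State) (r a s : ℕ) : Exec (.load r a s) σ (σ.setReg r (σ.arr a (σ.reg s))) 1
  | store (σ : State) (a s r : ℕ) :
      Exec (.store a s r) σ (σ.setArr a (σ.reg s) (σ.reg r)) 1
  | seq {p q : Prog} {σ τ ρ : State} {c d : ℕ} :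
      Exec p σ τ c → Exec q τ ρ d → Exec (.seq p q) σ ρ (c + d)
  | ite_true {r : ℕ} {p q : Prog} {σ τ : State} {c : ℕ} :
      σ.reg r ≠ 0 → Exec p σ τ c → Exec (.ite r p q) σ τ (c + 1)
  | ite_false {r : ℕ} {p q : Prog} {σ τ : State} {c : ℕ} :
      σ.reg r = 0 → Exec q σ τ c → Exec (.ite r p q) σ τ (c + 1)
  | loop_done {r : ℕ} {p : Prog} {σ : State} :
      σ.reg r = 0 → Exec (.loop r p) σ σ 1
  | loop_step {r : ℕ} {p : Prog} {σ τ ρ : State} {c d : ℕ} :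
      σ.reg r ≠ 0 → Exec p σ τ c → Exec (.loop r p) τ ρ d → Exec (.loop r p) σ ρ (c + d + 1)

/-- The start state on the word `x` and the parameter `k`: register 0 holds the length of `x`,
register 1 holds `k`, array 0 holds the bits of `x`, and everything else is zero. -/
def initState (x : List Bool) (k : ℕ) : State where
  reg r := if r = 0 then x.length else if r = 1 then k else 0
  arr a i := if a = 0 then (x.getD i false).toNat else 0

/-- The state holds the word `y` and the parameter `k` as output: register 0 holds the length
of `y`, register 1 holds `k`, and array 1 begins with the bits of `y`. -/
def IsOutput (σ : State) (y : List Bool) (k : ℕ) : Prop :=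
  σ.reg 0 = y.length ∧ σ.reg 1 = k ∧ ∀ i < y.length, σ.arr 1 i = (y.getD i false).toNat

/-! ### Parameterized problems and fpt-reductions -/

/-- A parameterized (promise) problem: a set of instances, each encoded by a binary word, with
a parameter for each instance and the set of yes-instances. -/
structure ParamProblem where
  Inst : Type
  enc : Inst → List Bool
  enc_injective : Function.Injective enc
  param : Inst → ℕ
  yes : Inst → Prop

/-- `P` is fpt-reducible to `Q`: some program turns every instance `a` of `P` into an equivalent
instance `b` of `Q` in at most `f(k) * (n + 1) ^ c` steps, where `n` is the length of the encoding
of `a` and `k` its parameter, and the parameter of `b` is at most `g(k)`; here `f` and `g` are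
computable and `c` is a constant. -/
def FptReducible (P Q : ParamProblem) : Prop :=
  ∃ (p : Prog) (f g : ℕ → ℕ) (c : ℕ), Computable f ∧ Computable g ∧
    ∀ a : P.Inst, ∃ (b : Q.Inst) (σ : State) (steps : ℕ),
      Exec p (initState (P.enc a) (P.param a)) σ steps ∧
      IsOutput σ (Q.enc b) (Q.param b) ∧
      steps ≤ f (P.param a) * ((P.enc a).length + 1) ^ c ∧
      Q.param b ≤ g (P.param a) ∧
      (P.yes a ↔ Q.yes b)

/-! ### Encodings by binary words -/

/-- The self-delimiting code `1 ... 1 0` (with `n` ones) of a natural number. -/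
def encNat (n : ℕ) : List Bool := List.replicate n true ++ [false]

/-- Encode a finite sequence of known length by concatenating the codes of its entries. -/
def encSeq {α : Type} (e : α → List Bool) {n : ℕ} (f : Fin n → α) : List Bool :=
  (List.ofFn fun i => e (f i)).flatten

/-- No code word is a proper prefix of another one, and different objects have different codes. -/
def SelfDelimiting {α : Type} (e : α → List Bool) : Prop :=
  ∀ (a b : α) (l m : List Bool), e a ++ l = e b ++ m → a = b ∧ l = m

theorem SelfDelimiting.injective {α : Type} {e : α → List Bool} (h : SelfDelimiting e) :
    Function.Injective e := fun a b hab => (h a b [] [] (by rw [hab])).1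

theorem selfDelimiting_encNat : SelfDelimiting encNat := by
  intro a
  induction a with
  | zero =>
    intro b l m h
    cases b with
    | zero => simpa [encNat] using h
    | succ b => simp [encNat, List.replicate_succ] at h
  | succ a ih =>
    intro b l m h
    cases b with
    | zero => simp [encNat, List.replicate_succ] at h
    | succ b =>
      have h2 : encNat a ++ l = encNat b ++ m := by
        simpa [encNat, List.replicate_succ] using h
      obtain ⟨h3, h4⟩ := ih b l m h2
      exact ⟨by rw [h3], h4⟩

/-- The code of a number below `n`. -/
def encFin {n : ℕ} (i : Fin n) : List Bool := encNat i

theorem selfDelimiting_encFin (n : ℕ) : SelfDelimiting (encFin (n := n)) := by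
  intro a b l m h
  obtain ⟨h1, h2⟩ := selfDelimiting_encNat a b l m h
  exact ⟨Fin.ext h1, h2⟩

theorem selfDelimiting_bit : SelfDelimiting fun b : Bool => [b] := by
  intro a b l m h
  simpa using h

theorem SelfDelimiting.encSeq {α : Type} {e : α → List Bool} (h : SelfDelimiting e) :
    ∀ n : ℕ, SelfDelimiting (SepLogic.encSeq e (n := n)) := by
  intro n
  induction n with
  | zero =>
    intro f g l m hh
    exact ⟨Subsingleton.elim _ _, by simpa [SepLogic.encSeq] using hh⟩
  | succ n ih =>
    intro f g l m hh
    simp only [SepLogic.encSeq, List.ofFn_succ, List.flatten_cons, List.append_assoc] at hh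
    obtain ⟨h1, h2⟩ := h _ _ _ _ hh
    obtain ⟨h3, h4⟩ := ih (fun i => f i.succ) (fun i => g i.succ) l m h2
    refine ⟨?_, h4⟩
    funext i
    refine Fin.cases h1 (fun j => congrFun h3 j) i

/-! ### The class AW[*]

It is defined through the alternating weighted satisfiability problems for propositional formulas
with a fixed number `t` of alternating layers of conjunctions and disjunctions. -/

/-- Formulas with `t` alternating layers of finite conjunctions and disjunctions, whose leaves
are literals: `(true, v)` is the variable `v`, and `(false, v)` is its negation. -/
def Layered (N : ℕ) : ℕ → Type
  | 0 => Bool × Fin N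
  | t + 1 => List (Layered N t)

/-- Truth when exactly the variables in `S` are true. The outermost layer is a conjunction if the
flag is `true`, and a disjunction if it is `false`. -/
def Layered.Holds {N : ℕ} (S : Finset (Fin N)) : (t : ℕ) → Bool → Layered N t → Prop
  | 0, _, l => (l.1 = true ↔ l.2 ∈ S)
  | t + 1, true, F => ∀ G ∈ (show List (Layered N t) from F), Layered.Holds S t false G
  | t + 1, false, F => ∃ G ∈ (show List (Layered N t) from F), Layered.Holds S t true G

/-- Encode a list by putting a one before each entry and a zero at the end. -/
def encList {α : Type} (e : α → List Bool) : List α → List Bool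
  | [] => [false]
  | a :: l => true :: (e a ++ encList e l)

/-- The code of a layered formula. -/
def Layered.enc {N : ℕ} : (t : ℕ) → Layered N t → List Bool
  | 0, l => l.1 :: encFin l.2
  | t + 1, F => encList (Layered.enc t) F

theorem SelfDelimiting.encList {α : Type} {e : α → List Bool} (h : SelfDelimiting e) :
    SelfDelimiting (SepLogic.encList e) := by
  intro a
  induction a with
  | nil =>
    intro b l m hh
    cases b with
    | nil => simpa [SepLogic.encList] using hh
    | cons b bs => simp [SepLogic.encList] at hh
  | cons a as ih =>
    intro b l m hh
    cases b with
    | nil => simp [SepLogic.encList] at hh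
    | cons b bs =>
      simp only [SepLogic.encList, List.cons_append, List.append_assoc, List.cons.injEq,
        true_and] at hh
      obtain ⟨h1, h2⟩ := h _ _ _ _ hh
      obtain ⟨h3, h4⟩ := ih bs l m h2
      exact ⟨by rw [h1, h3], h4⟩

theorem Layered.selfDelimiting_enc {N : ℕ} :
    ∀ t : ℕ, SelfDelimiting (Layered.enc (N := N) t) := by
  intro t
  induction t with
  | zero =>
    rintro ⟨a, v⟩ ⟨b, w⟩ l m h
    simp only [Layered.enc, List.cons_append, List.cons.injEq] at h
    obtain ⟨h1, h2⟩ := selfDelimiting_encFin N v w l m h.2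
    exact ⟨Prod.ext h.1 h1, h2⟩
  | succ t ih => exact ih.encList

/-- An instance: `N` propositional variables, partitioned into `r` blocks (`blk v` is the block
of the variable `v`), a number `k i` for each block `i`, and a formula with `t` layers. -/
structure QbfInst (t : ℕ) where
  r : ℕ
  N : ℕ
  k : Fin r → ℕ
  blk : Fin N → Fin r
  F : Layered N t

/-- `∃ T₁ ∀ T₂ ∃ T₃ ...`, where `Tᵢ` ranges over the subsets of size `k i` of the `i`-th block, for
the blocks of the list in order, followed by `φ (S ∪ T₁ ∪ T₂ ∪ ...)`. The first quantifier is
existential if the flag is `true`, and universal if it is `false`. -/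
def AltWeighted {r N : ℕ} (k : Fin r → ℕ) (blk : Fin N → Fin r) (φ : Finset (Fin N) → Prop) :
    Bool → List (Fin r) → Finset (Fin N) → Prop
  | _, [], S => φ S
  | true, i :: l, S => ∃ T : Finset (Fin N), (∀ v ∈ T, blk v = i) ∧ T.card = k i ∧
      AltWeighted k blk φ false l (S ∪ T)
  | false, i :: l, S => ∀ T : Finset (Fin N), (∀ v ∈ T, blk v = i) → T.card = k i →
      AltWeighted k blk φ true l (S ∪ T)

/-- The code of an instance. -/
def QbfInst.enc {t : ℕ} (I : QbfInst t) : List Bool :=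
  encNat I.r ++ (encNat I.N ++ (encSeq encNat I.k ++
    (encSeq encFin I.blk ++ Layered.enc t I.F)))

theorem QbfInst.enc_injective {t : ℕ} : Function.Injective (QbfInst.enc (t := t)) := by
  rintro ⟨r, N, k, blk, F⟩ ⟨r2, N2, k2, blk2, F2⟩ h
  simp only [QbfInst.enc] at h
  obtain ⟨h1, ha⟩ := selfDelimiting_encNat _ _ _ _ h
  subst h1
  obtain ⟨h1, hb⟩ := selfDelimiting_encNat _ _ _ _ ha
  subst h1
  obtain ⟨h1, hc⟩ := selfDelimiting_encNat.encSeq _ _ _ _ _ hb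
  obtain ⟨h2, hd⟩ := (selfDelimiting_encFin _).encSeq _ _ _ _ _ hc
  have h3 := (Layered.selfDelimiting_enc t).injective hd
  subst h1 h2 h3
  rfl

/-- Parameterized QBFSAT with `t` layers: is there a subset `T₁` of size `k₁` of the first block
such that for every subset `T₂` of size `k₂` of the second block there is ... such that the formula
(whose outermost layer is a conjunction) is true when exactly the variables in `T₁ ∪ ... ∪ Tᵣ` are
true? The parameter is `r + k₁ + ... + kᵣ`. -/
def qbfSat (t : ℕ) : ParamProblem where
  Inst := QbfInst t
  enc := QbfInst.enc
  enc_injective := QbfInst.enc_injective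
  param I := I.r + ∑ i, I.k i
  yes I := AltWeighted I.k I.blk (fun S => Layered.Holds S t true I.F) true (List.finRange I.r) ∅

/-- The class `AW[*] = ⋃_{t ≥ 1} AW[t]`, where `AW[t]` consists of the parameterized problems that
are fpt-reducible to parameterized QBFSAT with `t` layers. -/
def AWStar : Set ParamProblem := {P | ∃ t : ℕ, 1 ≤ t ∧ FptReducible P (qbfSat t)}

/-- `Q` is `AW[*]`-hard (under fpt-reductions). -/
def AWStarHard (Q : ParamProblem) : Prop := ∀ P ∈ AWStar, FptReducible P Q

/-! ### Separator logic -/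

/-- The relation symbols of separator logic: adjacency, and `conn_k` of arity `k + 2` for
every `k`. -/
inductive SepRel : ℕ → Type
  | adj : SepRel 2
  | conn (k : ℕ) : SepRel (k + 2)

/-- The vocabulary of separator logic FO+conn. -/
def sepLang : FirstOrder.Language.{0, 0} where
  Functions := fun _ => Empty
  Relations := SepRel

/-- `s` and `t` are joined by a path of `G` none of whose vertices (the two ends included) is
among `u 0, ..., u (k - 1)`. -/
def Conn {V : Type} (G : SimpleGraph V) {k : ℕ} (s t : V) (u : Fin k → V) : Prop :=
  ∃ p : G.Walk s t, p.IsPath ∧ ∀ i, u i ∉ p.support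

/-- The interpretation of the relation symbols in a graph. -/
def sepRelMap {V : Type} (G : SimpleGraph V) : {n : ℕ} → SepRel n → (Fin n → V) → Prop
  | _, .adj, x => G.Adj (x 0) (x 1)
  | _, .conn _, x => Conn G (x 0) (x 1) (fun i => x i.succ.succ)

/-- A graph as a structure for separator logic. -/
@[reducible]
def sepStructure {V : Type} (G : SimpleGraph V) : sepLang.Structure V where
  funMap := fun f => Empty.elim f
  RelMap := fun R x => sepRelMap G R x

/-- The sentence `φ` of FO+conn holds in the graph `G`. -/
def Models {V : Type} (G : SimpleGraph V) (φ : sepLang.Sentence) : Prop :=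
  @FirstOrder.Language.Sentence.Realize sepLang V (sepStructure G) φ

/-- The index of the variable that a term is. -/
def termIndex {n : ℕ} : sepLang.Term (Empty ⊕ Fin n) → Fin n
  | .var (.inr i) => i
  | .var (.inl e) => e.elim
  | .func f _ => Empty.elim f

theorem termIndex_injective {n : ℕ} : Function.Injective (termIndex (n := n)) := by
  intro a b h
  rcases a with (a | a) | ⟨f, _⟩
  · exact a.elim
  · rcases b with (b | b) | ⟨f, _⟩
    · exact b.elim
    · simp only [termIndex] at h
      rw [h]
    · exact Empty.elim f
  · exact Empty.elim f

/-- The code of a term. -/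
def encTerm {n : ℕ} (s : sepLang.Term (Empty ⊕ Fin n)) : List Bool := encFin (termIndex s)

/-- The code of a relation symbol. -/
def encRel {n : ℕ} : SepRel n → List Bool
  | .adj => encNat 0
  | .conn k => encNat 1 ++ encNat k

/-- The code of a formula, in prefix notation. -/
def encFormula : {n : ℕ} → sepLang.BoundedFormula Empty n → List Bool
  | _, .falsum => encNat 0
  | _, .equal s t => encNat 1 ++ (encTerm s ++ encTerm t)
  | _, .rel R ts => encNat 2 ++ (encRel (show SepRel _ from R) ++ encSeq encTerm ts)
  | _, .imp φ ψ => encNat 3 ++ (encFormula φ ++ encFormula ψ)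
  | _, .all φ => encNat 4 ++ encFormula φ

theorem selfDelimiting_encTerm {n : ℕ} : SelfDelimiting (encTerm (n := n)) := by
  intro a b l m h
  obtain ⟨h1, h2⟩ := selfDelimiting_encFin n _ _ l m h
  exact ⟨termIndex_injective h1, h2⟩

theorem encRel_append {n₁ n₂ : ℕ} (R₁ : SepRel n₁) (R₂ : SepRel n₂) (l m : List Bool)
    (h : encRel R₁ ++ l = encRel R₂ ++ m) : n₁ = n₂ ∧ HEq R₁ R₂ ∧ l = m := by
  cases R₁ with
  | adj =>
    cases R₂ with
    | adj => exact ⟨rfl, HEq.rfl, (selfDelimiting_encNat _ _ _ _ h).2⟩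
    | conn k => simp [encRel, encNat] at h
  | conn k =>
    cases R₂ with
    | adj => simp [encRel, encNat] at h
    | conn k2 =>
      simp only [encRel, List.append_assoc] at h
      obtain ⟨h1, h2⟩ := selfDelimiting_encNat _ _ _ _ (selfDelimiting_encNat _ _ _ _ h).2
      subst h1
      exact ⟨rfl, HEq.rfl, h2⟩

theorem selfDelimiting_encFormula {n : ℕ} : SelfDelimiting (encFormula (n := n)) := by
  intro φ
  induction φ with
  | falsum =>
    intro ψ l m h
    cases ψ <;> simp [encFormula, encNat] at h ⊢
    exact h
  | equal s t =>
    intro ψ l m h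
    cases ψ with
    | equal s2 t2 =>
      simp only [encFormula, List.append_assoc] at h
      obtain ⟨-, h⟩ := selfDelimiting_encNat _ _ _ _ h
      obtain ⟨h1, h⟩ := selfDelimiting_encTerm _ _ _ _ h
      obtain ⟨h2, h⟩ := selfDelimiting_encTerm _ _ _ _ h
      exact ⟨by rw [h1, h2], h⟩
    | _ => exfalso; simp [encFormula, encNat, List.replicate_succ] at h
  | rel R ts =>
    intro ψ l m h
    cases ψ with
    | rel R2 ts2 =>
      simp only [encFormula, List.append_assoc] at h
      obtain ⟨-, h⟩ := selfDelimiting_encNat _ _ _ _ h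
      obtain ⟨h1, h2, h⟩ := encRel_append _ _ _ _ h
      subst h1
      have h2 := eq_of_heq h2
      obtain ⟨h3, h⟩ := selfDelimiting_encTerm.encSeq _ _ _ _ _ h
      refine ⟨?_, h⟩
      have h4 : R = R2 := h2
      rw [h4, h3]
    | _ => exfalso; simp [encFormula, encNat, List.replicate_succ] at h
  | imp φ₁ φ₂ ih₁ ih₂ =>
    intro ψ l m h
    cases ψ with
    | imp ψ₁ ψ₂ =>
      simp only [encFormula, List.append_assoc] at h
      obtain ⟨-, h⟩ := selfDelimiting_encNat _ _ _ _ h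
      obtain ⟨h1, h⟩ := ih₁ _ _ _ h
      obtain ⟨h2, h⟩ := ih₂ _ _ _ h
      exact ⟨by rw [h1, h2], h⟩
    | _ => exfalso; simp [encFormula, encNat, List.replicate_succ] at h
  | all φ ih =>
    intro ψ l m h
    cases ψ with
    | all ψ =>
      simp only [encFormula, List.append_assoc] at h
      obtain ⟨-, h⟩ := selfDelimiting_encNat _ _ _ _ h
      obtain ⟨h1, h⟩ := ih _ _ _ h
      exact ⟨by rw [h1], h⟩
    | _ => exfalso; simp [encFormula, encNat, List.replicate_succ] at h

/-! ### Classes of graphs -/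

/-- A class of finite simple graphs, closed under isomorphism. Up to isomorphism, the vertices
are the numbers `0, ..., n - 1`. -/
structure GraphClass where
  Mem : {n : ℕ} → SimpleGraph (Fin n) → Prop
  mem_of_iso : ∀ {m n : ℕ} (G : SimpleGraph (Fin m)) (H : SimpleGraph (Fin n)),
    Nonempty (G ≃g H) → Mem G → Mem H

/-- `H` is a minor of `G` at depth `r`: there are pairwise disjoint branch sets in `G`, one for each
vertex of `H`, each of radius at most `r` around a centre, such that there is an edge of `G` between
the branch sets of any two adjacent vertices of `H`. -/
def IsShallowMinor {V W : Type} (r : ℕ) (H : SimpleGraph W) (G : SimpleGraph V) : Prop :=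
  ∃ (B : W → Set V) (centre : W → V),
    (∀ a b, a ≠ b → Disjoint (B a) (B b)) ∧
    (∀ a, ∀ v ∈ B a, ∃ p : G.Walk (centre a) v, p.length ≤ r ∧ ∀ w ∈ p.support, w ∈ B a) ∧
    (∀ a, centre a ∈ B a) ∧
    (∀ a b, H.Adj a b → ∃ v ∈ B a, ∃ w ∈ B b, G.Adj v w)

/-- `C` has bounded expansion: for every depth `r` there is a bound `c` on the edge density
`|E(H)| / |V(H)|` of all depth-`r` minors `H` of members of `C`. -/
def GraphClass.BoundedExpansion (C : GraphClass) : Prop :=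
  ∀ r : ℕ, ∃ c : ℕ, ∀ (n : ℕ) (G : SimpleGraph (Fin n)), C.Mem G →
    ∀ (m : ℕ) (H : SimpleGraph (Fin m)), IsShallowMinor r H G → H.edgeSet.ncard ≤ c * m

open Classical in
/-- The code of a graph: the number of vertices, followed by the adjacency matrix. -/
noncomputable def encGraph {n : ℕ} (G : SimpleGraph (Fin n)) : List Bool :=
  encNat n ++ encSeq (encSeq fun b : Bool => [b]) (fun i j : Fin n => decide (G.Adj i j))

/-- An instance of the model-checking problem for FO+conn on `C`: a graph from `C` and
a sentence of FO+conn. -/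
structure McInst (C : GraphClass) where
  n : ℕ
  G : SimpleGraph (Fin n)
  mem : C.Mem G
  φ : sepLang.Sentence

/-- The code of an instance. -/
noncomputable def McInst.enc {C : GraphClass} (I : McInst C) : List Bool :=
  encGraph I.G ++ encFormula I.φ

theorem McInst.enc_injective {C : GraphClass} : Function.Injective (McInst.enc (C := C)) := by
  rintro ⟨n, G, hG, φ⟩ ⟨n2, G2, hG2, φ2⟩ h
  simp only [McInst.enc, encGraph, List.append_assoc] at h
  obtain ⟨h1, ha⟩ := selfDelimiting_encNat _ _ _ _ h
  subst h1
  obtain ⟨h1, hb⟩ := (selfDelimiting_bit.encSeq n).encSeq n _ _ _ _ ha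
  have h2 : G = G2 := by
    ext i j
    simpa using congrFun (congrFun h1 i) j
  have h3 := selfDelimiting_encFormula.injective hb
  subst h2 h3
  rfl

/-- The model-checking problem for FO+conn on `C`, parameterized by the length of the sentence:
given a graph `G` in `C` and a sentence `φ`, does `φ` hold in `G`? -/
noncomputable def modelChecking (C : GraphClass) : ParamProblem where
  Inst := McInst C
  enc := McInst.enc
  enc_injective := McInst.enc_injective
  param I := (encFormula I.φ).length
  yes I := Models I.G I.φ

end SepLogic

namespace SepLogic

/-! ### A calculus of polynomially bounded programs -/

/-! Arbitrary digraphs can be hidden in very sparse graphs in such a way that connectivity under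
vertex deletion still sees their arcs. Given a digraph `D` on a finite set `δ`, `arcGraph` replaces
each arc by a path with `L` inner vertices, joins the last inner vertex to a vertex `Z`, and joins a
vertex `R` to all of `δ`. If `w` is the last inner vertex of an arc into `y`, then without `y` and
`Z` the path of `w` can be left only at the tail of the arc. So `x` is the tail if and only if `w`
reaches `x` without `y` and `Z`, but no longer reaches `R` when `x` is deleted as well
(`arcSem_arcGraph`). A vertex `q` makes `R`, `Z`, `q` the only triangle, and a unique source of `D`
fixes both the roles inside the triangle and a starting position (`anchored_arcGraph`).

Sparsity. If `L` is at least the size of `δ`, then after the deletion of `R`, `Z`, `q` all vertices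
outside `δ` have degree at most two, and the elements of `δ` are at distance at least their number.
In a depth-`r` minor of such a graph, at most three branch sets meet the deleted vertices. A branch
set all of whose vertices have degree at most two sends out at most two edges. An edge between two
branch sets that meet `δ` yields a walk of length at most `4 * r + 1` between elements of `δ`, which
bounds the size of `δ` (`sparseClass_boundedExpansion`).

Hardness. An instance of `qbfSat t` becomes a game on a digraph (`Arena.arc`). First `K = k₁ + ... +
kᵣ` moves pick variables, in increasing order inside each block, so that the moves for a block
amount to the choice of a subset (`steps_pick`). A forced move leads to the root of the formula, and
`t` further moves descend to a literal. From a literal there are arcs to all picks of its variable,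
and to the preceding column if the literal is positive; so the literal is true if and only if having
an arc to the previous position is equivalent to having one to an earlier position
(`Arena.Fits.play_leaf`). The sentence `mainF` plays this game by quantifying along arcs, and its
length is bounded in terms of `K + t`.

Time. Machines that compute the reduction are assembled from polynomial time functions, predicates
and output routines (`Ctx.Fn`, `Ctx.Dec`, `Ctx.Gen`). They have to run after an arbitrary reduction
to `qbfSat t`, whose output could be much longer than its running time, because unwritten cells
count as zeros. It cannot contain more ones than there were steps, however, and in the code of an
instance the ones make up a constant proportion, up to an additive constant (`count_le_steps`,
`QbfInst.length_enc_le`). -/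

/-- Started in a state satisfying `pre a`, the program `p` reaches a state related to the start
state by `post a` within a number of steps that is polynomial in `bnd a`. -/
def Runs {α : Type} (bnd : α → ℕ) (pre : α → State → Prop) (p : Prog)
    (post : α → State → State → Prop) : Prop :=
  ∃ C d : ℕ, ∀ a σ, pre a σ → ∃ τ c, Exec p σ τ c ∧ c ≤ C * (bnd a + 1) ^ d ∧ post a σ τ

theorem poly_add_le (C₁ C₂ d₁ d₂ b : ℕ) :
    C₁ * (b + 1) ^ d₁ + C₂ * (b + 1) ^ d₂ ≤ (C₁ + C₂) * (b + 1) ^ (d₁ + d₂) := by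
  rw [add_mul]
  gcongr <;> omega

theorem Runs.of_exec {α : Type} {bnd : α → ℕ} {pre : α → State → Prop} {p : Prog}
    {post : α → State → State → Prop} (C : ℕ) (F : State → State)
    (h : ∀ a σ, pre a σ → Exec p σ (F σ) C) (hp : ∀ a σ, pre a σ → post a σ (F σ)) :
    Runs bnd pre p post :=
  ⟨C, 0, fun a σ ha => ⟨F σ, C, h a σ ha, by simp, hp a σ ha⟩⟩

theorem Runs.seq {α : Type} {bnd : α → ℕ} {pre pre' : α → State → Prop} {p q : Prog}
    {mid post' post : α → State → State → Prop}
    (hp : Runs bnd pre p mid) (hq : Runs bnd pre' q post')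
    (h₁ : ∀ a σ τ, pre a σ → mid a σ τ → pre' a τ)
    (h₂ : ∀ a σ τ ρ, pre a σ → mid a σ τ → post' a τ ρ → post a σ ρ) :
    Runs bnd pre (.seq p q) post := by
  obtain ⟨C₁, d₁, hp⟩ := hp
  obtain ⟨C₂, d₂, hq⟩ := hq
  refine ⟨C₁ + C₂, d₁ + d₂, fun a σ ha => ?_⟩
  obtain ⟨τ, c, e₁, hc, m⟩ := hp a σ ha
  obtain ⟨ρ, c', e₂, hc', m'⟩ := hq a τ (h₁ a σ τ ha m)
  exact ⟨ρ, c + c', .seq e₁ e₂,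
    (add_le_add hc hc').trans (poly_add_le _ _ _ _ _), h₂ a σ τ ρ ha m m'⟩

theorem Runs.ite {α : Type} {bnd : α → ℕ} {pre : α → State → Prop} {p q : Prog} {r : ℕ}
    {post : α → State → State → Prop}
    (hp : Runs bnd (fun a σ => pre a σ ∧ σ.reg r ≠ 0) p post)
    (hq : Runs bnd (fun a σ => pre a σ ∧ σ.reg r = 0) q post) :
    Runs bnd pre (.ite r p q) post := by
  obtain ⟨C₁, d₁, hp⟩ := hp
  obtain ⟨C₂, d₂, hq⟩ := hq
  refine ⟨C₁ + C₂ + 1, d₁ + d₂, fun a σ ha => ?_⟩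
  have key := poly_add_le C₁ C₂ d₁ d₂ (bnd a)
  have one : 1 ≤ (bnd a + 1) ^ (d₁ + d₂) := Nat.one_le_pow _ _ (by omega)
  by_cases h : σ.reg r = 0
  · obtain ⟨τ, c, e, hc, m⟩ := hq a σ ⟨ha, h⟩
    refine ⟨τ, c + 1, .ite_false h e, ?_, m⟩
    rw [add_mul, one_mul]
    have := Nat.zero_le (C₁ * (bnd a + 1) ^ d₁)
    omega
  · obtain ⟨τ, c, e, hc, m⟩ := hp a σ ⟨ha, h⟩
    refine ⟨τ, c + 1, .ite_true h e, ?_, m⟩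
    rw [add_mul, one_mul]
    have := Nat.zero_le (C₂ * (bnd a + 1) ^ d₂)
    omega

/-- Induction on the number of remaining rounds. The loop register counts down from `N`, so exactly
`N` rounds take place; each costs the body and a test, and the failing test adds one. -/
theorem exec_loop {p : Prog} {r N T : ℕ} {I : ℕ → State → Prop}
    (hr : ∀ i σ, i ≤ N → I i σ → σ.reg r = N - i)
    (hp : ∀ i σ, i < N → I i σ → ∃ τ c, Exec p σ τ c ∧ c ≤ T ∧ I (i + 1) τ) {σ : State}
    (h : I 0 σ) : ∃ τ c, Exec (.loop r p) σ τ c ∧ c ≤ N * (T + 1) + 1 ∧ I N τ := by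
  suffices H : ∀ k i σ, i + k = N → I i σ →
      ∃ τ c, Exec (.loop r p) σ τ c ∧ c ≤ k * (T + 1) + 1 ∧ I N τ from H N 0 σ (by omega) h
  intro k
  induction k with
  | zero =>
    intro i σ hi h
    have : i = N := by omega
    subst this
    exact ⟨σ, 1, .loop_done (by rw [hr i σ le_rfl h]; omega), by omega, h⟩
  | succ k ih =>
    intro i σ hi h
    obtain ⟨τ, c, e, hc, h'⟩ := hp i σ (by omega) h
    obtain ⟨ρ, c', e', hc', h''⟩ := ih (i + 1) τ (by omega) h'
    refine ⟨ρ, c + c' + 1, .loop_step (by rw [hr i σ (by omega) h]; omega) e e', ?_, h''⟩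
    rw [Nat.succ_mul]
    omega

/-- The body is indexed by `α × State × ℕ`: its specification may mention the state at loop entry
and the round, while its polynomial bound is uniform in both. The loop then raises the degree only
by one. -/
theorem Runs.loop {α : Type} {bnd : α → ℕ} {pre : α → State → Prop} {p : Prog} {r : ℕ}
    {post : α → State → State → Prop} (N : α → ℕ) (I : α → State → ℕ → State → Prop)
    (hN : ∀ a, N a ≤ bnd a)
    (hr : ∀ a σ i τ, i ≤ N a → I a σ i τ → τ.reg r = N a - i)
    (hp : Runs (fun x : α × State × ℕ => bnd x.1)
      (fun x τ => x.2.2 < N x.1 ∧ I x.1 x.2.1 x.2.2 τ) p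
      (fun x _ ρ => I x.1 x.2.1 (x.2.2 + 1) ρ))
    (h₀ : ∀ a σ, pre a σ → I a σ 0 σ) (h₁ : ∀ a σ τ, pre a σ → I a σ (N a) τ → post a σ τ) :
    Runs bnd pre (.loop r p) post := by
  obtain ⟨C, d, hp⟩ := hp
  refine ⟨C + 2, d + 1, fun a σ ha => ?_⟩
  obtain ⟨τ, c, e, hc, hI⟩ := exec_loop (p := p) (r := r) (N := N a)
    (T := C * (bnd a + 1) ^ d) (I := I a σ) (hr a σ)
    (fun i τ hi h => hp (a, σ, i) τ ⟨hi, h⟩) (h₀ a σ ha)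
  refine ⟨τ, c, e, hc.trans ?_, h₁ a σ τ ha hI⟩
  have h1 := hN a
  have one : 1 ≤ (bnd a + 1) ^ d := Nat.one_le_pow _ _ (by omega)
  calc N a * (C * (bnd a + 1) ^ d + 1) + 1
      ≤ bnd a * (C * (bnd a + 1) ^ d + 1) + 1 := by gcongr
    _ ≤ (C + 2) * (bnd a + 1) ^ (d + 1) := by
      rw [pow_succ]
      generalize (bnd a + 1) ^ d = e at one
      nlinarith [Nat.zero_le (bnd a), Nat.zero_le (C * e), Nat.mul_le_mul_left (bnd a) one]

theorem Runs.reindex {α β : Type} {bnd : α → ℕ} {pre : α → State → Prop} {p : Prog}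
    {post : α → State → State → Prop} (h : Runs bnd pre p post) (f : β → α) :
    Runs (fun b => bnd (f b)) (fun b => pre (f b)) p (fun b => post (f b)) := by
  obtain ⟨C, d, h⟩ := h
  exact ⟨C, d, fun b => h (f b)⟩

theorem Runs.mono {α : Type} {bnd : α → ℕ} {pre pre' : α → State → Prop} {p : Prog}
    {post post' : α → State → State → Prop} (h : Runs bnd pre p post)
    (h₁ : ∀ a σ, pre' a σ → pre a σ) (h₂ : ∀ a σ τ, pre' a σ → post a σ τ → post' a σ τ) :
    Runs bnd pre' p post' := by
  obtain ⟨C, d, h⟩ := h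
  refine ⟨C, d, fun a σ ha => ?_⟩
  obtain ⟨τ, c, e, hc, hm⟩ := h a σ (h₁ a σ ha)
  exact ⟨τ, c, e, hc, h₂ a σ τ ha hm⟩

theorem Runs.copy {α : Type} {bnd : α → ℕ} {pre : α → State → Prop} (n r : ℕ) (h : r ≠ n) :
    Runs bnd pre (.seq (.const n 0) (.add n r n)) (fun _ σ τ => τ = σ.setReg n (σ.reg r)) := by
  refine Runs.of_exec 2 (fun σ => σ.setReg n (σ.reg r)) (fun a σ _ => ?_) (fun _ _ _ => rfl)
  have := Exec.seq (Exec.const σ n 0) (Exec.add (σ.setReg n 0) n r n)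
  convert this using 1
  simp [State.setReg, h]

/-! ### Contexts -/

/-- A description of the part of the memory that holds the data a computation may use: the
input word in array 2, its length in register 2, a bound for all loops in register 3,
and further variables in registers below `lvl`. -/
structure Ctx (α : Type) where
  word : α → List Bool
  bnd : α → ℕ
  lvl : ℕ
  rep : α → State → Prop
  four_le : 4 ≤ lvl
  reg_two : ∀ {a σ}, rep a σ → σ.reg 2 = (word a).length
  reg_three : ∀ {a σ}, rep a σ → σ.reg 3 = bnd a
  arr_two : ∀ {a σ}, rep a σ → ∀ i < (word a).length, σ.arr 2 i = ((word a).getD i false).toNat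
  -- Registers 0 and 1 and array 1 are left out, so that output can be written without disturbing
  -- the data.
  congr : ∀ {a σ τ}, rep a σ → τ.arr 2 = σ.arr 2 →
    (∀ r, 2 ≤ r → r < lvl → τ.reg r = σ.reg r) → rep a τ

/-- Add a variable, which is kept in register `n`. -/
def Ctx.push {α : Type} (Γ : Ctx α) (n : ℕ) (h : Γ.lvl ≤ n) : Ctx (α × ℕ) where
  word x := Γ.word x.1
  bnd x := Γ.bnd x.1
  lvl := n + 1
  rep x σ := Γ.rep x.1 σ ∧ σ.reg n = x.2
  four_le := by have := Γ.four_le; omega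
  reg_two h := Γ.reg_two h.1
  reg_three h := Γ.reg_three h.1
  arr_two h := Γ.arr_two h.1
  congr := by
    intro a σ τ hr ha hreg
    have := Γ.four_le
    exact ⟨Γ.congr hr.1 ha fun r h1 h2 => hreg r h1 (by omega),
      by rw [hreg n (by omega) (by omega), hr.2]⟩

/-- The function `f` is computable in polynomial time in the context `Γ`. -/
def Ctx.Fn {α : Type} (Γ : Ctx α) (f : α → ℕ) : Prop :=
  ∀ n, Γ.lvl ≤ n → ∃ p, Runs Γ.bnd Γ.rep p
    (fun a σ τ => τ.arr = σ.arr ∧ (∀ r < n, τ.reg r = σ.reg r) ∧ τ.reg n = f a)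

namespace Ctx

variable {α : Type} {Γ : Ctx α} {f g : α → ℕ}

theorem Fn.congr (hf : Γ.Fn f) (h : ∀ a, f a = g a) : Γ.Fn g := by
  have : f = g := funext h
  rwa [← this]

theorem Fn.weaken (hf : Γ.Fn f) {n : ℕ} {h : Γ.lvl ≤ n} : (Γ.push n h).Fn fun x => f x.1 := by
  intro m hm
  have hm' : n + 1 ≤ m := hm
  obtain ⟨p, hp⟩ := hf m (by omega)
  exact ⟨p, (hp.reindex Prod.fst).mono (fun a σ ha => ha.1) (fun _ _ _ _ h => h)⟩

theorem fn_const (k : ℕ) : Γ.Fn fun _ => k := fun n _ =>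
  ⟨.const n k, Runs.of_exec 1 (fun σ => σ.setReg n k) (fun _ σ _ => .const σ n k)
    fun _ σ _ => ⟨rfl, fun r hr => by simp [State.setReg, hr.ne], by simp [State.setReg]⟩⟩

theorem fn_reg {k : ℕ} (hk : k < Γ.lvl) (h : ∀ a σ, Γ.rep a σ → σ.reg k = f a) : Γ.Fn f :=
  fun n hn => ⟨_, (Runs.copy n k (by omega)).mono (fun _ _ h => h) fun a σ τ ha hτ => by
    subst hτ
    exact ⟨rfl, fun r hr => by simp [State.setReg, hr.ne], by simp [State.setReg, h a σ ha]⟩⟩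

theorem fn_bnd : Γ.Fn Γ.bnd :=
  fn_reg (k := 3) (by have := Γ.four_le; omega) fun _ _ h => Γ.reg_three h

theorem fn_len : Γ.Fn fun a => (Γ.word a).length :=
  fn_reg (k := 2) (by have := Γ.four_le; omega) fun _ _ h => Γ.reg_two h

theorem fn_var {n : ℕ} {h : Γ.lvl ≤ n} : (Γ.push n h).Fn fun x => x.2 :=
  fn_reg (k := n) (Nat.lt_succ_self n) fun _ _ h => h.2

/-- Compute two values in consecutive registers and combine them. -/
theorem Fn.binop (hf : Γ.Fn f) (hg : Γ.Fn g) (op : ℕ → Prog) (F : ℕ → ℕ → ℕ)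
    (hop : ∀ n σ, Exec (op n) σ (σ.setReg n (F (σ.reg n) (σ.reg (n + 1)))) 1) :
    Γ.Fn fun a => F (f a) (g a) := by
  intro n hn
  obtain ⟨p, hp⟩ := hf n hn
  obtain ⟨q, hq⟩ := hg (n + 1) (by omega)
  have hop' : Runs Γ.bnd (fun _ _ => True) (op n)
      (fun _ σ τ => τ = σ.setReg n (F (σ.reg n) (σ.reg (n + 1)))) :=
    Runs.of_exec 1 (fun σ => σ.setReg n (F (σ.reg n) (σ.reg (n + 1))))
      (fun _ σ _ => hop n σ) (fun _ _ _ => rfl)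
  refine ⟨.seq p (.seq q (op n)), hp.seq (hq.seq hop' (fun _ _ _ _ _ => trivial)
    (post := fun a σ τ => τ.arr = σ.arr ∧ (∀ r < n, τ.reg r = σ.reg r) ∧
      τ.reg n = F (σ.reg n) (g a)) ?_) ?_ ?_⟩
  · rintro a σ τ ρ - ⟨h1, h2, h3⟩ rfl
    refine ⟨h1, fun r hr => ?_, ?_⟩
    · simp [State.setReg, hr.ne, h2 r (by omega)]
    · simp [State.setReg, h2 n (by omega), h3]
  · rintro a σ τ h ⟨h1, h2, -⟩
    exact Γ.congr h (by rw [h1]) fun r _ hr => h2 r (by omega)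
  · rintro a σ τ ρ - ⟨h1, h2, h3⟩ ⟨h4, h5, h6⟩
    exact ⟨h4.trans h1, fun r hr => (h5 r hr).trans (h2 r hr), by rw [h6, h3]⟩

theorem Fn.add (hf : Γ.Fn f) (hg : Γ.Fn g) : Γ.Fn fun a => f a + g a :=
  hf.binop hg (fun n => .add n n (n + 1)) (· + ·) fun n σ => .add σ n n (n + 1)

theorem Fn.sub (hf : Γ.Fn f) (hg : Γ.Fn g) : Γ.Fn fun a => f a - g a :=
  hf.binop hg (fun n => .sub n n (n + 1)) (· - ·) fun n σ => .sub σ n n (n + 1)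

/-- A predicate is decidable in polynomial time in the context `Γ`. -/
def Dec (Γ : Ctx α) (P : α → Prop) : Prop := ∃ c : α → ℕ, Γ.Fn c ∧ ∀ a, P a ↔ c a ≠ 0

open Classical in
theorem Fn.ite {P : α → Prop} (hP : Γ.Dec P) (hf : Γ.Fn f) (hg : Γ.Fn g) :
    Γ.Fn fun a => if P a then f a else g a := by
  obtain ⟨c, hc, hPc⟩ := hP
  intro n hn
  obtain ⟨o, ho⟩ := hc n hn
  obtain ⟨p, hp⟩ := hf n hn
  obtain ⟨q, hq⟩ := hg n hn
  refine ⟨.seq o (.ite n p q), ho.seq (pre' := fun a σ => Γ.rep a σ ∧ σ.reg n = c a)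
    (post' := fun a σ τ => τ.arr = σ.arr ∧ (∀ r < n, τ.reg r = σ.reg r) ∧
      τ.reg n = if P a then f a else g a) (Runs.ite ?_ ?_) ?_ ?_⟩
  · refine hp.mono (fun a σ h => h.1.1) ?_
    rintro a σ τ ⟨⟨-, h0⟩, h⟩ ⟨h1, h2, h3⟩
    exact ⟨h1, h2, by rw [h3, if_pos ((hPc a).2 (h0 ▸ h))]⟩
  · refine hq.mono (fun a σ h => h.1.1) ?_
    rintro a σ τ ⟨⟨-, h0⟩, h⟩ ⟨h1, h2, h3⟩
    exact ⟨h1, h2, by rw [h3, if_neg fun h' => (hPc a).1 h' (h0 ▸ h)]⟩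
  · rintro a σ τ h ⟨h1, h2, h3⟩
    exact ⟨Γ.congr h (by rw [h1]) fun r _ hr => h2 r (by omega), h3⟩
  · rintro a σ τ ρ - ⟨h1, h2, h3⟩ ⟨h4, h5, h6⟩
    exact ⟨h4.trans h1, fun r hr => (h5 r hr).trans (h2 r hr), h6⟩

theorem Fn.bit (hf : Γ.Fn f) : Γ.Fn fun a => ((Γ.word a).getD (f a) false).toNat := by
  intro n hn
  have h4 := Γ.four_le
  obtain ⟨p, hp⟩ := hf n hn
  -- Array 2 is specified only up to the length of the word, so the position is first compared with
  -- the length; beyond the end the value is 0, in agreement with `getD`.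
  refine ⟨.seq p (.seq (.sub (n + 1) 2 n) (.ite (n + 1) (.load n 2 n) (.const n 0))),
    hp.seq (pre' := fun a σ => Γ.rep a σ ∧ σ.reg n = f a)
    (post' := fun a σ τ => τ.arr = σ.arr ∧ (∀ r < n, τ.reg r = σ.reg r) ∧
      τ.reg n = ((Γ.word a).getD (f a) false).toNat) ?_ ?_ ?_⟩
  · refine Runs.of_exec 3 (fun σ => if σ.reg n < σ.reg 2 then
      (σ.setReg (n + 1) (σ.reg 2 - σ.reg n)).setReg n (σ.arr 2 (σ.reg n)) else
      (σ.setReg (n + 1) (σ.reg 2 - σ.reg n)).setReg n 0) ?_ ?_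
    · intro a σ h
      split_ifs with hlt
      · refine Exec.seq (c := 1) (d := 2) (.sub σ (n + 1) 2 n) (Exec.ite_true (c := 1) ?_ ?_)
        · simp [State.setReg]; omega
        · convert Exec.load (σ.setReg (n + 1) (σ.reg 2 - σ.reg n)) n 2 n using 1
          simp [State.setReg]
      · exact Exec.seq (c := 1) (d := 2) (.sub σ (n + 1) 2 n) (Exec.ite_false (c := 1) (by simp [State.setReg]; omega) (.const _ _ _))
    · rintro a σ ⟨h, h0⟩
      have h2 := Γ.reg_two h
      have h3 := Γ.arr_two h
      split_ifs with hlt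
      · refine ⟨rfl, fun r hr => ?_, ?_⟩
        · simp [State.setReg, hr.ne, (show r ≠ n + 1 by omega)]
        · simp only [State.setReg, Function.update_self]
          rw [h3 _ (by omega), h0]
      · refine ⟨rfl, fun r hr => ?_, ?_⟩
        · simp [State.setReg, hr.ne, (show r ≠ n + 1 by omega)]
        · simp only [State.setReg, Function.update_self]
          rw [List.getD_eq_default _ _ (by omega)]
          rfl
  · rintro a σ τ h ⟨h1, h2, h3⟩
    exact ⟨Γ.congr h (by rw [h1]) fun r _ hr => h2 r (by omega), h3⟩
  · rintro a σ τ ρ - ⟨h1, h2, h3⟩ ⟨h4, h5, h6⟩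
    exact ⟨h4.trans h1, fun r hr => (h5 r hr).trans (h2 r hr), h6⟩

/-- Increment register `n`, decrement register `n + 1`; register `n + 2` is scratch space. -/
def tick (n : ℕ) : Prog :=
  .seq (.const (n + 2) 1) (.seq (.add n n (n + 2)) (.sub (n + 1) (n + 1) (n + 2)))

theorem exec_tick (n : ℕ) (σ : State) : Exec (tick n) σ
    (((σ.setReg (n + 2) 1).setReg n (σ.reg n + 1)).setReg (n + 1) (σ.reg (n + 1) - 1)) 3 := by
  have := Exec.seq (Exec.const σ (n + 2) 1) (Exec.seq (Exec.add _ n n (n + 2))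
    (Exec.sub _ (n + 1) (n + 1) (n + 2)))
  convert this using 1
  · rfl
  · simp [State.setReg]

theorem runs_tick {bnd : α → ℕ} {pre : α → State → Prop} (n : ℕ) :
    Runs bnd pre (tick n) fun _ σ τ =>
      τ.arr = σ.arr ∧ (∀ r < n, τ.reg r = σ.reg r) ∧ τ.reg n = σ.reg n + 1 ∧
        τ.reg (n + 1) = σ.reg (n + 1) - 1 :=
  Runs.of_exec 3 _ (fun _ σ _ => exec_tick n σ) fun _ σ _ =>
    ⟨rfl, fun r hr => by
      simp [State.setReg, hr.ne, (show r ≠ n + 1 by omega), (show r ≠ n + 2 by omega)],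
      by simp [State.setReg], by simp [State.setReg]⟩

/-- Primitive recursion with at most `bnd` iterations. -/
theorem Fn.rec {cnt : α → ℕ} {step : (α × ℕ) × ℕ → ℕ} (hf : Γ.Fn f) (hc : Γ.Fn cnt)
    (hle : ∀ a, cnt a ≤ Γ.bnd a)
    (hs : ∀ n (h : Γ.lvl ≤ n), ((Γ.push n h).push (n + 1) le_rfl).Fn step) :
    Γ.Fn fun a => Nat.rec (motive := fun _ => ℕ) (f a) (fun i acc => step ((a, acc), i))
      (cnt a) := by
  intro n hn
  -- Register `n` holds the accumulator, `n + 1` the round, `n + 2` the number of rounds left, and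
  -- `n + 3` receives the value of `step`, which sees only the first two as variables.
  obtain ⟨p, hp⟩ := hf n hn
  obtain ⟨q, hq⟩ := hc (n + 2) (by omega)
  obtain ⟨s, hs⟩ := hs n hn (n + 3) (Nat.le_succ _)
  let R : α → ℕ → ℕ := fun a i =>
    Nat.rec (motive := fun _ => ℕ) (f a) (fun i acc => step ((a, acc), i)) i
  let J : α → State → ℕ → State → Prop := fun a σ i τ =>
    Γ.rep a τ ∧ τ.arr = σ.arr ∧ (∀ r < n, τ.reg r = σ.reg r) ∧ τ.reg n = R a i ∧
      τ.reg (n + 1) = i ∧ τ.reg (n + 2) = cnt a - i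
  have hz : Runs Γ.bnd (fun _ _ => True) (.const (n + 1) 0)
      (fun _ σ τ => τ = σ.setReg (n + 1) 0) :=
    Runs.of_exec 1 _ (fun _ σ _ => .const σ (n + 1) 0) (fun _ _ _ => rfl)
  have hbody : Runs (fun x : α × State × ℕ => Γ.bnd x.1)
      (fun x τ => x.2.2 < cnt x.1 ∧ J x.1 x.2.1 x.2.2 τ)
      (.seq s (.seq (.seq (.const n 0) (.add n (n + 3) n)) (tick (n + 1))))
      (fun x _ ρ => J x.1 x.2.1 (x.2.2 + 1) ρ) := by
    refine ((hs.reindex fun x : α × State × ℕ => ((x.1, R x.1 x.2.2), x.2.2)).mono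
      (pre' := fun x τ => x.2.2 < cnt x.1 ∧ J x.1 x.2.1 x.2.2 τ)
      ?_ (fun _ _ _ _ h => h)).seq
      (((Runs.copy (pre := fun _ _ => True) n (n + 3) (by omega)).seq
      (runs_tick (pre := fun _ _ => True) (n + 1))
      (fun _ _ _ _ _ => trivial) (post := fun _ σ τ => τ.arr = σ.arr ∧
        (∀ r < n, τ.reg r = σ.reg r) ∧ τ.reg n = σ.reg (n + 3) ∧
        τ.reg (n + 1) = σ.reg (n + 1) + 1 ∧ τ.reg (n + 2) = σ.reg (n + 2) - 1) ?_))
        (fun _ _ _ _ _ => trivial) ?_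
    · rintro ⟨a, σ, i⟩ τ ⟨-, h1, -, -, h2, h3, -⟩
      exact ⟨⟨h1, h2⟩, h3⟩
    · rintro ⟨a, σ₀, i⟩ σ τ ρ - rfl ⟨h1, h2, h3, h4⟩
      refine ⟨h1, fun r hr => ?_, ?_, ?_, ?_⟩
      · rw [h2 r (by omega)]; simp [State.setReg, hr.ne]
      · rw [h2 n (by omega)]; simp [State.setReg]
      · rw [h3]; simp [State.setReg]
      · rw [h4]; simp [State.setReg, (show n + 1 + 1 ≠ n by omega)]
    · rintro ⟨a, σ₀, i⟩ σ τ ρ ⟨-, h1, h2, h3, h4, h5, h6⟩ ⟨h7, h8, h9⟩ ⟨h10, h11, h12, h13, h14⟩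
      refine ⟨Γ.congr h1 (by rw [h10, h7]) fun r _ hr => ?_, h10.trans (h7.trans h2),
        fun r hr => ?_, ?_, ?_, ?_⟩
      · rw [h11 r (by omega), h8 r (by omega)]
      · rw [h11 r (by omega), h8 r (by omega), h3 r (by omega)]
      · rw [h12, h9]
      · rw [h13, h8 _ (by omega), h5]
      · rw [h14, h8 _ (by omega), h6]; simp only; omega
  refine ⟨.seq p (.seq q (.seq (.const (n + 1) 0) (.loop (n + 2) _))),
    hp.seq (pre' := fun a σ => Γ.rep a σ ∧ σ.reg n = f a) (hq.mono (fun _ _ h => h.1)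
      (fun _ _ _ _ h => h) |>.seq
      (pre' := fun a σ => Γ.rep a σ ∧ σ.reg n = f a ∧ σ.reg (n + 2) = cnt a)
      ((hz.mono (fun _ _ _ => trivial) (fun _ _ _ _ h => h)).seq
        (pre' := fun a σ => Γ.rep a σ ∧ σ.reg n = f a ∧ σ.reg (n + 2) = cnt a ∧ σ.reg (n + 1) = 0)
        (Runs.loop (bnd := Γ.bnd) cnt J hle (fun a σ i τ _ h => h.2.2.2.2.2) hbody
        (post := fun a σ τ => τ.arr = σ.arr ∧ (∀ r < n, τ.reg r = σ.reg r) ∧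
          τ.reg n = R a (cnt a)) ?_ ?_)
        (post := fun a σ τ => τ.arr = σ.arr ∧ (∀ r < n, τ.reg r = σ.reg r) ∧
          τ.reg n = R a (cnt a)) ?_ ?_) 
      (post := fun a σ τ => τ.arr = σ.arr ∧ (∀ r < n, τ.reg r = σ.reg r) ∧
          τ.reg n = R a (cnt a)) ?_ ?_) ?_ ?_⟩
  · rintro a σ ⟨h1, h2, h3, h4⟩
    exact ⟨h1, rfl, fun _ _ => rfl, h2, h4, by rw [h3]; rfl⟩
  · rintro a σ τ - ⟨-, h1, h2, h3, -⟩
    exact ⟨h1, h2, h3⟩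
  · rintro a σ τ ⟨h1, h2, h3⟩ rfl
    refine ⟨Γ.congr h1 rfl fun r _ hr => ?_, ?_, ?_, ?_⟩
    · simp [State.setReg, (show r ≠ n + 1 by omega)]
    · simp [State.setReg, h2]
    · simp [State.setReg, h3]
    · simp [State.setReg]
  · rintro a σ τ ρ - rfl ⟨h1, h2, h3⟩
    refine ⟨h1, fun r hr => ?_, h3⟩
    rw [h2 r hr]
    simp [State.setReg, (show r ≠ n + 1 by omega)]
  · rintro a σ τ ⟨h1, h2⟩ ⟨h3, h4, h5⟩
    exact ⟨Γ.congr h1 (by rw [h3]) fun r _ hr => h4 r (by omega), by rw [h4 n (by omega), h2], h5⟩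
  · rintro a σ τ ρ - ⟨h1, h2, -⟩ ⟨h4, h5, h6⟩
    exact ⟨h4.trans h1, fun r hr => (h5 r hr).trans (h2 r (by omega)), h6⟩
  · rintro a σ τ h ⟨h1, h2, h3⟩
    exact ⟨Γ.congr h (by rw [h1]) fun r _ hr => h2 r (by omega), h3⟩
  · rintro a σ τ ρ - ⟨h1, h2, -⟩ ⟨h4, h5, h6⟩
    exact ⟨h4.trans h1, fun r hr => (h5 r hr).trans (h2 r hr), h6⟩

end Ctx

end SepLogic

namespace SepLogic

namespace Ctx

variable {α : Type} {Γ : Ctx α} {f g : α → ℕ}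

/-! ### Decidable predicates -/

theorem Dec.congr {P Q : α → Prop} (hP : Γ.Dec P) (h : ∀ a, P a ↔ Q a) : Γ.Dec Q := by
  have : P = Q := funext fun a => propext (h a)
  rwa [← this]

theorem Fn.ltDec (hf : Γ.Fn f) (hg : Γ.Fn g) : Γ.Dec fun a => f a < g a :=
  ⟨_, hg.sub hf, fun a => by omega⟩

theorem Fn.leDec (hf : Γ.Fn f) (hg : Γ.Fn g) : Γ.Dec fun a => f a ≤ g a :=
  ⟨_, (hg.add (fn_const 1)).sub hf, fun a => by omega⟩

theorem Dec.not {P : α → Prop} (hP : Γ.Dec P) : Γ.Dec fun a => ¬P a := by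
  obtain ⟨c, hc, h⟩ := hP
  exact ⟨_, (fn_const 1).sub hc, fun a => (not_congr (h a)).trans (by omega)⟩

theorem Dec.and {P Q : α → Prop} (hP : Γ.Dec P) (hQ : Γ.Dec Q) : Γ.Dec fun a => P a ∧ Q a := by
  classical
  obtain ⟨c, hc, h⟩ := hP
  obtain ⟨d, hd, h'⟩ := hQ
  refine ⟨_, Fn.ite ⟨c, hc, h⟩ hd (fn_const 0), fun a => ?_⟩
  by_cases hp : P a <;> simp [hp, h' a]

theorem Dec.or {P Q : α → Prop} (hP : Γ.Dec P) (hQ : Γ.Dec Q) : Γ.Dec fun a => P a ∨ Q a :=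
  (hP.not.and hQ.not).not.congr fun a => by tauto

theorem Dec.imp {P Q : α → Prop} (hP : Γ.Dec P) (hQ : Γ.Dec Q) : Γ.Dec fun a => P a → Q a :=
  (hP.and hQ.not).not.congr fun a => by tauto

theorem Fn.eqDec (hf : Γ.Fn f) (hg : Γ.Fn g) : Γ.Dec fun a => f a = g a :=
  ((hf.leDec hg).and (hg.leDec hf)).congr fun a => by omega

theorem Dec.bot : Γ.Dec fun _ => False := ⟨_, fn_const 0, fun _ => by simp⟩

theorem Fn.bitDec (hf : Γ.Fn f) : Γ.Dec fun a => (Γ.word a).getD (f a) false = true :=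
  ⟨_, hf.bit, fun a => by
    dsimp only
    generalize (Γ.word a).getD (f a) false = b
    cases b <;> decide⟩

theorem Dec.ex {cnt : α → ℕ} {P : α × ℕ → Prop} (hc : Γ.Fn cnt) (hle : ∀ a, cnt a ≤ Γ.bnd a)
    (hP : ∀ n (h : Γ.lvl ≤ n), (Γ.push n h).Dec P) : Γ.Dec fun a => ∃ i < cnt a, P (a, i) := by
  classical
  refine ⟨_, Fn.rec (fn_const 0) hc hle
    (step := fun x => if P (x.1.1, x.2) then 1 else x.1.2) fun n h => Fn.ite ?_ (fn_const 1)
      fn_var.weaken, fun a => ?_⟩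
  -- The accumulator in register `n` is skipped: the predicate is decided in the context extended by
  -- the counter alone, kept in register `n + 1`.
  · obtain ⟨c, hc, h'⟩ := hP (n + 1) (by omega)
    refine ⟨fun x => c (x.1.1, x.2), fun m hm => ?_, fun x => h' _⟩
    obtain ⟨p, hp⟩ := hc m hm
    exact ⟨p, (hp.reindex fun x : (α × ℕ) × ℕ => (x.1.1, x.2)).mono
      (fun x σ hx => ⟨hx.1.1, hx.2⟩) fun _ _ _ _ h => h⟩
  · dsimp only
    generalize cnt a = k
    induction k with
    | zero => simp
    | succ k ih =>
      simp only [Nat.lt_succ_iff_lt_or_eq]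
      by_cases h : P (a, k)
      · simp only [h, if_true]; exact ⟨fun _ => one_ne_zero, fun _ => ⟨k, .inr rfl, h⟩⟩
      · simp only [h, if_false, ← ih]
        constructor
        · rintro ⟨i, hi | rfl, hp⟩
          · exact ⟨i, hi, hp⟩
          · exact absurd hp h
        · rintro ⟨i, hi, hp⟩
          exact ⟨i, .inl hi, hp⟩

/-- Sums with at most `bnd` summands. -/
theorem Fn.sum {cnt : α → ℕ} {F : α × ℕ → ℕ} (hc : Γ.Fn cnt) (hle : ∀ a, cnt a ≤ Γ.bnd a)
    (hF : ∀ n (h : Γ.lvl ≤ n), (Γ.push n h).Fn F) :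
    Γ.Fn fun a => ∑ i ∈ Finset.range (cnt a), F (a, i) := by
  refine (Fn.rec (fn_const 0) hc hle (step := fun x => x.1.2 + F (x.1.1, x.2))
    fun n h => Fn.add fn_var.weaken ?_).congr fun a => ?_
  · intro m hm
    obtain ⟨p, hp⟩ := hF (n + 1) (by omega) m hm
    exact ⟨p, (hp.reindex fun x : (α × ℕ) × ℕ => (x.1.1, x.2)).mono
      (fun x σ hx => ⟨hx.1.1, hx.2⟩) fun _ _ _ _ h => h⟩
  · generalize cnt a = k
    induction k with
    | zero => simp
    | succ k ih => rw [Finset.sum_range_succ, ← ih]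

/-- Repeated addition, as the machine has no multiplication; hence one factor must stay below the
loop bound. -/
theorem Fn.mul (hf : Γ.Fn f) (hg : Γ.Fn g) (hle : ∀ a, f a ≤ Γ.bnd a) :
    Γ.Fn fun a => f a * g a :=
  (Fn.sum hf hle (F := fun x => g x.1) fun _ _ => hg.weaken).congr fun a => by simp

/-! ### Output -/

/-- A polynomial time program appends the list `g a` to the list in array 1 whose length is
in register 0. -/
def Gen (Γ : Ctx α) (g : α → List Bool) : Prop :=
  ∀ n, Γ.lvl ≤ n → ∃ p, Runs Γ.bnd Γ.rep p fun a σ τ =>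
    (∀ x, x ≠ 1 → τ.arr x = σ.arr x) ∧ (∀ r, 1 ≤ r → r < n → τ.reg r = σ.reg r) ∧
      τ.reg 0 = σ.reg 0 + (g a).length ∧ (∀ i < σ.reg 0, τ.arr 1 i = σ.arr 1 i) ∧
      ∀ i < (g a).length, τ.arr 1 (σ.reg 0 + i) = ((g a).getD i false).toNat

theorem Gen.congr {g h : α → List Bool} (hg : Γ.Gen g) (e : ∀ a, g a = h a) : Γ.Gen h := by
  have : g = h := funext e
  rwa [← this]

theorem gen_nil : Γ.Gen fun _ => [] := fun _ _ =>
  ⟨.skip, Runs.of_exec 1 id (fun _ σ _ => .skip σ) fun _ _ _ => by simp⟩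

theorem Gen.append {g h : α → List Bool} (hg : Γ.Gen g) (hh : Γ.Gen h) :
    Γ.Gen fun a => g a ++ h a := by
  intro n hn
  obtain ⟨p, hp⟩ := hg n hn
  obtain ⟨q, hq⟩ := hh n hn
  refine ⟨.seq p q, hp.seq hq ?_ ?_⟩
  · rintro a σ τ h ⟨h1, h2, -⟩
    exact Γ.congr h (h1 2 (by omega)) fun r _ hr => h2 r (by omega) (by omega)
  · rintro a σ τ ρ - ⟨h1, h2, h3, h4, h5⟩ ⟨k1, k2, k3, k4, k5⟩
    refine ⟨fun x hx => (k1 x hx).trans (h1 x hx), fun r hr hr' => (k2 r hr hr').trans (h2 r hr hr'),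
      by rw [k3, h3, List.length_append]; omega,
      fun i hi => (k4 i (by omega)).trans (h4 i hi), fun i hi => ?_⟩
    rw [List.length_append] at hi
    by_cases hlt : i < (g a).length
    · rw [k4 _ (by omega), h5 i hlt, List.getD_append _ _ _ _ hlt]
    · rw [List.getD_append_right _ _ _ _ (by omega), ← k5 _ (by omega), h3]
      congr 1
      omega

open Classical in
theorem Gen.ite {P : α → Prop} {g h : α → List Bool} (hP : Γ.Dec P) (hg : Γ.Gen g)
    (hh : Γ.Gen h) : Γ.Gen fun a => if P a then g a else h a := by
  obtain ⟨c, hc, hPc⟩ := hP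
  intro n hn
  obtain ⟨o, ho⟩ := hc n hn
  obtain ⟨p, hp⟩ := hg n hn
  obtain ⟨q, hq⟩ := hh n hn
  have h4 := Γ.four_le
  refine ⟨.seq o (.ite n p q), ho.seq (pre' := fun a σ => Γ.rep a σ ∧ σ.reg n = c a)
    (post' := fun a σ τ => (∀ x, x ≠ 1 → τ.arr x = σ.arr x) ∧
      (∀ r, 1 ≤ r → r < n → τ.reg r = σ.reg r) ∧
      τ.reg 0 = σ.reg 0 + (if P a then g a else h a).length ∧
      (∀ i < σ.reg 0, τ.arr 1 i = σ.arr 1 i) ∧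
      ∀ i < (if P a then g a else h a).length,
        τ.arr 1 (σ.reg 0 + i) = ((if P a then g a else h a).getD i false).toNat)
      (Runs.ite ?_ ?_) ?_ ?_⟩
  · refine hp.mono (fun a σ h => h.1.1) ?_
    rintro a σ τ ⟨⟨-, h0⟩, h⟩ H
    rwa [if_pos ((hPc a).2 (h0 ▸ h))]
  · refine hq.mono (fun a σ h => h.1.1) ?_
    rintro a σ τ ⟨⟨-, h0⟩, h⟩ H
    rwa [if_neg fun h' => (hPc a).1 h' (h0 ▸ h)]
  · rintro a σ τ h ⟨h1, h2, h3⟩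
    exact ⟨Γ.congr h (by rw [h1]) fun r _ hr => h2 r (by omega), h3⟩
  · rintro a σ τ ρ - ⟨h1, h2, h3⟩ ⟨k1, k2, k3, k4, k5⟩
    rw [h1, h2 0 (by omega)] at *
    exact ⟨k1, fun r hr hr' => (k2 r hr hr').trans (h2 r hr'), k3, k4, k5⟩

theorem gen_singleton (b : Bool) : Γ.Gen fun _ => [b] := by
  intro n hn
  have h4 := Γ.four_le
  refine ⟨.seq (.const n b.toNat) (.seq (.store 1 0 n) (.seq (.const n 1) (.add 0 0 n))),
    Runs.of_exec 4 (fun σ => (((σ.setReg n b.toNat).setArr 1 (σ.reg 0) b.toNat).setReg n 1).setReg 0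
      (σ.reg 0 + 1)) (fun a σ _ => ?_) fun a σ _ => ?_⟩
  · have := Exec.seq (Exec.const σ n b.toNat) (Exec.seq (Exec.store _ 1 0 n)
      (Exec.seq (Exec.const _ n 1) (Exec.add _ 0 0 n)))
    convert this using 1
    simp [State.setReg, State.setArr, (show 0 ≠ n by omega)]
  · refine ⟨fun x hx => ?_, fun r hr hr' => ?_, ?_, fun i hi => ?_, fun i hi => ?_⟩
    · simp [State.setReg, State.setArr, hx]
    · simp [State.setReg, State.setArr, hr'.ne, (show r ≠ 0 by omega)]
    · simp [State.setReg]
    · simp [State.setReg, State.setArr, hi.ne]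
    · have : i = 0 := by simpa using hi
      subst this
      simp [State.setReg, State.setArr]

theorem gen_const : ∀ l : List Bool, Γ.Gen fun _ => l
  | [] => gen_nil
  | b :: l => (gen_singleton b).append (gen_const l)

open Classical in
theorem Dec.gen {P : α → Prop} (hP : Γ.Dec P) : Γ.Gen fun a => [decide (P a)] :=
  (Gen.ite hP (gen_const [true]) (gen_const [false])).congr fun a => by
    by_cases h : P a <;> simp [h]

/-- Concatenation of at most `bnd` lists. -/
theorem Gen.flatMap {cnt : α → ℕ} {G : α × ℕ → List Bool} (hc : Γ.Fn cnt)
    (hle : ∀ a, cnt a ≤ Γ.bnd a) (hG : ∀ n (h : Γ.lvl ≤ n), (Γ.push n h).Gen G) :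
    Γ.Gen fun a => (List.range (cnt a)).flatMap fun i => G (a, i) := by
  intro n hn
  have h4 := Γ.four_le
  obtain ⟨q, hq⟩ := hc (n + 1) (by omega)
  obtain ⟨s, hs⟩ := hG n hn (n + 2) (Nat.le_succ _)
  let L : α → ℕ → List Bool := fun a i => (List.range i).flatMap fun i => G (a, i)
  let J : α → State → ℕ → State → Prop := fun a σ i τ =>
    Γ.rep a τ ∧ (∀ x, x ≠ 1 → τ.arr x = σ.arr x) ∧ (∀ r, 1 ≤ r → r < n → τ.reg r = σ.reg r) ∧
      τ.reg n = i ∧ τ.reg (n + 1) = cnt a - i ∧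
      τ.reg 0 = σ.reg 0 + (L a i).length ∧ (∀ j < σ.reg 0, τ.arr 1 j = σ.arr 1 j) ∧
      ∀ j < (L a i).length, τ.arr 1 (σ.reg 0 + j) = ((L a i).getD j false).toNat
  have hz : Runs Γ.bnd (fun _ _ => True) (.const n 0)
      (fun _ σ τ => τ = σ.setReg n 0) :=
    Runs.of_exec 1 _ (fun _ σ _ => .const σ n 0) (fun _ _ _ => rfl)
  have hbody : Runs (fun x : α × State × ℕ => Γ.bnd x.1)
      (fun x τ => x.2.2 < cnt x.1 ∧ J x.1 x.2.1 x.2.2 τ) (.seq s (tick n))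
      (fun x _ ρ => J x.1 x.2.1 (x.2.2 + 1) ρ) := by
    refine ((hs.reindex fun x : α × State × ℕ => (x.1, x.2.2)).mono
      (pre' := fun x τ => x.2.2 < cnt x.1 ∧ J x.1 x.2.1 x.2.2 τ)
      ?_ (fun _ _ _ _ h => h)).seq (runs_tick (pre := fun _ _ => True) n)
        (fun _ _ _ _ _ => trivial) ?_
    · rintro ⟨a, σ, i⟩ τ ⟨-, h1, -, -, h2, -⟩
      exact ⟨h1, h2⟩
    · rintro ⟨a, σ₀, i⟩ σ τ ρ ⟨-, h1, h2, h3, h4, h5, h6, h7, h8⟩ ⟨k1, k2, k3, k4, k5⟩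
        ⟨t1, t2, t3, t4⟩
      dsimp only at *
      have hL : L a (i + 1) = L a i ++ G (a, i) := by
        simp only [L, List.range_succ, List.flatMap_append, List.flatMap_singleton]
      refine ⟨Γ.congr h1 (by rw [t1, k1 2 (by omega)]) fun r _ hr => ?_,
        fun x hx => by rw [t1, k1 x hx, h2 x hx], fun r hr hr' => ?_, ?_, ?_, ?_,
        fun j hj => ?_, fun j hj => ?_⟩
      · rw [t2 r (by omega), k2 r (by omega) (by omega)]
      · rw [t2 r (by omega), k2 r (by omega) (by omega), h3 r hr hr']
      · rw [t3, k2 n (by omega) (by omega), h4]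
      · rw [t4, k2 _ (by omega) (by omega), h5]; omega
      · rw [t2 0 (by omega), k3, h6, hL, List.length_append]; omega
      · rw [t1, k4 j (by omega), h7 j hj]
      · rw [hL, List.length_append] at hj
        rw [t1, hL]
        by_cases hlt : j < (L a i).length
        · rw [k4 _ (by omega), h8 j hlt, List.getD_append _ _ _ _ hlt]
        · rw [List.getD_append_right _ _ _ _ (by omega), ← k5 _ (by omega), h6]
          congr 1
          omega
  refine ⟨.seq q (.seq (.const n 0) (.loop (n + 1) _)), hq.seq
      (pre' := fun a σ => Γ.rep a σ ∧ σ.reg (n + 1) = cnt a)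
      ((hz.mono (fun _ _ _ => trivial) (fun _ _ _ _ h => h)).seq
        (pre' := fun a σ => Γ.rep a σ ∧ σ.reg (n + 1) = cnt a ∧ σ.reg n = 0)
        (Runs.loop (bnd := Γ.bnd) cnt J hle (fun a σ i τ _ h => h.2.2.2.2.1) hbody
        (post := fun a σ τ => J a σ (cnt a) τ) ?_ (fun _ _ _ _ h => h))
        (post := fun a σ τ => J a σ (cnt a) τ) ?_ ?_) ?_ ?_⟩
  · rintro a σ ⟨h1, h2, h3⟩
    exact ⟨h1, fun _ _ => rfl, fun _ _ _ => rfl, h3, by rw [h2]; rfl, by simp [L],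
      fun _ _ => rfl, fun j hj => by simp [L] at hj⟩
  · rintro a σ τ ⟨h1, h2⟩ rfl
    refine ⟨Γ.congr h1 rfl fun r _ hr => ?_, ?_, ?_⟩
    · simp [State.setReg, (show r ≠ n by omega)]
    · simp [State.setReg, h2]
    · simp [State.setReg]
  · rintro a σ τ ρ - rfl ⟨h1, h2, h3, h4, h5, h6, h7, h8⟩
    simp only [State.setReg, Function.update_of_ne (show 0 ≠ n by omega)] at h2 h6 h7 h8
    refine ⟨h1, h2, fun r hr hr' => ?_, h4, h5, h6, h7, h8⟩
    rw [h3 r hr hr']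
    simp [State.setReg, hr'.ne]
  · rintro a σ τ h ⟨h1, h2, h3⟩
    exact ⟨Γ.congr h (by rw [h1]) fun r _ hr => h2 r (by omega), h3⟩
  · rintro a σ τ ρ - ⟨h1, h2, -⟩ ⟨-, k2, k3, -, -, k6, k7, k8⟩
    rw [h1, h2 0 (by omega)] at *
    exact ⟨k2, fun r hr hr' => (k3 r hr hr').trans (h2 r (by omega)), k6, k7, k8⟩

end Ctx

end SepLogic

namespace SepLogic

open Ctx

/-! ### From output routines to a complete program -/

theorem Runs.mono_bnd {α : Type} {bnd bnd' : α → ℕ} {pre : α → State → Prop} {p : Prog}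
    {post : α → State → State → Prop} (h : Runs bnd pre p post) (hb : ∀ a, bnd a ≤ bnd' a) :
    Runs bnd' pre p post := by
  obtain ⟨C, d, h⟩ := h
  refine ⟨C, d, fun a σ ha => ?_⟩
  obtain ⟨τ, c, e, hc, hm⟩ := h a σ ha
  refine ⟨τ, c, e, hc.trans ?_, hm⟩
  have := hb a
  gcongr

theorem Runs.trans {α : Type} {bnd : α → ℕ} {pre mid post : α → State → Prop} {p q : Prog}
    (hp : Runs bnd pre p fun a _ τ => mid a τ) (hq : Runs bnd mid q fun a _ τ => post a τ) :
    Runs bnd pre (.seq p q) fun a _ τ => post a τ :=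
  hp.seq hq (fun _ _ _ _ h => h) fun _ _ _ _ _ _ h => h

/-- The context with the input word and a bound, and no further variables. -/
def baseCtx {Ω : Type} (word : Ω → List Bool) (bnd : Ω → ℕ) : Ctx Ω where
  word := word
  bnd := bnd
  lvl := 4
  rep a σ := σ.reg 2 = (word a).length ∧ σ.reg 3 = bnd a ∧
    ∀ i < (word a).length, σ.arr 2 i = ((word a).getD i false).toNat
  four_le := le_rfl
  reg_two h := h.1
  reg_three h := h.2.1
  arr_two h := h.2.2
  congr h ha hr := ⟨(hr 2 (by omega) (by omega)).trans h.1, (hr 3 (by omega) (by omega)).trans h.2.1,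
    fun i hi => by rw [ha]; exact h.2.2 i hi⟩

/-- Copy the word in array 1 to array 2. -/
def copyWord : Prog :=
  .seq (.seq (.const 5 0) (.add 5 0 5)) (.seq (.const 4 0)
    (.loop 5 (.seq (.seq (.load 7 1 4) (.store 2 4 7)) (tick 4))))

theorem runs_copyWord {Ω : Type} (word : Ω → List Bool) :
    Runs (fun a => (word a).length)
      (fun a σ => σ.reg 0 = (word a).length ∧
        ∀ i < (word a).length, σ.arr 1 i = ((word a).getD i false).toNat) copyWord
      (fun a _ τ => τ.reg 0 = (word a).length ∧
        ∀ i < (word a).length, τ.arr 2 i = ((word a).getD i false).toNat) := by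
  let J : Ω → State → ℕ → State → Prop := fun a _ i τ =>
    (τ.reg 0 = (word a).length ∧ ∀ i < (word a).length, τ.arr 1 i = ((word a).getD i false).toNat) ∧
      τ.reg 4 = i ∧ τ.reg 5 = (word a).length - i ∧
      ∀ j < i, τ.arr 2 j = ((word a).getD j false).toNat
  refine Runs.seq (pre' := fun a σ => (σ.reg 0 = (word a).length ∧
        ∀ i < (word a).length, σ.arr 1 i = ((word a).getD i false).toNat) ∧
        σ.reg 5 = (word a).length) (Runs.copy 5 0 (by omega))
    (Runs.seq (mid := fun _ σ τ => τ = σ.setReg 4 0) (pre' := fun a σ => J a σ 0 σ)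
      (post := fun a _ τ => J a τ (word a).length τ)
      (Runs.of_exec 1 _ (fun _ σ _ => .const σ 4 0) (fun _ _ _ => rfl))
      (Runs.loop (post := fun a _ τ => J a τ (word a).length τ)
        (fun a => (word a).length) J (fun _ => le_rfl) ?_ ?_
        (fun _ _ h => h) (fun _ _ _ _ h => h)) ?_ ?_) ?_ ?_
  · rintro a σ i τ - ⟨-, -, h, -⟩
    exact h
  · refine Runs.seq (mid := fun _ σ τ => τ = (σ.setReg 7 (σ.arr 1 (σ.reg 4))).setArr 2 (σ.reg 4)
        (σ.arr 1 (σ.reg 4)))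
      (Runs.of_exec 2 _ (fun _ σ _ => ?_) (fun _ _ _ => rfl))
      (runs_tick (pre := fun _ _ => True) 4) (fun _ _ _ _ _ => trivial) ?_
    · have := Exec.seq (Exec.load σ 7 1 4) (Exec.store _ 2 4 7)
      convert this using 1
      simp [State.setReg]
    · rintro ⟨a, σ₀, i⟩ σ τ ρ ⟨h, ⟨h1, h2⟩, h3, h4, h5⟩ rfl ⟨k1, k2, k3, k4⟩
      dsimp only at *
      simp only [State.setReg, State.setArr] at k1 k2 k3 k4
      refine ⟨⟨?_, fun j hj => ?_⟩, ?_, ?_, fun j hj => ?_⟩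
      · rw [k2 0 (by omega)]; simpa using h1
      · rw [k1]; simpa using h2 j hj
      · rw [k3]; simp [h3]
      · rw [k4]; simp [h4]; omega
      · rw [k1, h3]
        by_cases hji : j = i
        · subst hji; simpa using h2 j h
        · simp [hji]
          simpa using h5 j (by omega)
  · rintro a σ τ ⟨⟨h1, h2⟩, h3⟩ rfl
    exact ⟨⟨by simpa [State.setReg] using h1, fun i hi => by simpa [State.setReg] using h2 i hi⟩,
      by simp [State.setReg], by simpa [State.setReg] using h3, by simp⟩
  · intros; assumption
  · rintro a σ τ ⟨h1, h2⟩ rfl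
    exact ⟨⟨by simpa [State.setReg] using h1, fun i hi => by simpa [State.setReg] using h2 i hi⟩,
      by simpa [State.setReg] using h1⟩
  · rintro a σ τ ρ - - ⟨⟨h1, -⟩, -, -, h2⟩
    exact ⟨h1, h2⟩

/-- A program that turns the word `word a` into the word `out₁ a ++ out₂ a`, with the length of
`out₂ a` as parameter. -/
theorem exists_program {Ω : Type} (word out₁ out₂ : Ω → List Bool) (s : ℕ)
    (h₁ : (baseCtx word fun a => ((word a).length + s) * ((word a).length + s)).Gen out₁)
    (h₂ : (baseCtx word fun a => ((word a).length + s) * ((word a).length + s)).Gen out₂) :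
    ∃ p C d, ∀ a σ k, IsOutput σ (word a) k → ∃ τ c, Exec p σ τ c ∧
      c ≤ C * ((word a).length + 1) ^ d ∧ IsOutput τ (out₁ a ++ out₂ a) (out₂ a).length := by
  obtain ⟨p₁, hp₁⟩ := h₁ 4 le_rfl
  obtain ⟨p₂, hp₂⟩ := h₂ 4 le_rfl
  -- Two contexts, because squaring is itself a loop: it runs with the bound `length + s`, and its
  -- result becomes the loop bound for the output.
  let Γ := baseCtx word fun a => (word a).length + s
  let Γ' := baseCtx word fun a => ((word a).length + s) * ((word a).length + s)
  obtain ⟨q, hq⟩ := (Fn.mul (Γ := Γ) fn_bnd fn_bnd fun _ => le_rfl) 4 le_rfl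
  have hle : ∀ a, (word a).length + s ≤ ((word a).length + s) * ((word a).length + s) :=
    fun a => Nat.le_mul_self _
  have r₀ := (runs_copyWord word).mono_bnd (bnd' := Γ'.bnd)
    fun a => (Nat.le_add_right _ s).trans (hle a)
  have r₁ : Runs Γ'.bnd (fun a σ => σ.reg 0 = (word a).length ∧
        ∀ i < (word a).length, σ.arr 2 i = ((word a).getD i false).toNat)
      (.seq (.const 4 s) (.seq (.add 3 0 4) (.seq (.const 2 0) (.add 2 0 2))))
      (fun a _ τ => Γ.rep a τ) := by
    refine Runs.of_exec 4 (fun σ => ((σ.setReg 4 s).setReg 3 (σ.reg 0 + s)).setReg 2 (σ.reg 0))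
      (fun a σ h => ?_) fun a σ h => ?_
    · have := Exec.seq (Exec.const σ 4 s) (Exec.seq (Exec.add _ 3 0 4)
        (Exec.seq (Exec.const _ 2 0) (Exec.add _ 2 0 2)))
      convert this using 1
      simp [State.setReg]
    · exact ⟨by simpa [State.setReg] using h.1, by simpa [State.setReg] using h.1,
        fun i hi => by simpa [State.setReg] using h.2 i hi⟩
  have r₂ := hq.mono_bnd (bnd' := Γ'.bnd) hle
  have r₃ : Runs Γ'.bnd (fun a σ => Γ.rep a σ ∧
        σ.reg 4 = ((word a).length + s) * ((word a).length + s))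
      (.seq (.seq (.const 3 0) (.add 3 4 3)) (.const 0 0))
      (fun a _ τ => Γ'.rep a τ ∧ τ.reg 0 = 0) := by
    refine Runs.of_exec 3 (fun σ => (σ.setReg 3 (σ.reg 4)).setReg 0 0)
      (fun a σ h => ?_) fun a σ h => ?_
    · have := Exec.seq (Exec.seq (Exec.const σ 3 0) (Exec.add _ 3 4 3)) (Exec.const _ 0 0)
      convert this using 1
      simp [State.setReg]
    · exact ⟨⟨by simpa [State.setReg] using h.1.1, by simpa [State.setReg] using h.2,
        fun i hi => by simpa [State.setReg] using h.1.2.2 i hi⟩, by simp [State.setReg]⟩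
  have r₄ := hp₁.mono (pre' := fun a σ => Γ'.rep a σ ∧ σ.reg 0 = 0) (post' := fun a σ τ =>
      Γ'.rep a τ ∧ τ.reg 0 = (out₁ a).length ∧
        ∀ i < (out₁ a).length, τ.arr 1 i = ((out₁ a).getD i false).toNat) (fun _ _ h => h.1) (by
    rintro a σ τ ⟨h1, h2⟩ ⟨k1, k2, k3, k4, k5⟩
    simp only [h2, zero_add] at k3 k5
    exact ⟨Γ'.congr h1 (k1 2 (by omega)) fun r hr hr' => k2 r (by omega) hr', k3, k5⟩)
  -- The length of the first part is kept in register 1; the final growth of register 0 over it is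
  -- the parameter.
  have r₅ : Runs Γ'.bnd (fun a σ => Γ'.rep a σ ∧ σ.reg 0 = (out₁ a).length ∧
        ∀ i < (out₁ a).length, σ.arr 1 i = ((out₁ a).getD i false).toNat)
      (.seq (.const 1 0) (.add 1 0 1))
      (fun a _ τ => Γ'.rep a τ ∧ τ.reg 0 = (out₁ a).length ∧ τ.reg 1 = (out₁ a).length ∧
        ∀ i < (out₁ a).length, τ.arr 1 i = ((out₁ a).getD i false).toNat) := by
    refine (Runs.copy 1 0 (by omega)).mono (fun _ _ h => h) ?_
    rintro a σ τ ⟨h1, h2, h3⟩ rfl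
    refine ⟨Γ'.congr h1 rfl fun r hr hr' => ?_, ?_, ?_, ?_⟩
    · simp [State.setReg, (show r ≠ 1 by omega)]
    · simpa [State.setReg] using h2
    · simpa [State.setReg] using h2
    · simpa [State.setReg] using h3
  have r₆ : Runs Γ'.bnd (fun a σ => Γ'.rep a σ ∧ σ.reg 0 = (out₁ a).length ∧
        σ.reg 1 = (out₁ a).length ∧
        ∀ i < (out₁ a).length, σ.arr 1 i = ((out₁ a).getD i false).toNat)
      (.seq p₂ (.sub 1 0 1)) (fun a _ τ => IsOutput τ (out₁ a ++ out₂ a) (out₂ a).length) := by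
    refine (hp₂.mono (fun _ _ h => h.1) (fun _ _ _ _ h => h)).seq
      (Runs.of_exec (pre := fun _ _ => True) (post := fun _ σ τ =>
        τ = σ.setReg 1 (σ.reg 0 - σ.reg 1)) 1 _ (fun _ σ _ => .sub σ 1 0 1) fun _ _ _ => rfl)
      (fun _ _ _ _ _ => trivial) ?_
    rintro a σ τ ρ ⟨-, h1, h2, h3⟩ ⟨-, k1, k2, k3, k4⟩ rfl
    refine ⟨?_, ?_, fun i hi => ?_⟩
    · simp [State.setReg, k2, h1]
    · simp [State.setReg, k2, h1, k1 1 le_rfl (by omega), h2]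
    · simp only [State.setReg]
      rw [List.length_append] at hi
      by_cases hlt : i < (out₁ a).length
      · rw [k3 i (by omega), h3 i hlt, List.getD_append _ _ _ _ hlt]
      · rw [List.getD_append_right _ _ _ _ (by omega), ← k4 _ (by omega), h1]
        congr 1
        omega
  have r₂' := r₂.mono (fun _ _ h => h) (post' := fun a _ τ => Γ.rep a τ ∧
      τ.reg 4 = ((word a).length + s) * ((word a).length + s)) fun a σ τ h h' =>
        ⟨Γ.congr h (by rw [h'.1]) fun r _ hr => h'.2.1 r hr, h'.2.2⟩
  obtain ⟨P, C, d, h⟩ : ∃ P, Runs Γ'.bnd _ P _ :=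
    ⟨_, r₀.trans (r₁.trans (r₂'.trans (r₃.trans (r₄.trans (r₅.trans r₆)))))⟩
  -- For words of length `ℓ`, `(ℓ + s) ^ 2 + 1 ≤ ((s + 1) * (ℓ + 1)) ^ 2` turns the bound in terms
  -- of the loop bound into one in terms of the length.
  refine ⟨P, C * ((s + 1) ^ 2) ^ d, 2 * d, fun a σ k hσ => ?_⟩
  obtain ⟨τ, c, e, hc, ho⟩ := h a σ ⟨hσ.1, hσ.2.2⟩
  refine ⟨τ, c, e, hc.trans ?_, ho⟩
  rw [pow_mul, mul_assoc, ← mul_pow]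
  refine Nat.mul_le_mul_left _ (Nat.pow_le_pow_left ?_ _)
  change ((word a).length + s) * ((word a).length + s) + 1 ≤ _
  rw [← mul_pow]
  nlinarith [Nat.zero_le (s * (word a).length), Nat.zero_le (s * s * (word a).length), Nat.zero_le (s * (word a).length * (word a).length),
    Nat.zero_le (s * s * (word a).length* (word a).length)]

end SepLogic

namespace SepLogic

/-! ### A criterion for bounded expansion -/

/-- After the deletion of at most three vertices, `G` consists of branch vertices that are far apart
in comparison to their number, and of vertices of degree at most two. -/
def Sparse {V : Type} (G : SimpleGraph V) : Prop :=
  ∃ X Y : Set V, Y.ncard ≤ 3 ∧ (∀ v, v ∉ X → v ∉ Y → (G.neighborSet v \ Y).ncard ≤ 2) ∧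
    ∀ x ∈ X, ∀ y ∈ X, x ≠ y → ∀ p : G.Walk x y, (∀ w ∈ p.support, w ∉ Y) → X.ncard ≤ p.length

theorem Sparse.of_iso {V W : Type} {G : SimpleGraph V} {H : SimpleGraph W} (e : G ≃g H)
    (h : Sparse G) : Sparse H := by
  obtain ⟨X, Y, hY, hd, hX⟩ := h
  refine ⟨e '' X, e '' Y, by rwa [Set.ncard_image_of_injective _ e.injective],
    fun w hx hy => ?_, ?_⟩
  · obtain ⟨v, rfl⟩ := e.surjective w
    have : H.neighborSet (e v) \ e '' Y = e '' (G.neighborSet v \ Y) := by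
      ext w
      obtain ⟨u, rfl⟩ := e.surjective w
      simp [e.map_adj_iff]
    rw [this, Set.ncard_image_of_injective _ e.injective]
    exact hd v (fun h => hx ⟨v, h, rfl⟩) (fun h => hy ⟨v, h, rfl⟩)
  · rintro _ ⟨x, hx, rfl⟩ _ ⟨y, hy, rfl⟩ hxy p hp
    rw [Set.ncard_image_of_injective _ e.injective]
    have := hX x hx y hy (fun h => hxy (by rw [h]))
      ((p.map e.symm.toHom).copy (e.symm_apply_apply x) (e.symm_apply_apply y)) (by
        intro w hw hwY
        simp only [SimpleGraph.Walk.support_copy, SimpleGraph.Walk.support_map, List.mem_map] at hw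
        obtain ⟨u, hu, rfl⟩ := hw
        exact hp u hu ⟨_, hwY, e.apply_symm_apply u⟩)
    simpa using this

open Classical in
/-- Few edges leave a connected set all of whose vertices have degree at most two. -/
theorem sum_boundary_le_two {V : Type} [Fintype V] (G : SimpleGraph V) (S Y : Set V)
    (hS : (G.induce S).Connected) (hSY : Disjoint S Y)
    (hd : ∀ v ∈ S, (G.neighborSet v \ Y).ncard ≤ 2) :
    ∑ v : S, (Finset.univ.filter fun w => w ∉ S ∧ w ∉ Y ∧ G.Adj v w).card ≤ 2 := by
  have h1 : ∀ v : S, (G.induce S).degree v +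
      (Finset.univ.filter fun w => w ∉ S ∧ w ∉ Y ∧ G.Adj v w).card ≤ 2 := by
    intro v
    refine le_trans ?_ (hd v v.2)
    have h2 : (G.induce S).degree v =
        (Finset.univ.filter fun w => w ∈ S ∧ G.Adj v w).card := by
      rw [← SimpleGraph.card_neighborFinset_eq_degree,
        ← Finset.card_map (Function.Embedding.subtype (· ∈ S))]
      congr 1
      ext w
      simp [and_comm]
    rw [h2, ← Finset.card_union_of_disjoint, Set.ncard_eq_toFinset_card']
    · refine Finset.card_le_card fun w hw => ?_
      simp only [Finset.mem_union, Finset.mem_filter, Finset.mem_univ, true_and] at hw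
      simp only [Set.mem_toFinset, Set.mem_sdiff, SimpleGraph.mem_neighborSet]
      rcases hw with ⟨hw, ha⟩ | ⟨-, hw, ha⟩
      · exact ⟨ha, Set.disjoint_left.1 hSY hw⟩
      · exact ⟨ha, hw⟩
    · rw [Finset.disjoint_left]
      intro w hw hw'
      simp only [Finset.mem_filter] at hw hw'
      exact hw'.2.1 hw.2.1
  have h3 := Finset.sum_le_sum fun v (_ : v ∈ (Finset.univ : Finset S)) => h1 v
  rw [Finset.sum_add_distrib, SimpleGraph.sum_degrees_eq_twice_card_edges] at h3
  -- A connected set has at least `|S| - 1` inner edges, so the inner degrees use up all but two of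
  -- the `2 * |S|` available ends.
  have h4 := hS.card_vert_le_card_edgeSet_add_one
  rw [Nat.card_eq_fintype_card, Nat.card_eq_fintype_card, ← SimpleGraph.edgeFinset_card] at h4
  simp only [Finset.sum_const, Finset.card_univ, smul_eq_mul] at h3
  omega

/-- The class of all sparse graphs. -/
def sparseClass : GraphClass where
  Mem G := Sparse G
  mem_of_iso _ _ := fun ⟨e⟩ h => h.of_iso e

-- A common point of `B a` and `Y` belongs to no other branch set, so choosing one for each `a` is
-- injective.
open Classical in
theorem card_le_of_forall_meets {V : Type} {m : ℕ} (B : Fin m → Set V)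
    (hB : ∀ a b, a ≠ b → Disjoint (B a) (B b)) (Y : Set V) (hY : Y.Finite) :
    (Finset.univ.filter fun a => ¬ Disjoint (B a) Y).card ≤ Y.ncard := by
  have h : ∀ a : Finset.univ.filter fun a => ¬ Disjoint (B a) Y, ∃ v, v ∈ B a ∧ v ∈ Y :=
    fun a => Set.not_disjoint_iff.1 (Finset.mem_filter.1 a.2).2
  choose f hf hf' using h
  have := hY.fintype
  rw [← Fintype.card_coe, ← Nat.card_coe_set_eq, Nat.card_eq_fintype_card]
  refine Fintype.card_le_of_injective (fun a => ⟨f a, hf' a⟩) fun a b hab => ?_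
  have h1 : f a = f b := congrArg Subtype.val hab
  by_contra hne
  exact Set.disjoint_left.1 (hB a b fun h => hne (Subtype.ext h)) (hf a) (h1 ▸ hf b)

open Classical in
theorem sparseClass_boundedExpansion : sparseClass.BoundedExpansion := by
  intro r
  -- The contributions are `3` from branch sets that meet `Y`, `2` from those that miss `X` and `Y`,
  -- and `4 * r + 1` from those that meet `X`.
  refine ⟨4 * r + 6, ?_⟩
  rintro n G ⟨X, Y, hY, hd, hX⟩ m H ⟨B, c, hB, hw, hc, he⟩
  let PY := Finset.univ.filter fun a => ¬ Disjoint (B a) Y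
  let PX := Finset.univ.filter fun a => ¬ Disjoint (B a) X
  -- Each edge is charged to at least one of its ends: to an end whose branch set meets `Y` if
  -- possible, otherwise to one whose branch set misses `X` if possible. Thus an end in `PX` outside
  -- `PY` only pays for edges inside `PX`.
  let N : Fin m → Finset (Fin m) := fun a =>
    if a ∈ PY then Finset.univ else Finset.univ.filter fun b => H.Adj a b ∧ b ∉ PY ∧
      (a ∈ PX → b ∈ PX)
  have hPY : PY.card ≤ 3 := (card_le_of_forall_meets B hB Y (Set.toFinite _)).trans hY
  have hPX : PX.card ≤ X.ncard := card_le_of_forall_meets B hB X (Set.toFinite _)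
  have h0 : ∀ a, a ∉ PY → a ∉ PX → (N a).card ≤ 2 := by
    intro a haY haX
    have haY' : Disjoint (B a) Y := by simpa [PY] using haY
    have haX' : Disjoint (B a) X := by simpa [PX] using haX
    refine le_trans ?_ (sum_boundary_le_two G (B a) Y ?_ haY' fun v hv =>
      hd v (Set.disjoint_left.1 haX' hv) (Set.disjoint_left.1 haY' hv))
    · rw [← Finset.card_sigma]
      have : ∀ b : N a, ∃ v w, v ∈ B a ∧ w ∈ B b ∧ G.Adj v w := by
        rintro ⟨b, hb⟩
        simp only [N, if_neg haY, Finset.mem_filter] at hb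
        obtain ⟨v, hv, w, hw, h⟩ := he a b hb.2.1
        exact ⟨v, w, hv, hw, h⟩
      choose f g hf hg hfg using this
      rw [← Fintype.card_coe, ← Fintype.card_coe]
      refine Fintype.card_le_of_injective (fun b => ⟨⟨⟨f b, hf b⟩, g b⟩, ?_⟩) ?_
      · obtain ⟨-, hb, hbY, -⟩ : b.1 ∈ Finset.univ ∧ H.Adj a b ∧ b.1 ∉ PY ∧ _ := by
          have := b.2
          simpa only [N, if_neg haY, Finset.mem_filter] using this
        have hbY : Disjoint (B b) Y := by simpa [PY] using hbY
        simp only [Finset.mem_sigma, Finset.mem_univ, Finset.mem_filter, true_and]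
        exact ⟨fun h => Set.disjoint_left.1 (hB a b hb.ne) h (hg b),
          Set.disjoint_left.1 hbY (hg b), hfg b⟩
      · intro b b' h
        have h1 : g b = g b' := congrArg (fun x => x.1.2) h
        by_contra hne
        exact Set.disjoint_left.1 (hB b b' fun h => hne (Subtype.ext h)) (hg b) (h1 ▸ hg b')
    · refine SimpleGraph.induce_connected_of_patches (c a) (hc a) fun {v} hv => ?_
      obtain ⟨p, -, hp⟩ := hw a v hv
      exact ⟨B a, subset_rfl, hc a, hv, ⟨p.induce (B a) hp⟩⟩
  have h1 : ∀ a, a ∉ PY → a ∈ PX → (N a).card ≤ if X.ncard ≤ 4 * r + 1 then m else 0 := by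
    intro a haY haX
    split_ifs with hr
    · exact (Finset.card_le_univ _).trans (by simp)
    · rw [Nat.le_zero, Finset.card_eq_zero, Finset.eq_empty_iff_forall_notMem]
      intro b hb
      simp only [N, if_neg haY, Finset.mem_filter, Finset.mem_univ, true_and] at hb
      obtain ⟨hab, hbY, hbX⟩ := hb
      obtain ⟨x, hxB, hxX⟩ := Set.not_disjoint_iff.1 (by simpa [PX] using haX : ¬ Disjoint (B a) X)
      obtain ⟨y, hyB, hyX⟩ := Set.not_disjoint_iff.1
        (by simpa [PX] using hbX haX : ¬ Disjoint (B b) X)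
      have haY' : Disjoint (B a) Y := by simpa [PY] using haY
      have hbY' : Disjoint (B b) Y := by simpa [PY] using hbY
      obtain ⟨v, hv, w, hw', hvw⟩ := he a b hab
      obtain ⟨p₁, l₁, s₁⟩ := hw a x hxB
      obtain ⟨p₂, l₂, s₂⟩ := hw a v hv
      obtain ⟨p₃, l₃, s₃⟩ := hw b w hw'
      obtain ⟨p₄, l₄, s₄⟩ := hw b y hyB
      -- The walk runs from `x` over the centre of `B a` to `v`, across the edge to `w`, and over
      -- the centre of `B b` to `y`. It has at most `4 * r + 1` edges and stays in two branch sets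
      -- disjoint from `Y`.
      have := hX x hxX y hyX
        (fun h => Set.disjoint_left.1 (hB a b hab.ne) hxB (h ▸ hyB))
        (p₁.reverse.append (p₂.append (.cons hvw (p₃.reverse.append p₄)))) (by
          intro u hu
          simp only [SimpleGraph.Walk.mem_support_append_iff, SimpleGraph.Walk.support_reverse,
            List.mem_reverse, SimpleGraph.Walk.support_cons, List.mem_cons] at hu
          rcases hu with hu | hu | rfl | hu | hu
          · exact Set.disjoint_left.1 haY' (s₁ u hu)
          · exact Set.disjoint_left.1 haY' (s₂ u hu)
          · exact Set.disjoint_left.1 haY' hv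
          · exact Set.disjoint_left.1 hbY' (s₃ u hu)
          · exact Set.disjoint_left.1 hbY' (s₄ u hu))
      simp only [SimpleGraph.Walk.length_append, SimpleGraph.Walk.length_reverse,
        SimpleGraph.Walk.length_cons] at this
      omega
  have hE : H.edgeSet.ncard ≤ ∑ a, (N a).card := by
    rw [← Finset.card_sigma, ← Set.ncard_coe_finset]
    refine le_trans (Set.ncard_le_ncard (t := (fun x : (_ : Fin m) × Fin m => s(x.1, x.2)) ''
      (Finset.univ.sigma N : Finset ((_ : Fin m) × Fin m))) ?_ (Set.toFinite _)) Set.ncard_image_le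
    intro e
    induction e with
    | _ a b =>
      intro hab
      have hab : H.Adj a b := hab
      have : b ∈ N a ∨ a ∈ N b := by
        by_cases ha : a ∈ PY
        · simp [N, ha]
        by_cases hb : b ∈ PY
        · simp [N, hb]
        simp only [N, ha, hb, if_false, Finset.mem_filter, Finset.mem_univ, true_and, hab, hab.symm,
          not_false_eq_true]
        tauto
      rcases this with h | h
      · exact ⟨⟨a, b⟩, by simpa using h, rfl⟩
      · exact ⟨⟨b, a⟩, by simpa using h, Sym2.eq_swap⟩
  refine hE.trans ?_
  have hN : ∀ a, (N a).card ≤ (if a ∈ PY then m else 0) + 2 +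
      (if a ∈ PX then (if X.ncard ≤ 4 * r + 1 then m else 0) else 0) := by
    intro a
    by_cases ha : a ∈ PY
    · rw [if_pos ha]
      have := (Finset.card_le_univ (N a)).trans (by simp : _ ≤ m)
      omega
    · rw [if_neg ha]
      by_cases ha' : a ∈ PX
      · rw [if_pos ha']
        have := h1 a ha ha'
        omega
      · have := h0 a ha ha'
        omega
  refine (Finset.sum_le_sum fun a _ => hN a).trans ?_
  rw [Finset.sum_add_distrib, Finset.sum_add_distrib, ← Finset.sum_filter, ← Finset.sum_filter]
  simp only [Finset.sum_const, smul_eq_mul, Finset.card_univ, Fintype.card_fin,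
    Finset.filter_mem_eq_inter, Finset.univ_inter]
  have e1 : PY.card * m ≤ 3 * m := Nat.mul_le_mul_right _ hPY
  have e2 : PX.card * (if X.ncard ≤ 4 * r + 1 then m else 0) ≤ (4 * r + 1) * m := by
    split_ifs with h
    · exact Nat.mul_le_mul_right _ (hPX.trans h)
    · simp
  calc _ ≤ 3 * m + m * 2 + (4 * r + 1) * m := by omega
    _ = (4 * r + 6) * m := by ring

end SepLogic

namespace SepLogic

/-! ### Connectivity after the deletion of vertices -/

/-- Paths are traded for reachability, where deleted vertices are tested at the target of each step
and only the start needs a separate test. Shortening a walk to a path does not enlarge its support.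
-/
theorem conn_iff {V : Type} (G : SimpleGraph V) {k : ℕ} (s t : V) (u : Fin k → V) :
    Conn G s t u ↔ (∀ i, u i ≠ s) ∧
      Relation.ReflTransGen (fun x y => G.Adj x y ∧ ∀ i, u i ≠ y) s t := by
  classical
  constructor
  · rintro ⟨p, -, hp⟩
    refine ⟨fun i h => hp i (h ▸ p.start_mem_support), ?_⟩
    induction p with
    | nil => exact .refl
    | cons h p ih =>
      simp only [SimpleGraph.Walk.support_cons, List.mem_cons, not_or] at hp
      exact .head ⟨h, fun i hi => (hp i).2 (hi ▸ p.start_mem_support)⟩ (ih fun i => (hp i).2)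
  · rintro ⟨h, H⟩
    have : ∃ p : G.Walk s t, ∀ i, u i ∉ p.support := by
      induction H using Relation.ReflTransGen.head_induction_on with
      | refl => exact ⟨.nil, by simpa using h⟩
      | head hab _ ih =>
        obtain ⟨p, hp⟩ := ih hab.2
        exact ⟨.cons hab.1 p, by simp [hp, h]⟩
    obtain ⟨p, hp⟩ := this
    exact ⟨p.toPath, p.toPath.2, fun i hi => hp i (p.support_toPath_subset_support hi)⟩

/-- A certificate of separation: a set that can be left only through deleted vertices. It is applied
to the inner vertices of a single arc. -/
theorem not_conn_of_closed {V : Type} {G : SimpleGraph V} {k : ℕ} {s t : V} {u : Fin k → V}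
    (S : V → Prop) (hs : S s) (ht : ¬ S t) (h : ∀ x y, S x → G.Adj x y → (∀ i, u i ≠ y) → S y) :
    ¬ Conn G s t u := by
  rw [conn_iff]
  rintro ⟨-, H⟩
  have key : ∀ z, Relation.ReflTransGen (fun x y => G.Adj x y ∧ ∀ i, u i ≠ y) s z → S z := by
    intro z H
    induction H with
    | refl => exact hs
    | tail _ h' ih => exact h _ _ ih h'.1 h'.2
  exact ht (key t H)

/-! ### The graph of a binary relation -/

/-- The vertices of the graph that encodes a relation on `δ`: three special vertices, the
elements of `δ`, and for each pair in `δ` the inner vertices of a path. -/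
inductive Vtx (δ : Type) (L : ℕ) : Type
  | R : Vtx δ L
  | Z : Vtx δ L
  | q : Vtx δ L
  | br (a : δ) : Vtx δ L
  | pt (a b : δ) (i : Fin L) : Vtx δ L

/-- The edges of the graph that encodes the relation `D`, each in one direction. -/
def halfAdj {δ : Type} {L : ℕ} (D : δ → δ → Prop) : Vtx δ L → Vtx δ L → Prop
  | .R, .Z => True
  | .R, .q => True
  | .Z, .q => True
  | .R, .br _ => True
  | .br a, .pt a' b i => a = a' ∧ D a' b ∧ (i : ℕ) = 0
  | .pt a b i, .pt a' b' i' => a = a' ∧ b = b' ∧ D a b ∧ (i : ℕ) + 1 = i'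
  | .pt a b i, .br b' => b = b' ∧ D a b ∧ (i : ℕ) + 1 = L
  | .pt a b i, .Z => D a b ∧ (i : ℕ) + 1 = L
  | _, _ => False

/-- The graph that encodes the relation `D`: each pair in `D` becomes a path with `L` inner
vertices, the last of which is adjacent to the vertex `Z`; the vertex `R` is adjacent to all elements
of `δ`. -/
def arcGraph {δ : Type} (L : ℕ) (D : δ → δ → Prop) : SimpleGraph (Vtx δ L) where
  Adj u v := halfAdj D u v ∨ halfAdj D v u
  symm := ⟨fun _ _ h => h.symm⟩
  loopless := ⟨fun u h => by cases u <;> simp [halfAdj] at h⟩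

section arcGraph

variable {δ : Type} {L : ℕ} {D : δ → δ → Prop}

/-! ### Neighbourhoods and distances in the graph of a relation -/

theorem adj_R {v : Vtx δ L} : (arcGraph L D).Adj .R v ↔ v = .Z ∨ v = .q ∨ ∃ a, v = .br a := by
  cases v <;> simp [arcGraph, halfAdj]

theorem adj_Z {v : Vtx δ L} : (arcGraph L D).Adj .Z v ↔
    v = .R ∨ v = .q ∨ ∃ a b i, v = .pt a b i ∧ D a b ∧ (i : ℕ) + 1 = L := by
  cases v <;> simp [arcGraph, halfAdj]

theorem adj_q {v : Vtx δ L} : (arcGraph L D).Adj .q v ↔ v = .R ∨ v = .Z := by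
  cases v <;> simp [arcGraph, halfAdj]

theorem adj_br {c : δ} {v : Vtx δ L} : (arcGraph L D).Adj (.br c) v ↔
    v = .R ∨ ∃ a b i, v = .pt a b i ∧ D a b ∧ (c = a ∧ (i : ℕ) = 0 ∨ b = c ∧ (i : ℕ) + 1 = L) := by
  cases v <;> simp [arcGraph, halfAdj]
  tauto

theorem adj_pt {a b : δ} {i : Fin L} {v : Vtx δ L} : (arcGraph L D).Adj (.pt a b i) v ↔
    D a b ∧ ((v = .br a ∧ (i : ℕ) = 0) ∨ (v = .br b ∧ (i : ℕ) + 1 = L) ∨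
      (v = .Z ∧ (i : ℕ) + 1 = L) ∨
      ∃ j, v = .pt a b j ∧ ((i : ℕ) + 1 = j ∨ (j : ℕ) + 1 = i)) := by
  cases v with
  | pt a' b' j =>
    simp only [arcGraph, halfAdj, Vtx.pt.injEq, reduceCtorEq, false_and, false_or]
    constructor
    · rintro (⟨rfl, rfl, h, h'⟩ | ⟨rfl, rfl, h, h'⟩)
      · exact ⟨h, j, ⟨rfl, rfl, rfl⟩, .inl h'⟩
      · exact ⟨h, j, ⟨rfl, rfl, rfl⟩, .inr h'⟩
    · rintro ⟨h, k, ⟨rfl, rfl, rfl⟩, h' | h'⟩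
      · exact .inl ⟨rfl, rfl, h, h'⟩
      · exact .inr ⟨rfl, rfl, h, h'⟩
  | br c =>
    simp only [arcGraph, halfAdj, Vtx.br.injEq, reduceCtorEq, false_and, exists_false, or_false]
    constructor
    · rintro (⟨rfl, h, h'⟩ | ⟨rfl, h, h'⟩)
      · exact ⟨h, .inr ⟨rfl, h'⟩⟩
      · exact ⟨h, .inl ⟨rfl, h'⟩⟩
    · rintro ⟨h, ⟨rfl, h'⟩ | ⟨rfl, h'⟩⟩
      · exact .inr ⟨rfl, h, h'⟩
      · exact .inl ⟨rfl, h, h'⟩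
  | _ => simp [arcGraph, halfAdj]

/-- A potential that grows by at most one along every edge outside `Y` gives a lower bound on the
length of walks outside `Y`. -/
theorem le_length_of_lipschitz {V : Type} {G : SimpleGraph V} (Y : Set V) (f : V → ℕ)
    (hf : ∀ x y, x ∉ Y → y ∉ Y → G.Adj x y → f y ≤ f x + 1) {x y : V} (p : G.Walk x y)
    (hp : ∀ w ∈ p.support, w ∉ Y) : f y ≤ f x + p.length := by
  induction p with
  | nil => simp
  | cons h p ih =>
    simp only [SimpleGraph.Walk.support_cons, List.mem_cons, forall_eq_or_imp] at hp
    have h1 := ih hp.2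
    have h2 := hf _ _ hp.1 (hp.2 _ p.start_mem_support) h
    simp only [SimpleGraph.Walk.length_cons]
    omega

open Classical in
theorem sparse_arcGraph [Fintype δ] (h : Fintype.card δ ≤ L) : Sparse (arcGraph L D) := by
  refine ⟨Set.range .br, {.R, .Z, .q}, ?_, ?_, ?_⟩
  · exact (Set.ncard_insert_le _ _).trans (Nat.succ_le_succ ((Set.ncard_insert_le _ _).trans (by simp)))
  · intro v hX hY
    cases v with
    | pt a b i =>
      have : (arcGraph L D).neighborSet (.pt a b i) \ {.R, .Z, .q} ⊆
          {if (i : ℕ) = 0 then .br a else .pt a b ⟨i - 1, by omega⟩,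
            if h : (i : ℕ) + 1 = L then .br b else .pt a b ⟨i + 1, by omega⟩} := by
        rintro v ⟨hv, hY⟩
        rw [SimpleGraph.mem_neighborSet, adj_pt] at hv
        simp only [Set.mem_insert_iff, Set.mem_singleton_iff, not_or] at hY
        rcases hv.2 with ⟨rfl, h⟩ | ⟨rfl, h⟩ | ⟨rfl, h⟩ | ⟨j, rfl, h | h⟩
        · left; rw [if_pos h]
        · right; rw [Set.mem_singleton_iff, dif_pos h]
        · exact absurd rfl hY.2.1
        · right
          rw [Set.mem_singleton_iff, dif_neg (by omega)]
          congr 1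
          exact Fin.ext h.symm
        · left
          rw [if_neg (by omega)]
          congr 1
          exact Fin.ext (by simp only; omega)
      exact (Set.ncard_le_ncard this (Set.toFinite _)).trans
        ((Set.ncard_insert_le _ _).trans (by simp))
    | br a => exact absurd ⟨a, rfl⟩ hX
    | _ => simp at hY
  · rintro _ ⟨a, rfl⟩ _ ⟨b, rfl⟩ hab p hp
    have hab : a ≠ b := fun h => hab (by rw [h])
    have hX : (Set.range (Vtx.br : δ → Vtx δ L)).ncard ≤ L := by
      rw [← Set.image_univ]
      refine (Set.ncard_image_le (Set.toFinite _)).trans ?_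
      rwa [Set.ncard_univ, Nat.card_eq_fintype_card]
    -- The distance from `br a` in the absence of the special vertices, truncated at `L`: on arcs
    -- that leave `a` it is counted from the first inner vertex, on arcs that enter `a` from the
    -- last.
    let f : Vtx δ L → ℕ := fun v => match v with
      | .br c => if c = a then 0 else L
      | .pt c d i => min (if c = a then (i : ℕ) + 1 else L) (if d = a then L - i else L)
      | _ => 0
    have := le_length_of_lipschitz {.R, .Z, .q} f (fun x y hx hy hxy => ?_) p hp
    · simp only [f, if_true, if_neg hab.symm] at this
      omega
    · simp only [Set.mem_insert_iff, Set.mem_singleton_iff, not_or] at hx hy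
      cases x with
      | br c =>
        rcases adj_br.1 hxy with rfl | ⟨a', b', i, rfl, -, ⟨rfl, hi⟩ | ⟨rfl, hi⟩⟩
        · exact absurd rfl hy.1
        · simp only [f]; split_ifs <;> omega
        · simp only [f]; split_ifs <;> omega
      | pt c d i =>
        rcases (adj_pt.1 hxy).2 with ⟨rfl, h⟩ | ⟨rfl, h⟩ | ⟨rfl, h⟩ | ⟨j, rfl, h⟩
        · simp only [f]; split_ifs <;> omega
        · simp only [f]; split_ifs <;> omega
        · exact absurd rfl hy.2.1
        · simp only [f]; split_ifs <;> omega
      | _ => simp at hx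

/-! ### Definability of the arcs and of the special vertices -/

/-- The vertices `R` and `Z` of `arcGraph` define the relation. -/
def ArcSem {V : Type} (G : SimpleGraph V) (R Z x y : V) : Prop :=
  ∃ w, G.Adj y R ∧ G.Adj w y ∧ G.Adj w Z ∧ Conn G w x ![y, Z] ∧ ¬ Conn G w R ![x, y, Z]

/-- Running back along the path towards the tail uses neither its head nor `Z`, so this connection
survives their deletion. -/
theorem reach_br {k : ℕ} {u : Fin k → Vtx δ L} {c d : δ} (hD : D c d) (hc : ∀ i, u i ≠ .br c)
    (hp : ∀ i j, u i ≠ .pt c d j) (j : Fin L) :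
    Relation.ReflTransGen (fun x y => (arcGraph L D).Adj x y ∧ ∀ i, u i ≠ y) (.pt c d j) (.br c) := by
  obtain ⟨j, hj⟩ := j
  induction j with
  | zero => exact .single ⟨adj_pt.2 ⟨hD, .inl ⟨rfl, rfl⟩⟩, hc⟩
  | succ j ih =>
    exact .head ⟨adj_pt.2 ⟨hD, .inr (.inr (.inr ⟨⟨j, by omega⟩, rfl, .inr rfl⟩))⟩, fun i => hp i _⟩
      (ih (by omega))

theorem conn_R_of_arc {k : ℕ} {u : Fin k → Vtx δ L} {c d : δ} (hD : D c d) (hc : ∀ i, u i ≠ .br c)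
    (hp : ∀ i j, u i ≠ .pt c d j) (hR : ∀ i, u i ≠ .R) (j : Fin L) :
    Conn (arcGraph L D) (.pt c d j) .R u :=
  (conn_iff _ _ _ _).2 ⟨fun i => hp i j, (reach_br hD hc hp j).tail ⟨adj_br.2 (.inl rfl), hR⟩⟩

/-- The only possible `w` is the last inner vertex of an arc `c → d` with `y = br d`. If `c` is
different from `a` and `d`, then `w` reaches `R` through `c` even after all three deletions, against
the last condition. If `c = a`, these deletions cut the path off from the rest. -/
theorem arcSem_arcGraph (hL : 2 ≤ L) {a : δ} (ha : ¬ D a a) (y : Vtx δ L) :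
    ArcSem (arcGraph L D) .R .Z (.br a) y ↔ ∃ b, y = .br b ∧ D a b := by
  constructor
  · rintro ⟨w, h1, h2, h3, h4, h5⟩
    have hwR : w ≠ .R := by
      rintro rfl
      refine h5 ((conn_iff _ _ _ _).2 ⟨fun i => ?_, .refl⟩)
      fin_cases i <;> simp
      rintro rfl
      exact (arcGraph L D).irrefl h1
    rcases adj_Z.1 h3.symm with rfl | rfl | ⟨c, d, i, rfl, hcd, hi⟩
    · exact absurd rfl hwR
    · rcases adj_q.1 h2 with rfl | rfl
      · exact absurd h1 (arcGraph L D).irrefl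
      · refine absurd ((conn_iff _ _ _ _).2 ⟨fun i => ?_, .single
           ⟨adj_q.2 (.inl rfl),
          fun i => ?_⟩⟩) h5
        · fin_cases i <;> simp
        · fin_cases i <;> simp
    · rcases (adj_pt.1 h2).2 with ⟨rfl, h⟩ | ⟨rfl, h⟩ | ⟨rfl, h⟩ | ⟨j, rfl, h⟩
      · omega
      · refine ⟨d, rfl, ?_⟩
        by_cases hca : c = a
        · exact hca ▸ hcd
        exfalso
        by_cases hcd' : c = d
        -- The arc is a loop at `c`: deleting `br c` and `Z` isolates its path, so `w` cannot reach
        -- `br a`.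
        · subst hcd'
          refine not_conn_of_closed (fun v => ∃ i : Fin L, v = Vtx.pt c c i) ⟨i, rfl⟩ (by simp) ?_ h4
          rintro _ y ⟨i, rfl⟩ h hy
          rcases (adj_pt.1 h).2 with ⟨rfl, h⟩ | ⟨rfl, h⟩ | ⟨rfl, h⟩ | ⟨j, rfl, h⟩
          · exact absurd rfl (hy 0)
          · exact absurd rfl (hy 0)
          · exact absurd rfl (hy 1)
          · exact ⟨j, rfl⟩
        · refine h5 (conn_R_of_arc hcd (fun i => ?_) (fun i j => ?_) (fun i => ?_) _) <;>
            fin_cases i <;> simp [Ne.symm hca, Ne.symm hcd']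
      -- Here `y = Z`, so the path remains attached at both ends; one of them differs from `br a`,
      -- since there is no loop at `a`, and leads to `R`.
      · exfalso
        by_cases hda : d = a
        · have hca : c ≠ a := by
            rintro rfl
            exact ha (hda ▸ hcd)
          refine h5 (conn_R_of_arc hcd (fun i => ?_) (fun i j => ?_) (fun i => ?_) _) <;>
            fin_cases i <;> simp [Ne.symm hca]
        · refine h5 ((conn_iff _ _ _ _).2 ⟨fun i => ?_, .head (b := .br d)
            ⟨adj_pt.2 ⟨hcd, .inr (.inl ⟨rfl, hi⟩)⟩, fun i => ?_⟩
            (.single ⟨adj_br.2 (.inl rfl), fun i => ?_⟩)⟩) <;>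
            fin_cases i <;> simp [Ne.symm hda]
      · have := adj_R.1 h1.symm
        simp at this
  · rintro ⟨b, rfl, hab⟩
    have hne : a ≠ b := fun h => ha (h ▸ hab)
    refine ⟨.pt a b ⟨L - 1, by omega⟩, adj_br.2 (.inl rfl),
      adj_pt.2 ⟨hab, .inr (.inl ⟨rfl, by simp only; omega⟩)⟩,
      adj_pt.2 ⟨hab, .inr (.inr (.inl ⟨rfl, by simp only; omega⟩))⟩,
      (conn_iff _ _ _ _).2 ⟨fun i => ?_, reach_br hab (fun i => ?_) (fun i j => ?_) _⟩, ?_⟩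
    · fin_cases i <;> simp
    · fin_cases i <;> simp [hne.symm]
    · fin_cases i <;> simp
    · refine not_conn_of_closed (fun v => ∃ i : Fin L, v = Vtx.pt a b i) ⟨_, rfl⟩ (by simp) ?_
      rintro _ y ⟨i, rfl⟩ h hy
      rcases (adj_pt.1 h).2 with ⟨rfl, h⟩ | ⟨rfl, h⟩ | ⟨rfl, h⟩ | ⟨j, rfl, h⟩
      · exact absurd rfl (hy 0)
      · exact absurd rfl (hy 1)
      · exact absurd rfl (hy 2)
      · exact ⟨j, rfl⟩

/-- Every other triangle would be a loop subdivided by exactly two vertices, which `3 ≤ L` excludes.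
-/
theorem special_of_triangle (hL : 3 ≤ L) {x y z : Vtx δ L} (hxy : (arcGraph L D).Adj x y)
    (hyz : (arcGraph L D).Adj y z) (hzx : (arcGraph L D).Adj z x) : x = .R ∨ x = .Z ∨ x = .q := by
  cases x with
  | br c =>
    exfalso
    rcases adj_br.1 hxy with rfl | ⟨a, b, i, rfl, hab, hi⟩
    · rcases adj_br.1 hzx.symm with rfl | ⟨a, b, i, rfl, hab, hi⟩
      · exact (arcGraph L D).irrefl hyz
      · simpa using adj_R.1 hyz
    · rcases adj_br.1 hzx.symm with rfl | ⟨a', b', i', rfl, hab', hi'⟩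
      · simpa using adj_R.1 hyz.symm
      · have := (adj_pt.1 hyz).2
        simp only [reduceCtorEq, false_and, false_or, Vtx.pt.injEq] at this
        obtain ⟨j, ⟨rfl, rfl, rfl⟩, h⟩ := this
        omega
  | pt a b i =>
    exfalso
    rcases (adj_pt.1 hxy).2 with ⟨rfl, h⟩ | ⟨rfl, h⟩ | ⟨rfl, h⟩ | ⟨j, rfl, h⟩ <;>
    rcases (adj_pt.1 hzx.symm).2 with ⟨rfl, h'⟩ | ⟨rfl, h'⟩ | ⟨rfl, h'⟩ | ⟨j', rfl, h'⟩ <;>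
    first
      | omega
      | exact (arcGraph L D).irrefl hyz
      | skip
    all_goals
      first
        | (simp [adj_br] at hyz; done)
        | (simp [adj_Z] at hyz; done)
        | skip
    · have := (adj_pt.1 hyz.symm).2
      simp at this; omega
    · have := (adj_pt.1 hyz.symm).2
      simp at this; omega
    · have := (adj_pt.1 hyz.symm).2
      simp at this; omega
    · have := (adj_pt.1 hyz).2
      simp at this; omega
    · have := (adj_pt.1 hyz).2
      simp at this; omega
    · have := (adj_pt.1 hyz).2
      simp at this; omega
    · have := (adj_pt.1 hyz).2
      simp at this; omega
  | _ => simp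

/-- The special vertices and a given element of `δ` are characterized by a pattern. -/
def Anchored {V : Type} (G : SimpleGraph V) (q R Z w s : V) : Prop :=
  G.Adj q R ∧ G.Adj R Z ∧ G.Adj Z q ∧ G.Adj Z w ∧ w ≠ R ∧ w ≠ q ∧ G.Adj R s ∧ s ≠ q ∧ s ≠ Z ∧
    ∀ u, G.Adj s u → G.Adj u Z → u = R

/-- The triangle admits six labellings. Both `Z'` (because of `w`) and `R'` (because of `s`) have a
neighbour outside the triangle, unlike `q`. If `R` and `Z` were swapped, `s` would be the last inner
vertex of an arc, and the head of this arc would be a forbidden common neighbour of `s` and `R`. In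
the correct labelling the common neighbours of `s = br b` and `Z` other than `R` are the last inner
vertices of arcs into `b`; so `b` has no predecessor, which leaves only `s₀`. -/
theorem anchored_arcGraph (hL : 3 ≤ L) {s₀ : δ} (h₀ : ∀ a, ¬ D a s₀)
    (h₁ : ∀ b, b ≠ s₀ → ∃ a, D a b) {q' R' Z' w s : Vtx δ L} :
    Anchored (arcGraph L D) q' R' Z' w s ↔ (q' = .q ∧ R' = .R ∧ Z' = .Z ∧ s = .br s₀ ∧
      ∃ a b i, w = .pt a b i ∧ D a b ∧ (i : ℕ) + 1 = L) := by
  constructor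
  · rintro ⟨a1, a2, a3, a4, n1, n2, a5, n3, n4, hs⟩
    have head : ∀ b, b ≠ s₀ → ∃ a, ∃ i : Fin L, D a b ∧ (i : ℕ) + 1 = L := fun b hb => by
      obtain ⟨a, ha⟩ := h₁ b hb
      exact ⟨a, ⟨L - 1, by omega⟩, ha, by simp only; omega⟩
    rcases special_of_triangle hL a2 a3 a1 with rfl | rfl | rfl
    · rcases adj_R.1 a1.symm with rfl | rfl | ⟨a, rfl⟩
      · rcases adj_R.1 a2 with rfl | rfl | ⟨b, rfl⟩
        · exact absurd a3 (arcGraph L D).irrefl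
        · rcases adj_q.1 a4 with rfl | rfl <;> simp at n1 n2
        · simp [adj_br] at a3
      · rcases adj_R.1 a2 with rfl | rfl | ⟨b, rfl⟩
        · rcases adj_R.1 a5 with rfl | rfl | ⟨b, rfl⟩
          · exact absurd rfl n4
          · exact absurd rfl n3
          · refine ⟨rfl, rfl, rfl, ?_, ?_⟩
            · by_contra hb
              obtain ⟨a, i, hab, hi⟩ := head b (fun h => hb (by rw [h]))
              have := hs (.pt a b i) (adj_br.2 (.inr ⟨a, b, i, rfl, hab, .inr ⟨rfl, hi⟩⟩))
                (adj_pt.2 ⟨hab, .inr (.inr (.inl ⟨rfl, hi⟩))⟩)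
              simp at this
            · rcases adj_Z.1 a4 with rfl | rfl | h
              · exact absurd rfl n1
              · exact absurd rfl n2
              · exact h
        · exact absurd a3 (arcGraph L D).irrefl
        · simp [adj_br] at a3
      · rcases special_of_triangle hL a1 a2 a3 with h | h | h <;> simp at h
    · exfalso
      rcases special_of_triangle hL a3 a1 a2 with rfl | rfl | rfl
      · rcases adj_Z.1 a5 with rfl | rfl | ⟨a, b, i, rfl, hab, hi⟩
        · exact absurd rfl n4
        · rcases special_of_triangle hL a1 a2 a3 with rfl | rfl | rfl
          · exact (arcGraph L D).irrefl a3
          · exact (arcGraph L D).irrefl a1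
          · exact absurd rfl n3
        · have := hs (.br b) (adj_pt.2 ⟨hab, .inr (.inl ⟨rfl, hi⟩)⟩) (adj_br.2 (.inl rfl))
          simp at this
      · exact (arcGraph L D).irrefl a2
      · rcases adj_q.1 a4 with rfl | rfl
        · rcases adj_q.1 a3 with rfl | rfl
          · exact n2 rfl
          · exact (arcGraph L D).irrefl a1
        · exact n1 rfl
    · exfalso
      rcases adj_q.1 a2 with rfl | rfl <;> rcases adj_q.1 a1.symm with rfl | rfl <;>
        rcases adj_q.1 a5 with rfl | rfl <;> simp_all
  · rintro ⟨rfl, rfl, rfl, rfl, a, b, i, rfl, hab, hi⟩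
    refine ⟨adj_q.2 (.inl rfl), adj_R.2 (.inl rfl), adj_Z.2 (.inr (.inl rfl)),
      adj_Z.2 (.inr (.inr ⟨a, b, i, rfl, hab, hi⟩)), by simp, by simp,
      adj_R.2 (.inr (.inr ⟨_, rfl⟩)), by simp, by simp, fun u hu hZ => ?_⟩
    rcases adj_br.1 hu with rfl | ⟨a, b, i, rfl, hab, ⟨rfl, hi⟩ | ⟨rfl, hi⟩⟩
    · rfl
    · have := (adj_pt.1 hZ).2
      simp at this
      omega
    · exact absurd hab (h₀ a)

end arcGraph

end SepLogic

namespace SepLogic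

open FirstOrder Language

/-! ### Satisfaction of formulas -/

/-- Satisfaction of a formula when the variables have the values given by `h`. -/
def Sat {V : Type} (G : SimpleGraph V) {n : ℕ} (φ : sepLang.BoundedFormula Empty n) (h : ℕ → V) :
    Prop :=
  @BoundedFormula.Realize sepLang V (sepStructure G) Empty n φ default fun i => h i

section Sat

variable {V : Type} {G : SimpleGraph V} {n : ℕ} {h : ℕ → V}

/-- The variable with index `i`. -/
def tv (n i : ℕ) : sepLang.Term (Empty ⊕ Fin (n + 1)) := .var (.inr (Fin.ofNat (n + 1) i))

/-- The value of a term. -/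
def tval (G : SimpleGraph V) (h : ℕ → V) (t : sepLang.Term (Empty ⊕ Fin (n + 1))) : V :=
  @Term.realize sepLang V (sepStructure G) _ (Sum.elim default fun i : Fin (n + 1) => h i) t

theorem tval_tv {i : ℕ} (hi : i ≤ n) : tval G h (tv n i) = h i := by
  simp [tval, tv, Nat.mod_eq_of_lt (Nat.lt_succ_of_le hi)]

theorem sat_falsum : Sat G (.falsum : sepLang.BoundedFormula Empty n) h ↔ False := Iff.rfl

theorem sat_imp {φ ψ : sepLang.BoundedFormula Empty n} :
    Sat G (.imp φ ψ) h ↔ (Sat G φ h → Sat G ψ h) := Iff.rfl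

/-- With assignments defined on all of `ℕ`, a quantifier at depth `n` is an update at `n`, and a
variable keeps its index under further quantifiers. -/
theorem sat_all {φ : sepLang.BoundedFormula Empty (n + 1)} :
    Sat G (.all φ) h ↔ ∀ a, Sat G φ (Function.update h n a) := by
  have : ∀ a, (Fin.snoc (fun i : Fin n => h i) a : Fin (n + 1) → V) =
      fun i : Fin (n + 1) => Function.update h n a i := by
    intro a
    funext i
    refine Fin.lastCases ?_ (fun j => ?_) i
    · simp
    · simp [Function.update_of_ne j.2.ne]
  change (∀ a, @BoundedFormula.Realize sepLang V (sepStructure G) Empty _ φ default _) ↔ _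
  simp only [this]
  exact Iff.rfl

/-- Equality of two variables. -/
def eqF (n i j : ℕ) : sepLang.BoundedFormula Empty (n + 1) := .equal (tv n i) (tv n j)

/-- Adjacency of two variables. -/
def adjF (n i j : ℕ) : sepLang.BoundedFormula Empty (n + 1) :=
  .rel (SepRel.adj : sepLang.Relations 2) ![tv n i, tv n j]

/-- The predicate `conn₂` applied to variables. -/
def connF₂ (n i j a b : ℕ) : sepLang.BoundedFormula Empty (n + 1) :=
  .rel (SepRel.conn 2 : sepLang.Relations 4) ![tv n i, tv n j, tv n a, tv n b]

/-- The predicate `conn₃` applied to variables. -/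
def connF₃ (n i j a b c : ℕ) : sepLang.BoundedFormula Empty (n + 1) :=
  .rel (SepRel.conn 3 : sepLang.Relations 5) ![tv n i, tv n j, tv n a, tv n b, tv n c]

theorem sat_eqF {i j : ℕ} (hi : i ≤ n) (hj : j ≤ n) : Sat G (eqF n i j) h ↔ h i = h j := by
  change tval G h (tv n i) = tval G h (tv n j) ↔ _
  rw [tval_tv hi, tval_tv hj]

theorem sat_adjF {i j : ℕ} (hi : i ≤ n) (hj : j ≤ n) :
    Sat G (adjF n i j) h ↔ G.Adj (h i) (h j) := by
  change G.Adj (tval G h (tv n i)) (tval G h (tv n j)) ↔ _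
  rw [tval_tv hi, tval_tv hj]

theorem sat_connF₂ {i j a b : ℕ} (hi : i ≤ n) (hj : j ≤ n) (ha : a ≤ n) (hb : b ≤ n) :
    Sat G (connF₂ n i j a b) h ↔ Conn G (h i) (h j) ![h a, h b] := by
  have : (fun k : Fin 2 => tval G h (![tv n i, tv n j, tv n a, tv n b] k.succ.succ)) =
      ![h a, h b] := by
    funext k
    fin_cases k
    · exact tval_tv ha
    · exact tval_tv hb
  rw [← this, ← tval_tv (G := G) (h := h) hi, ← tval_tv (G := G) (h := h) hj]
  exact Iff.rfl

theorem sat_connF₃ {i j a b c : ℕ} (hi : i ≤ n) (hj : j ≤ n) (ha : a ≤ n) (hb : b ≤ n)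
    (hc : c ≤ n) : Sat G (connF₃ n i j a b c) h ↔ Conn G (h i) (h j) ![h a, h b, h c] := by
  have : (fun k : Fin 3 => tval G h (![tv n i, tv n j, tv n a, tv n b, tv n c] k.succ.succ)) =
      ![h a, h b, h c] := by
    funext k
    fin_cases k
    · exact tval_tv ha
    · exact tval_tv hb
    · exact tval_tv hc
  rw [← this, ← tval_tv (G := G) (h := h) hi, ← tval_tv (G := G) (h := h) hj]
  exact Iff.rfl

/-- Negation. -/
def negF (φ : sepLang.BoundedFormula Empty n) : sepLang.BoundedFormula Empty n := .imp φ .falsum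

theorem sat_negF {φ : sepLang.BoundedFormula Empty n} : Sat G (negF φ) h ↔ ¬ Sat G φ h := Iff.rfl

/-- There is no arc from the variable `x` to the variable `y`. -/
def noArcF (n x y : ℕ) : sepLang.BoundedFormula Empty (n + 1) :=
  .all (.imp (adjF (n + 1) y 1) (.imp (adjF (n + 1) (n + 1) y) (.imp (adjF (n + 1) (n + 1) 2)
    (.imp (connF₂ (n + 1) (n + 1) x y 2) (connF₃ (n + 1) (n + 1) 1 x y 2)))))

theorem sat_noArcF {x y : ℕ} (hn : 2 ≤ n) (hx : x ≤ n) (hy : y ≤ n) :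
    Sat G (noArcF n x y) h ↔ ¬ ArcSem G (h 1) (h 2) (h x) (h y) := by
  rw [noArcF, sat_all]
  simp only [sat_imp, sat_adjF (show y ≤ n + 1 by omega) (show 1 ≤ n + 1 by omega),
    sat_adjF le_rfl (show y ≤ n + 1 by omega), sat_adjF le_rfl (show 2 ≤ n + 1 by omega),
    sat_connF₂ le_rfl (show x ≤ n + 1 by omega) (show y ≤ n + 1 by omega) (show 2 ≤ n + 1 by omega),
    sat_connF₃ le_rfl (show 1 ≤ n + 1 by omega) (show x ≤ n + 1 by omega)
      (show y ≤ n + 1 by omega) (show 2 ≤ n + 1 by omega), Function.update_self,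
    Function.update_of_ne (show 1 ≠ n + 1 by omega), Function.update_of_ne (show 2 ≠ n + 1 by omega),
    Function.update_of_ne (show x ≠ n + 1 by omega), Function.update_of_ne (show y ≠ n + 1 by omega),
    ArcSem]
  push Not
  exact Iff.rfl

/-- There is an arc from the variable `x` to a variable of the list. -/
def someArcF (n x : ℕ) : List ℕ → sepLang.BoundedFormula Empty (n + 1)
  | [] => .falsum
  | y :: l => .imp (noArcF n x y) (someArcF n x l)

theorem sat_someArcF {x : ℕ} (hn : 2 ≤ n) (hx : x ≤ n) {l : List ℕ} (hl : ∀ y ∈ l, y ≤ n) :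
    Sat G (someArcF n x l) h ↔ ∃ y ∈ l, ArcSem G (h 1) (h 2) (h x) (h y) := by
  induction l with
  | nil => simp [someArcF, sat_falsum]
  | cons y l ih =>
    simp only [List.mem_cons, forall_eq_or_imp] at hl
    rw [someArcF, sat_imp, sat_noArcF hn hx hl.1, ih hl.2]
    simp only [List.mem_cons, exists_eq_or_imp]
    tauto

/-- The last variable has an arc to its predecessor if and only if it has an arc to one of the
variables before, from the variable 4 on. -/
def leafF (n : ℕ) : sepLang.BoundedFormula Empty (n + 1) :=
  negF (.imp (.imp (someArcF n n ((List.range (n - 5)).map (· + 4))) (negF (noArcF n n (n - 1))))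
    (negF (.imp (negF (noArcF n n (n - 1))) (someArcF n n ((List.range (n - 5)).map (· + 4))))))

theorem sat_leafF (hn : 2 ≤ n) : Sat G (leafF n) h ↔ (ArcSem G (h 1) (h 2) (h n) (h (n - 1)) ↔
    ∃ y, 4 ≤ y ∧ y + 1 < n ∧ ArcSem G (h 1) (h 2) (h n) (h y)) := by
  have h1 : (∃ y ∈ (List.range (n - 5)).map (· + 4), ArcSem G (h 1) (h 2) (h n) (h y)) ↔
      ∃ y, 4 ≤ y ∧ y + 1 < n ∧ ArcSem G (h 1) (h 2) (h n) (h y) := by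
    constructor
    · rintro ⟨y, hy, h⟩
      simp only [List.mem_map, List.mem_range] at hy
      obtain ⟨z, hz, rfl⟩ := hy
      exact ⟨_, by omega, by omega, h⟩
    · rintro ⟨y, h1, h2, h⟩
      exact ⟨y, List.mem_map.2 ⟨y - 4, List.mem_range.2 (by omega), by omega⟩, h⟩
  simp only [leafF, sat_negF, sat_imp]
  rw [sat_noArcF hn le_rfl (by omega), sat_someArcF hn le_rfl, h1]
  · generalize (∃ y, 4 ≤ y ∧ y + 1 < n ∧ ArcSem G (h 1) (h 2) (h n) (h y)) = A
    tauto
  · intro y hy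
    simp only [List.mem_map, List.mem_range] at hy
    omega

/-- Quantifiers along arcs that start at the last variable; `true` stands for `∃`. -/
def moveF : List Bool → (n : ℕ) → sepLang.BoundedFormula Empty (n + 1)
  | [], n => leafF n
  | true :: l, n => negF (.all (.imp (negF (noArcF (n + 1) n (n + 1))) (negF (moveF l (n + 1)))))
  | false :: l, n => .all (.imp (negF (noArcF (n + 1) n (n + 1))) (moveF l (n + 1)))

/-- The sentence that starts with the pattern `Anchored`. -/
def mainF (l : List Bool) : sepLang.Sentence :=
  -- The variables 0, 1, 2, 3, 4 stand for `q`, `R`, `Z`, `w`, `s` in `Anchored`; the history of the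
  -- game starts with variable 4.
  .all (.all (.all (.all (.all (.imp (adjF 4 0 1) (.imp (adjF 4 1 2) (.imp (adjF 4 2 0)
    (.imp (adjF 4 2 3) (.imp (negF (eqF 4 3 1)) (.imp (negF (eqF 4 3 0)) (.imp (adjF 4 1 4)
    (.imp (negF (eqF 4 4 0)) (.imp (negF (eqF 4 4 2))
    (.imp (.all (.imp (adjF 5 4 5) (.imp (adjF 5 5 2) (eqF 5 5 1)))) (moveF l 4))))))))))))))) 

end Sat

/-- The game on a relation that the formula `moveF` describes; the positions visited so far are
listed in reverse order. -/
def Play {δ : Type} (D : δ → δ → Prop) : List Bool → List δ → Prop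
  | [], a :: b :: l => D a b ↔ ∃ c ∈ l, D a c
  | true :: qs, a :: l => ∃ b, D a b ∧ Play D qs (b :: a :: l)
  | false :: qs, a :: l => ∀ b, D a b → Play D qs (b :: a :: l)
  | _, _ => False

/-- The history occupies the variables from 4 to `n`, the newest position last, so entry `k` of the
reversed list is variable `n - k`. The condition `5 ≤ n + qs.length` provides at least one move,
hence a predecessor for the final test. -/
theorem sat_moveF {δ : Type} {L : ℕ} {D : δ → δ → Prop} (hL : 2 ≤ L) (hD : ∀ a, ¬ D a a)
    (qs : List Bool) : ∀ (n : ℕ) (h : ℕ → Vtx δ L) (l : List δ), 4 ≤ n → 5 ≤ n + qs.length →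
    h 1 = .R → h 2 = .Z → l.length = n - 3 →
    (∀ k (hk : k < l.length), h (n - k) = .br l[k]) →
    (Sat (arcGraph L D) (moveF qs n) h ↔ Play D qs l) := by
  have arc : ∀ a b, ArcSem (arcGraph L D) .R .Z (.br a) (.br b) ↔ D a b := fun a b => by
    rw [arcSem_arcGraph hL (hD a)]
    simp
  induction qs with
  | nil =>
    rintro n h l h4 h5 hR hZ hl hh
    match l, hl with
    | [], hl => simp at hl; omega
    | [a], hl => simp at hl h5; omega
    | a :: b :: l, hl =>
      simp only [List.length_cons] at hl hh
      simp only [List.length_nil] at h5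
      have e0 := hh 0 (by omega)
      have e1 := hh 1 (by omega)
      simp only [List.getElem_cons_zero, List.getElem_cons_succ, Nat.sub_zero] at e0 e1
      rw [moveF, sat_leafF (by omega), hR, hZ, e0, e1, arc, Play]
      refine iff_congr Iff.rfl ⟨?_, ?_⟩
      · rintro ⟨y, hy, hy', ha⟩
        have := hh (n - y) (by omega)
        rw [show n - (n - y) = y by omega] at this
        obtain ⟨k, hk⟩ : ∃ k, n - y = k + 2 := ⟨n - y - 2, by omega⟩
        simp only [hk, List.getElem_cons_succ] at this
        rw [this, arc] at ha
        exact ⟨_, List.getElem_mem _, ha⟩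
      · rintro ⟨c, hc, ha⟩
        obtain ⟨k, hk, rfl⟩ := List.getElem_of_mem hc
        have := hh (k + 2) (by omega)
        simp only [List.getElem_cons_succ] at this
        exact ⟨n - (k + 2), by omega, by omega, by rw [this, arc]; exact ha⟩
  | cons q qs ih =>
    rintro n h l h4 h5 hR hZ hl hh
    match l, hl with
    | [], hl => simp at hl; omega
    | a :: l, hl =>
      have e0 := hh 0 (by simp)
      simp only [List.getElem_cons_zero, Nat.sub_zero] at e0
      have step : ∀ y, Sat (arcGraph L D) (negF (noArcF (n + 1) n (n + 1)))
          (Function.update h (n + 1) y) ↔ ∃ b, y = .br b ∧ D a b := by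
        intro y
        rw [sat_negF, sat_noArcF (by omega) (by omega) le_rfl, not_not, Function.update_self,
          Function.update_of_ne (by omega), Function.update_of_ne (by omega),
          Function.update_of_ne (by omega), hR, hZ, e0, arcSem_arcGraph hL (hD a)]
      have next : ∀ b, Sat (arcGraph L D) (moveF qs (n + 1)) (Function.update h (n + 1) (.br b)) ↔
          Play D qs (b :: a :: l) := by
        intro b
        refine ih (n + 1) _ _ (by omega) (by simp only [List.length_cons] at h5; omega)
          (by rw [Function.update_of_ne (by omega), hR])
          (by rw [Function.update_of_ne (by omega), hZ])
          (by simp only [List.length_cons] at hl ⊢; omega) ?_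
        rintro (_ | k) hk
        · simp
        · rw [Function.update_of_ne (by omega), Nat.add_sub_add_right]
          exact hh k (by simpa using hk)
      cases q with
      | true =>
        simp only [moveF, sat_negF (φ := .all _), sat_all, sat_imp, step, sat_negF (φ := moveF _ _), Play]
        push Not
        constructor
        · rintro ⟨_, ⟨b, rfl, hb⟩, h⟩
          exact ⟨b, hb, (next b).1 h⟩
        · rintro ⟨b, hb, h⟩
          exact ⟨_, ⟨b, rfl, hb⟩, (next b).2 h⟩
      | false =>
        simp only [moveF, sat_all, sat_imp, step, Play]
        constructor
        · exact fun h b hb => (next b).1 (h _ ⟨b, rfl, hb⟩)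
        · rintro h _ ⟨b, rfl, hb⟩
          exact (next b).2 (h b hb)

/-- Any two anchored tuples agree on `R`, `Z` and the start, and the choice of `w` does not
influence the game; so the universal prefix is harmless. It is not vacuous either: `h₂` and `h₁`
supply an arc, whose last inner vertex serves as `w`. -/
theorem models_mainF {δ : Type} {L : ℕ} {D : δ → δ → Prop} (hL : 3 ≤ L) (hD : ∀ a, ¬ D a a)
    {s : δ} (h₀ : ∀ a, ¬ D a s) (h₁ : ∀ b, b ≠ s → ∃ a, D a b) (h₂ : ∃ b, b ≠ s)
    {qs : List Bool} (hqs : qs ≠ []) :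
    Models (arcGraph L D) (mainF qs) ↔ Play D qs [s] := by
  have e : Models (arcGraph L D) (mainF qs) ↔ Sat (arcGraph L D) (mainF qs) fun _ => .R := by
    refine iff_of_eq (congrArg (@BoundedFormula.Realize sepLang _ (sepStructure _) Empty 0 (mainF qs)
      default) (Subsingleton.elim _ _))
  have hpos := List.length_pos_iff.2 hqs
  rw [e, mainF]
  simp only [sat_all]
  have key : ∀ q' R' Z' w t : Vtx δ L, Sat (arcGraph L D) (.imp (adjF 4 0 1) (.imp (adjF 4 1 2)
    (.imp (adjF 4 2 0)
    (.imp (adjF 4 2 3) (.imp (negF (eqF 4 3 1)) (.imp (negF (eqF 4 3 0)) (.imp (adjF 4 1 4)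
    (.imp (negF (eqF 4 4 0)) (.imp (negF (eqF 4 4 2))
    (.imp (.all (.imp (adjF 5 4 5) (.imp (adjF 5 5 2) (eqF 5 5 1)))) (moveF qs 4)))))))))))
      (Function.update (Function.update (Function.update (Function.update (Function.update
        (fun _ => .R) 0 q') 1 R') 2 Z') 3 w) 4 t) ↔
      (Anchored (arcGraph L D) q' R' Z' w t → Play D qs [s]) := by
    intro q' R' Z' w t
    simp only [sat_imp, sat_all, sat_negF]
    rw [sat_adjF (by omega) (by omega), sat_adjF (by omega) (by omega),
      sat_adjF (by omega) (by omega), sat_adjF (by omega) (by omega),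
      sat_adjF (by omega) (by omega), sat_eqF (by omega) (by omega), sat_eqF (by omega) (by omega),
      sat_eqF (by omega) (by omega), sat_eqF (by omega) (by omega)]
    simp only [sat_adjF (n := 5) (i := 4) (j := 5) (by omega) (by omega),
      sat_adjF (n := 5) (i := 5) (j := 2) (by omega) (by omega),
      sat_eqF (n := 5) (i := 5) (j := 1) (by omega) (by omega)]
    simp only [ne_eq, OfNat.ofNat_ne_zero, OfNat.ofNat_ne_one, not_false_eq_true,
      Function.update_of_ne, Function.update_self, OfNat.one_ne_ofNat, OfNat.zero_ne_ofNat,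
      zero_ne_one, Nat.reduceEqDiff]
    have fin : Anchored (arcGraph L D) q' R' Z' w t → (Sat (arcGraph L D) (moveF qs 4)
        (Function.update (Function.update (Function.update (Function.update (Function.update
        (fun _ => .R) 0 q') 1 R') 2 Z') 3 w) 4 t) ↔ Play D qs [s]) := by
      intro hA
      obtain ⟨rfl, rfl, rfl, rfl, -⟩ := (anchored_arcGraph hL h₀ h₁).1 hA
      refine sat_moveF (by omega) hD qs 4 _ _ le_rfl (by omega) (by simp) (by simp) (by simp) ?_
      intro k hk
      have : k = 0 := by simpa using hk
      subst this
      simp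
    constructor
    · rintro H hA
      have ⟨a1, a2, a3, a4, n1, n2, a5, n3, n4, a6⟩ := hA
      exact (fin hA).1 (H a1 a2 a3 a4 n1 n2 a5 n3 n4 a6)
    · intro H a1 a2 a3 a4 n1 n2 a5 n3 n4 a6
      have hA : Anchored (arcGraph L D) q' R' Z' w t := ⟨a1, a2, a3, a4, n1, n2, a5, n3, n4, a6⟩
      exact (fin hA).2 (H hA)
  simp only [key]
  constructor
  · intro H
    obtain ⟨b, hb⟩ := h₂
    obtain ⟨a, ha⟩ := h₁ b hb
    exact H .q .R .Z (.pt a b ⟨L - 1, by omega⟩) (.br s) ((anchored_arcGraph hL h₀ h₁).2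
      ⟨rfl, rfl, rfl, rfl, a, b, _, rfl, ha, by simp only; omega⟩)
  · intro H _ _ _ _ _ _
    exact H

end SepLogic

namespace SepLogic

open FirstOrder Language

/-! ### The codes of the formulas -/

theorem encTerm_tv {n i : ℕ} (hi : i ≤ n) : encTerm (tv n i) = encNat i := by
  simp [encTerm, tv, termIndex, encFin, Nat.mod_eq_of_lt (Nat.lt_succ_of_le hi)]

/-- The code of `eqF`. -/
def eqW (i j : ℕ) : List Bool := encNat 1 ++ (encNat i ++ encNat j)

/-- The code of `adjF`. -/
def adjW (i j : ℕ) : List Bool := encNat 2 ++ (encNat 0 ++ (encNat i ++ encNat j))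

/-- The code of `connF₂`. -/
def connW₂ (i j a b : ℕ) : List Bool :=
  encNat 2 ++ (encNat 1 ++ (encNat 2 ++ (encNat i ++ (encNat j ++ (encNat a ++ encNat b)))))

/-- The code of `connF₃`. -/
def connW₃ (i j a b c : ℕ) : List Bool :=
  encNat 2 ++ (encNat 1 ++ (encNat 3 ++ (encNat i ++ (encNat j ++ (encNat a ++
    (encNat b ++ encNat c))))))

/-- The code of `noArcF`. -/
def noArcW (n x y : ℕ) : List Bool :=
  encNat 4 ++ (encNat 3 ++ (adjW y 1 ++ (encNat 3 ++ (adjW (n + 1) y ++ (encNat 3 ++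
    (adjW (n + 1) 2 ++ (encNat 3 ++ (connW₂ (n + 1) x y 2 ++ connW₃ (n + 1) 1 x y 2))))))))

/-- The code of `someArcF`. -/
def someArcW (n x : ℕ) (l : List ℕ) : List Bool :=
  l.flatMap (fun y => encNat 3 ++ noArcW n x y) ++ encNat 0

/-- The code of `leafF`. -/
def leafW (n : ℕ) : List Bool :=
  encNat 3 ++ (encNat 3 ++ (encNat 3 ++ (someArcW n n ((List.range (n - 5)).map (· + 4)) ++
    (encNat 3 ++ (noArcW n n (n - 1) ++ encNat 0))) ++ (encNat 3 ++ (encNat 3 ++ (encNat 3 ++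
    (noArcW n n (n - 1) ++ encNat 0) ++ someArcW n n ((List.range (n - 5)).map (· + 4))) ++
    encNat 0))) ++ encNat 0)

/-- The first part of the code of a quantifier along an arc. -/
def moveW (q : Bool) (n : ℕ) : List Bool :=
  if q then encNat 3 ++ (encNat 4 ++ (encNat 3 ++ (encNat 3 ++ (noArcW (n + 1) n (n + 1) ++
    (encNat 0 ++ encNat 3)))))
  else encNat 4 ++ (encNat 3 ++ (encNat 3 ++ (noArcW (n + 1) n (n + 1) ++ encNat 0)))

/-- The last part of the code of a quantifier along an arc. -/
def endW (q : Bool) : List Bool := if q then [false, false] else []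

/-- The code of the pattern `Anchored`. -/
def anchorW : List Bool :=
  [4, 4, 4, 4, 4].flatMap encNat ++ (encNat 3 ++ (adjW 0 1 ++ (encNat 3 ++ (adjW 1 2 ++
    (encNat 3 ++ (adjW 2 0 ++ (encNat 3 ++ (adjW 2 3 ++
    (encNat 3 ++ (encNat 3 ++ eqW 3 1 ++ encNat 0 ++ (encNat 3 ++ (encNat 3 ++ eqW 3 0 ++ encNat 0 ++
    (encNat 3 ++ (adjW 1 4 ++ (encNat 3 ++ (encNat 3 ++ eqW 4 0 ++ encNat 0 ++
    (encNat 3 ++ (encNat 3 ++ eqW 4 2 ++ encNat 0 ++ (encNat 3 ++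
    (encNat 4 ++ (encNat 3 ++ (adjW 4 5 ++ (encNat 3 ++ (adjW 5 2 ++ eqW 5 1))))))))))))))))))))))))

theorem encFormula_eqF {n i j : ℕ} (hi : i ≤ n) (hj : j ≤ n) :
    encFormula (eqF n i j) = eqW i j := by
  simp [eqF, encFormula, encTerm_tv hi, encTerm_tv hj, eqW]

theorem encFormula_adjF {n i j : ℕ} (hi : i ≤ n) (hj : j ≤ n) :
    encFormula (adjF n i j) = adjW i j := by
  simp [adjF, encFormula, encRel, encSeq, List.ofFn_succ, encTerm_tv hi, encTerm_tv hj, adjW]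

theorem encFormula_connF₂ {n i j a b : ℕ} (hi : i ≤ n) (hj : j ≤ n) (ha : a ≤ n) (hb : b ≤ n) :
    encFormula (connF₂ n i j a b) = connW₂ i j a b := by
  simp [connF₂, encFormula, encRel, encSeq, List.ofFn_succ, encTerm_tv hi, encTerm_tv hj,
    encTerm_tv ha, encTerm_tv hb, connW₂]

theorem encFormula_connF₃ {n i j a b c : ℕ} (hi : i ≤ n) (hj : j ≤ n) (ha : a ≤ n) (hb : b ≤ n)
    (hc : c ≤ n) : encFormula (connF₃ n i j a b c) = connW₃ i j a b c := by
  simp [connF₃, encFormula, encRel, encSeq, List.ofFn_succ, encTerm_tv hi, encTerm_tv hj,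
    encTerm_tv ha, encTerm_tv hb, encTerm_tv hc, connW₃]

theorem encFormula_negF {n : ℕ} (φ : sepLang.BoundedFormula Empty n) :
    encFormula (negF φ) = encNat 3 ++ (encFormula φ ++ encNat 0) := rfl

theorem encFormula_noArcF {n x y : ℕ} (hn : 2 ≤ n) (hx : x ≤ n) (hy : y ≤ n) :
    encFormula (noArcF n x y) = noArcW n x y := by
  simp only [noArcF, encFormula]
  rw [encFormula_adjF (by omega) (by omega), encFormula_adjF (by omega) (by omega),
    encFormula_adjF (by omega) (by omega),
    encFormula_connF₂ (by omega) (by omega) (by omega) (by omega),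
    encFormula_connF₃ (by omega) (by omega) (by omega) (by omega) (by omega), noArcW]

theorem encFormula_someArcF {n x : ℕ} (hn : 2 ≤ n) (hx : x ≤ n) {l : List ℕ}
    (hl : ∀ y ∈ l, y ≤ n) : encFormula (someArcF n x l) = someArcW n x l := by
  induction l with
  | nil => rfl
  | cons y l ih =>
    simp only [List.mem_cons, forall_eq_or_imp] at hl
    rw [someArcF, encFormula, ih hl.2, encFormula_noArcF hn hx hl.1]
    simp [someArcW]

theorem encFormula_leafF {n : ℕ} (hn : 2 ≤ n) : encFormula (leafF n) = leafW n := by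
  have hl : ∀ y ∈ (List.range (n - 5)).map (· + 4), y ≤ n := by
    intro y hy
    simp only [List.mem_map, List.mem_range] at hy
    omega
  simp only [leafF, encFormula_negF, encFormula, encFormula_someArcF hn le_rfl hl]
  rw [encFormula_noArcF hn le_rfl (by omega)]
  simp only [leafW, List.append_assoc]

/-- Nesting closes the quantifiers in reverse order, but the closing words consist of zeros only, so
they can also be written in forward order. -/
theorem flatMap_endW_comm (l : List Bool) (q : Bool) :
    l.flatMap endW ++ endW q = endW q ++ l.flatMap endW := by
  have h : ∀ q, ∃ k, endW q = List.replicate k false := fun q => by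
    cases q
    · exact ⟨0, rfl⟩
    · exact ⟨2, rfl⟩
  have h' : ∃ k, l.flatMap endW = List.replicate k false := by
    induction l with
    | nil => exact ⟨0, rfl⟩
    | cons a l ih =>
      obtain ⟨k, hk⟩ := ih
      obtain ⟨j, hj⟩ := h a
      exact ⟨j + k, by rw [List.flatMap_cons, hk, hj, List.replicate_append_replicate]⟩
  obtain ⟨k, hk⟩ := h'
  obtain ⟨j, hj⟩ := h q
  rw [hk, hj, List.replicate_append_replicate, List.replicate_append_replicate, add_comm]

/-- Unfolds the nested recursion into two loops around the leaf, a form that a program can print. -/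
theorem encFormula_moveF (Q : ℕ → Bool) (m : ℕ) : ∀ {n : ℕ}, 2 ≤ n →
    encFormula (moveF ((List.range m).map Q) n) =
      (List.range m).flatMap (fun j => moveW (Q j) (n + j)) ++ (leafW (n + m) ++
        (List.range m).flatMap fun j => endW (Q j)) := by
  induction m generalizing Q with
  | zero => intro n hn; simp [moveF, encFormula_leafF hn]
  | succ m ih =>
    intro n hn
    have h1 : encFormula (moveF ((List.range (m + 1)).map Q) n) = moveW (Q 0) n ++
        (encFormula (moveF ((List.range m).map fun j => Q (j + 1)) (n + 1)) ++ endW (Q 0)) := by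
      rw [List.range_succ_eq_map, List.map_cons, List.map_map]
      cases hQ : Q 0
      · simp only [moveF, encFormula, encFormula_negF]
        rw [encFormula_noArcF (by omega) (by omega) (by omega)]
        simp [moveW, endW, Function.comp_def]
      · simp only [moveF, encFormula, encFormula_negF]
        rw [encFormula_noArcF (by omega) (by omega) (by omega)]
        simp [moveW, endW, Function.comp_def, encNat]
    have h2 := flatMap_endW_comm ((List.range m).map fun j => Q (j + 1)) (Q 0)
    rw [h1, ih _ (by omega), List.range_succ_eq_map]
    simp only [List.flatMap_cons, List.flatMap_map, List.append_assoc] at h2 ⊢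
    rw [h2]
    simp only [Nat.succ_eq_add_one, Nat.add_zero, add_assoc, add_comm 1]

theorem encFormula_mainF (Q : ℕ → Bool) (m : ℕ) :
    encFormula (mainF ((List.range m).map Q)) = anchorW ++
      ((List.range m).flatMap (fun j => moveW (Q j) (4 + j)) ++ (leafW (4 + m) ++
        (List.range m).flatMap fun j => endW (Q j))) := by
  rw [← encFormula_moveF Q m (n := 4) (by omega)]
  simp only [mainF, encFormula, encFormula_negF]
  rw [encFormula_adjF (by omega) (by omega), encFormula_adjF (by omega) (by omega),
    encFormula_adjF (by omega) (by omega), encFormula_adjF (by omega) (by omega),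
    encFormula_adjF (by omega) (by omega), encFormula_adjF (by omega) (by omega),
    encFormula_adjF (by omega) (by omega), encFormula_eqF (by omega) (by omega),
    encFormula_eqF (by omega) (by omega), encFormula_eqF (by omega) (by omega),
    encFormula_eqF (by omega) (by omega), encFormula_eqF (by omega) (by omega)]
  simp only [anchorW, List.append_assoc, List.flatMap_cons, List.flatMap_nil, List.nil_append]

/-! ### Their lengths -/

theorem length_noArcW {n x y : ℕ} (hx : x ≤ n) (hy : y ≤ n) :
    (noArcW n x y).length ≤ 100 * (n + 1) := by
  simp only [noArcW, adjW, connW₂, connW₃, encNat, List.length_append, List.length_replicate,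
    List.length_singleton]
  omega

theorem length_someArcW (n : ℕ) :
    (someArcW n n ((List.range (n - 5)).map (· + 4))).length ≤ n * (100 * (n + 1) + 4) + 1 := by
  have : ∀ l : List ℕ, (∀ y ∈ l, y ≤ n) → (someArcW n n l).length ≤
      l.length * (100 * (n + 1) + 4) + 1 := by
    intro l hl
    induction l with
    | nil => simp [someArcW, encNat]
    | cons y l ih =>
      simp only [List.mem_cons, forall_eq_or_imp] at hl
      have h1 := ih hl.2
      have h2 := length_noArcW le_rfl hl.1
      simp only [someArcW, List.flatMap_cons, List.length_append, List.length_cons, encNat,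
        List.length_replicate, List.length_nil] at h1 ⊢
      rw [Nat.succ_mul]
      omega
  refine (this _ fun y hy => ?_).trans ?_
  · simp only [List.mem_map, List.mem_range] at hy
    omega
  · simp only [List.length_map, List.length_range]
    gcongr
    omega

theorem length_flatMap_range_le {f : ℕ → List Bool} {m b : ℕ} (h : ∀ j < m, (f j).length ≤ b) :
    ((List.range m).flatMap f).length ≤ m * b := by
  induction m with
  | zero => simp
  | succ m ih =>
    have h1 := ih fun j hj => h j (by omega)
    have h2 := h m (by omega)
    rw [List.range_succ, List.flatMap_append, List.length_append, Nat.succ_mul]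
    simpa using add_le_add h1 h2

/-- The bound is quadratic because the leaf contains linearly many arc formulas, each of linear
length owing to the unary variable indices. -/
theorem length_encFormula_mainF (Q : ℕ → Bool) (m : ℕ) :
    (encFormula (mainF ((List.range m).map Q))).length ≤ 2000 * (m + 10) ^ 2 := by
  rw [encFormula_mainF]
  have h1 : ((List.range m).flatMap fun j => moveW (Q j) (4 + j)).length ≤
      m * (100 * (m + 10)) := by
    refine length_flatMap_range_le fun j hj => ?_
    have := length_noArcW (n := 4 + j + 1) (x := 4 + j) (y := 4 + j + 1) (by omega) le_rfl
    cases Q j <;> simp only [moveW, if_true, encNat, List.length_append, List.length_replicate,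
      List.length_singleton, Bool.false_eq_true, if_false] <;> omega
  have h2 : ((List.range m).flatMap fun j => endW (Q j)).length ≤ m * 2 :=
    length_flatMap_range_le fun j hj => by cases Q j <;> simp [endW]
  have h3 := length_someArcW (4 + m)
  have h4 := length_noArcW (n := 4 + m) (x := 4 + m) (y := 4 + m - 1) le_rfl (by omega)
  have h5 : anchorW.length ≤ 400 := by
    simp only [anchorW, adjW, eqW, encNat, List.flatMap_cons, List.flatMap_nil, List.length_append,
      List.length_replicate, List.length_cons, List.length_nil]
    omega
  simp only [leafW, encNat, List.length_append, List.length_replicate, List.length_singleton]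
  nlinarith

end SepLogic

namespace SepLogic

namespace Ctx

variable {α : Type} {Γ : Ctx α} {f g h k l : α → ℕ}

/-! ### Writing codes of formulas -/

theorem Fn.genNat (hf : Γ.Fn f) (hle : ∀ a, f a ≤ Γ.bnd a) : Γ.Gen fun a => encNat (f a) :=
  ((Gen.flatMap hf hle (G := fun _ => [true]) fun _ _ => gen_const _).append
    (gen_const [false])).congr fun a => by
      rw [encNat]
      congr 1
      generalize f a = n
      induction n with
      | zero => rfl
      | succ n ih => rw [List.range_succ, List.flatMap_append, ih, List.replicate_succ']; rfl

theorem Fn.inf (hf : Γ.Fn f) (hg : Γ.Fn g) : Γ.Fn fun a => min (f a) (g a) :=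
  (hf.sub (hf.sub hg)).congr fun a => by omega

theorem gen_adjW (hf : Γ.Fn f) (hg : Γ.Fn g) (hf' : ∀ a, f a ≤ Γ.bnd a)
    (hg' : ∀ a, g a ≤ Γ.bnd a) : Γ.Gen fun a => adjW (f a) (g a) :=
  (gen_const _).append ((gen_const _).append ((hf.genNat hf').append (hg.genNat hg')))

theorem gen_connW₂ (hf : Γ.Fn f) (hg : Γ.Fn g) (hh : Γ.Fn h) (hk : Γ.Fn k)
    (hf' : ∀ a, f a ≤ Γ.bnd a) (hg' : ∀ a, g a ≤ Γ.bnd a) (hh' : ∀ a, h a ≤ Γ.bnd a)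
    (hk' : ∀ a, k a ≤ Γ.bnd a) : Γ.Gen fun a => connW₂ (f a) (g a) (h a) (k a) :=
  (gen_const _).append ((gen_const _).append ((gen_const _).append ((hf.genNat hf').append
    ((hg.genNat hg').append ((hh.genNat hh').append (hk.genNat hk'))))))

theorem gen_connW₃ (hf : Γ.Fn f) (hg : Γ.Fn g) (hh : Γ.Fn h) (hk : Γ.Fn k) (hl : Γ.Fn l)
    (hf' : ∀ a, f a ≤ Γ.bnd a) (hg' : ∀ a, g a ≤ Γ.bnd a) (hh' : ∀ a, h a ≤ Γ.bnd a)
    (hk' : ∀ a, k a ≤ Γ.bnd a) (hl' : ∀ a, l a ≤ Γ.bnd a) :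
    Γ.Gen fun a => connW₃ (f a) (g a) (h a) (k a) (l a) :=
  (gen_const _).append ((gen_const _).append ((gen_const _).append ((hf.genNat hf').append
    ((hg.genNat hg').append ((hh.genNat hh').append ((hk.genNat hk').append (hl.genNat hl')))))))

theorem gen_noArcW (hf : Γ.Fn f) (hg : Γ.Fn g) (hh : Γ.Fn h) (hf' : ∀ a, f a + 2 ≤ Γ.bnd a)
    (hg' : ∀ a, g a ≤ f a) (hh' : ∀ a, h a ≤ f a) :
    Γ.Gen fun a => noArcW (f a) (g a) (h a) := by
  have b₁ : ∀ a, (fun _ => 1 : α → ℕ) a ≤ Γ.bnd a := fun a => by have := hf' a; dsimp only; omega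
  have b₂ : ∀ a, (fun _ => 2 : α → ℕ) a ≤ Γ.bnd a := fun a => by have := hf' a; dsimp only; omega
  have bf : ∀ a, f a + 1 ≤ Γ.bnd a := fun a => by have := hf' a; omega
  have bg : ∀ a, g a ≤ Γ.bnd a := fun a => by have := hf' a; have := hg' a; omega
  have bh : ∀ a, h a ≤ Γ.bnd a := fun a => by have := hf' a; have := hh' a; omega
  have f' := hf.add (fn_const 1)
  have c₁ : Γ.Fn fun _ => 1 := fn_const 1
  have c₂ : Γ.Fn fun _ => 2 := fn_const 2
  exact (gen_const _).append ((gen_const _).append ((gen_adjW hh c₁ bh b₁).append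
    ((gen_const _).append ((gen_adjW f' hh bf bh).append ((gen_const _).append
    ((gen_adjW f' c₂ bf b₂).append ((gen_const _).append
    ((gen_connW₂ f' hg hh c₂ bf bg bh b₂).append
      (gen_connW₃ f' c₁ hg hh c₂ bf b₁ bg bh b₂)))))))))

theorem gen_leafW (hf : Γ.Fn f) (hf' : ∀ a, f a + 2 ≤ Γ.bnd a) : Γ.Gen fun a => leafW (f a) := by
  have h₁ : Γ.Gen fun a => someArcW (f a) (f a) ((List.range (f a - 5)).map (· + 4)) := by
    -- A pushed variable ranges over all numbers, so the bounds are required beyond the actual loop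
    -- range. The `min` secures them and disappears for the indices that occur.
    have := (Gen.flatMap (hf.sub (fn_const 5)) (fun a => by have := hf' a; omega)
      (G := fun x => encNat 3 ++ noArcW (f x.1) (f x.1) (min (4 + x.2) (f x.1)))
      fun n hn => (gen_const _).append (gen_noArcW hf.weaken hf.weaken
        (((fn_const 4).add fn_var).inf hf.weaken) (fun x => hf' x.1) (fun _ => le_rfl)
          fun x => min_le_right _ _)).append (gen_const (encNat 0))
    refine this.congr fun a => ?_
    rw [someArcW, List.flatMap_map]
    congr 1
    refine List.flatMap_congr fun x hx => ?_
    rw [List.mem_range] at hx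
    dsimp only
    rw [min_eq_left (by omega), add_comm]
  have h₂ : Γ.Gen fun a => noArcW (f a) (f a) (f a - 1) :=
    gen_noArcW hf hf (hf.sub (fn_const 1)) hf' (fun _ => le_rfl) fun a => Nat.sub_le _ _
  have e (l : List Bool) : Γ.Gen fun _ => l := gen_const l
  exact ((e (encNat 3)).append ((e (encNat 3)).append ((e (encNat 3)).append (h₁.append
    ((e (encNat 3)).append (h₂.append ((e (encNat 0)).append ((e (encNat 3)).append
    ((e (encNat 3)).append ((e (encNat 3)).append (h₂.append ((e (encNat 0)).append (h₁.append
    ((e (encNat 0)).append (e (encNat 0)))))))))))))))).congr fun a => by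
      simp only [leafW, List.append_assoc]

open Classical in
theorem gen_moveW {Q : α → Prop} (hQ : Γ.Dec Q) (hf : Γ.Fn f) (hf' : ∀ a, f a + 3 ≤ Γ.bnd a) :
    Γ.Gen fun a => moveW (decide (Q a)) (f a) := by
  have h : Γ.Gen fun a => noArcW (f a + 1) (f a) (f a + 1) :=
    gen_noArcW (hf.add (fn_const 1)) hf (hf.add (fn_const 1)) hf' (fun _ => Nat.le_succ _)
      fun _ => le_rfl
  have e (l : List Bool) : Γ.Gen fun _ => l := gen_const l
  exact (Gen.ite hQ ((e (encNat 3)).append ((e (encNat 4)).append ((e (encNat 3)).append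
    ((e (encNat 3)).append (h.append ((e (encNat 0)).append (e (encNat 3))))))))
    ((e (encNat 4)).append ((e (encNat 3)).append ((e (encNat 3)).append
    (h.append (e (encNat 0))))))).congr fun a => by simp only [moveW, decide_eq_true_eq]

open Classical in
theorem gen_endW {Q : α → Prop} (hQ : Γ.Dec Q) : Γ.Gen fun a => endW (decide (Q a)) :=
  (Gen.ite hQ (gen_const [false, false]) gen_nil).congr fun a => by
    simp only [endW, decide_eq_true_eq]

open Classical in
theorem gen_mainF {Q : α → ℕ → Prop} {cnt : α → ℕ} (hc : Γ.Fn cnt)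
    (hle : ∀ a, cnt a + 7 ≤ Γ.bnd a)
    (hQ : ∀ n (h : Γ.lvl ≤ n), (Γ.push n h).Dec fun x => Q x.1 x.2) :
    Γ.Gen fun a => encFormula (mainF ((List.range (cnt a)).map fun j => decide (Q a j))) := by
  have hle' : ∀ a, cnt a ≤ Γ.bnd a := fun a => (Nat.le_add_right _ 7).trans (hle a)
  have h₁ := Gen.flatMap hc hle' (G := fun x => moveW (decide (Q x.1 x.2)) (min (4 + x.2) (4 + cnt x.1)))
    fun n hn => gen_moveW (hQ n hn) (((fn_const 4).add fn_var).inf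
      ((fn_const 4).add hc.weaken))
      fun x => by have := hle x.1; have := min_le_right (4 + x.2) (4 + cnt x.1); change _ ≤ Γ.bnd x.1; omega
  have h₂ := Gen.flatMap hc hle' (G := fun x => endW (decide (Q x.1 x.2))) fun n hn =>
    gen_endW (hQ n hn)
  refine ((gen_const anchorW).append (h₁.append ((gen_leafW ((fn_const 4).add hc)
    fun a => ?_).append h₂))).congr fun a => ?_
  · have := hle a
    omega
  · rw [encFormula_mainF (fun j => decide (Q a j))]
    congr 2
    refine List.flatMap_congr fun x hx => ?_
    rw [List.mem_range] at hx
    dsimp only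
    rw [min_eq_left (by omega)]

end Ctx

end SepLogic

namespace SepLogic

/-! ### The arena -/

/-- Numerical data from which a game for an instance of `qbfSat t` is built. -/
structure Arena where
  r : ℕ
  N : ℕ
  root : ℕ
  k : ℕ → ℕ
  blk : ℕ → ℕ
  child : ℕ → ℕ → ℕ → Prop
  pos : ℕ → Prop
  var : ℕ → ℕ

namespace Arena

/-- The number of variables to be picked from the blocks before block `i`. -/
def start (A : Arena) (i : ℕ) : ℕ := ∑ j ∈ Finset.range i, A.k j

/-- The number of variables to be picked. -/
def total (A : Arena) : ℕ := A.start A.r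

/-- The block from which the variable number `c` is picked. -/
def turn (A : Arena) (c : ℕ) : ℕ := ∑ i ∈ Finset.range A.r, if A.start (i + 1) ≤ c then 1 else 0

/-- The moves from `(c, u)` to `(c', u')`. The column `c ≤ K` describes the variable picked in
step `c`, the column `K + 1` consists of vertices without predecessors, and the column
`K + 2 + d` describes the subformulas at depth `d`. -/
def arc (A : Arena) (t c u c' u' : ℕ) : Prop :=
  (c = A.total + 1 ∧ (c' ≠ 0 ∨ u' ≠ 0) ∧ (c' ≠ c ∨ u' ≠ u)) ∨
  (c < A.total ∧ c' = c + 1 ∧ u' < A.N ∧ A.blk u' = A.turn c ∧ (A.start (A.turn c) < c → u < u')) ∨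
  (c = A.total ∧ c' = c + 2 ∧ u' = A.root) ∨
  ((A.total + 2 ≤ c ∧ c < A.total + 2 + t) ∧ c' = c + 1 ∧ A.child (A.total + 2 + t - 1 - c) u u') ∨
  (c = A.total + 2 + t ∧ (((1 ≤ c' ∧ c' ≤ A.total) ∧ u' = A.var u) ∨ (c' + 1 = c ∧ A.pos u)))

/-- The moves between the vertices in an `m × m`-grid. -/
def move (A : Arena) (t : ℕ) {m : ℕ} (x y : Fin m × Fin m) : Prop := A.arc t x.1 x.2 y.1 y.2

/-- The player who moves in step `j`. -/
def player (A : Arena) (t j : ℕ) : Prop :=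
  (j < A.total ∧ ∃ i < A.r, A.turn j = 2 * i) ∨ ∃ i < t, j = A.total + 1 + (2 * i + 1)

/-- The data describe the given instance. -/
structure Fits (A : Arena) {t : ℕ} (I : QbfInst t) (m : ℕ) where
  r_eq : A.r = I.r
  N_eq : A.N = I.N
  k_eq : ∀ i : Fin I.r, A.k i = I.k i
  blk_eq : ∀ v : Fin I.N, A.blk v = I.blk v
  N_le : I.N ≤ m
  total_lt : A.total + 2 + t < m
  At : (l : ℕ) → Layered I.N l → ℕ → Prop
  at_root : At t I.F A.root
  at_lt : ∀ {l G p}, At l G p → p < m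
  at_of_child : ∀ {l p p'} {G : List (Layered I.N l)}, At (l + 1) G p → A.child l p p' →
    ∃ H ∈ G, At l H p'
  child_of_mem : ∀ {l p} {G : List (Layered I.N l)} {H}, At (l + 1) G p → H ∈ G →
    ∃ p', A.child l p p' ∧ At l H p'
  pos_iff : ∀ {G p}, At 0 G p → (A.pos p ↔ G.1 = true)
  var_eq : ∀ {G p}, At 0 G p → A.var p = G.2

/-- By monotonicity of `A.start`, the blocks completed by time `c` are exactly those before `i`.
Blocks from which nothing is picked are passed over. -/
theorem turn_eq (A : Arena) {i c : ℕ} (hi : i < A.r) (h₁ : A.start i ≤ c)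
    (h₂ : c < A.start (i + 1)) : A.turn c = i := by
  have hm : Monotone A.start := fun a b h =>
    Finset.sum_le_sum_of_subset (Finset.range_mono h)
  rw [turn, ← Finset.sum_filter, Finset.sum_const, smul_eq_mul, mul_one]
  have : (Finset.range A.r).filter (fun j => A.start (j + 1) ≤ c) = Finset.range i := by
    ext j
    simp only [Finset.mem_filter, Finset.mem_range]
    constructor
    · rintro ⟨-, h⟩
      by_contra hj
      have := hm (show i + 1 ≤ j + 1 by omega)
      omega
    · intro h
      exact ⟨by omega, (hm (show j + 1 ≤ i by omega)).trans h₁⟩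
  rw [this, Finset.card_range]

theorem not_arc_self (A : Arena) (t c u : ℕ) : ¬ A.arc t c u c u := by
  unfold arc
  omega

/-- Every vertex other than the origin has a predecessor in column `A.total + 1`, so the origin
becomes the unique source that `anchored_arcGraph` asks for. A play that starts at the origin never
enters that column. -/
theorem not_arc_zero (A : Arena) {t : ℕ} (ht : 1 ≤ t) (c u : ℕ) : ¬ A.arc t c u 0 0 := by
  unfold arc
  omega

end Arena

/-! ### Sequences of moves of the same player -/

/-- After some sequence of `j` moves the history has the property `Ψ`. -/
def Steps {δ : Type} (D : δ → δ → Prop) (Ψ : List δ → Prop) : ℕ → List δ → Prop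
  | 0, l => Ψ l
  | _ + 1, [] => False
  | j + 1, a :: l => ∃ b, D a b ∧ Steps D Ψ j (b :: a :: l)

theorem play_replicate_true {δ : Type} (D : δ → δ → Prop) (qs : List Bool) :
    ∀ (j : ℕ) (a : δ) (l : List δ), Play D (List.replicate j true ++ qs) (a :: l) ↔
      Steps D (Play D qs) j (a :: l)
  | 0, a, l => by simp [Steps]
  | j + 1, a, l => by
    simp only [List.replicate_succ, List.cons_append, Play, Steps,
      play_replicate_true D qs j]

theorem play_replicate_false {δ : Type} (D : δ → δ → Prop) (qs : List Bool) :
    ∀ (j : ℕ) (a : δ) (l : List δ), Play D (List.replicate j false ++ qs) (a :: l) ↔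
      ¬ Steps D (fun l => ¬ Play D qs l) j (a :: l)
  | 0, a, l => by simp [Steps]
  | j + 1, a, l => by
    simp only [List.replicate_succ, List.cons_append, Play, Steps,
      play_replicate_false D qs j]
    push Not
    rfl

/-! ### The phase in which variables are picked -/

/-- The history of a play that has reached column `c` and in which the set `S` has been picked. -/
def Picked {m N : ℕ} (c : ℕ) (S : Finset (Fin N)) (l : List (Fin m × Fin m)) : Prop :=
  (∀ x ∈ l, (x.1 : ℕ) ≤ c) ∧ ∀ v : Fin N, v ∈ S ↔ ∃ x ∈ l, 1 ≤ (x.1 : ℕ) ∧ (x.2 : ℕ) = v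

theorem Picked.cons {m N c : ℕ} {S : Finset (Fin N)} {l : List (Fin m × Fin m)}
    (h : Picked c S l) {x : Fin m × Fin m} (hx : (x.1 : ℕ) = c + 1) {v : Fin N}
    (hv : (x.2 : ℕ) = v) : Picked (c + 1) (insert v S) (x :: l) := by
  refine ⟨fun y hy => ?_, fun w => ?_⟩
  · rcases List.mem_cons.1 hy with rfl | hy
    · exact hx.le
    · exact (h.1 y hy).trans (Nat.le_succ c)
  · rw [Finset.mem_insert, h.2]
    constructor
    · rintro (rfl | ⟨y, hy, h'⟩)
      · exact ⟨x, List.mem_cons_self, by omega, hv⟩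
      · exact ⟨y, List.mem_cons_of_mem _ hy, h'⟩
    · rintro ⟨y, hy, h1, h2⟩
      rcases List.mem_cons.1 hy with rfl | hy
      · exact .inl (Fin.ext (h2.symm.trans hv))
      · exact .inr ⟨y, hy, h1, h2⟩

/-- Increasing sequences of moves correspond to subsets. In the induction `T` is the set still to be
picked, and its elements exceed the last pick, except at the start of the block, where the row of
`a` belongs to an earlier phase. -/
theorem steps_pick {m N : ℕ} {D : Fin m × Fin m → Fin m × Fin m → Prop} {B : Fin N → Prop}
    {c₀ n : ℕ} (hN : N ≤ m) (hm : c₀ + n < m)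
    (hD : ∀ x y : Fin m × Fin m, c₀ ≤ x.1 → (x.1 : ℕ) < c₀ + n → (D x y ↔ (y.1 : ℕ) = x.1 + 1 ∧
      ∃ v : Fin N, (y.2 : ℕ) = v ∧ B v ∧ (c₀ < x.1 → (x.2 : ℕ) < v)))
    {Ψ : List (Fin m × Fin m) → Prop} {Φ : Finset (Fin N) → Prop}
    (hΨ : ∀ a l S, (a.1 : ℕ) = c₀ + n → Picked (c₀ + n) S (a :: l) → (Ψ (a :: l) ↔ Φ S)) :
    ∀ (j c : ℕ) (a : Fin m × Fin m) (l : List (Fin m × Fin m)) (S : Finset (Fin N)),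
      c₀ ≤ c → c + j = c₀ + n → (a.1 : ℕ) = c → Picked c S (a :: l) →
      (Steps D Ψ j (a :: l) ↔ ∃ T : Finset (Fin N), (∀ v ∈ T, B v) ∧
        (∀ v ∈ T, c₀ < c → (a.2 : ℕ) < v) ∧ T.card = j ∧ Φ (S ∪ T))
  | 0, c, a, l, S, h₀, hc, ha, hS => by
    obtain rfl : c = c₀ + n := by omega
    rw [Steps, hΨ a l S ha hS]
    constructor
    · intro h
      exact ⟨∅, by simp, by simp, rfl, by simpa using h⟩
    · rintro ⟨T, -, -, h, h'⟩
      rw [Finset.card_eq_zero.1 h] at h'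
      simpa using h'
  | j + 1, c, a, l, S, h₀, hc, ha, hS => by
    rw [Steps]
    constructor
    · rintro ⟨b, hab, hb⟩
      obtain ⟨hb1, v, hv, hBv, hlt⟩ := (hD a b (by omega) (by omega)).1 hab
      rw [ha] at hb1 hlt
      obtain ⟨T, h1, h2, h3, h4⟩ := (steps_pick hN hm hD hΨ j (c + 1) b (a :: l) (insert v S)
        (by omega) (by omega) hb1 (hS.cons hb1 hv)).1 hb
      have hvT : v ∉ T := fun h => by
        have := h2 v h (by omega)
        omega
      refine ⟨insert v T, ?_, ?_, by rw [Finset.card_insert_of_notMem hvT, h3], ?_⟩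
      · intro w hw
        rcases Finset.mem_insert.1 hw with rfl | hw
        · exact hBv
        · exact h1 w hw
      · intro w hw hc'
        rcases Finset.mem_insert.1 hw with rfl | hw
        · exact hlt hc'
        · have := h2 w hw (by omega)
          have := hlt hc'
          omega
      · rwa [Finset.union_insert, ← Finset.insert_union]
    · rintro ⟨T, h1, h2, h3, h4⟩
      have hne : T.Nonempty := Finset.card_pos.1 (by omega)
      -- The order is forced: the next pick is the least element of `T`.
      let v := T.min' hne
      have hv : v ∈ T := T.min'_mem hne
      have hvm := v.2
      let b : Fin m × Fin m := (⟨c + 1, by omega⟩, ⟨v, by omega⟩)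
      refine ⟨b, (hD a b (by omega) (by omega)).2 ⟨by simp [b, ha], v, rfl, h1 v hv, fun h =>
        h2 v hv (by omega)⟩, ?_⟩
      refine (steps_pick hN hm hD hΨ j (c + 1) b (a :: l) (insert v S)
        (by omega) (by omega) rfl (hS.cons rfl rfl)).2 ⟨T.erase v, fun w hw => h1 w
          (Finset.mem_of_mem_erase hw), fun w hw _ => ?_, by rw [Finset.card_erase_of_mem hv, h3]; rfl, ?_⟩
      · have : v < w := lt_of_le_of_ne (T.min'_le w (Finset.mem_of_mem_erase hw))
          (Finset.ne_of_mem_erase hw).symm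
        exact this
      · rwa [Finset.insert_union, ← Finset.union_insert, Finset.insert_erase hv]

/-- The quantifiers for the picks from the given blocks. -/
def pickQuants {r : ℕ} (k : Fin r → ℕ) : Bool → List (Fin r) → List Bool
  | _, [] => []
  | q, i :: l => List.replicate (k i) q ++ pickQuants k (!q) l

namespace Arena

variable {A : Arena} {t : ℕ} {I : QbfInst t} {m : ℕ}

theorem Fits.start_succ (h : A.Fits I m) (i : Fin I.r) :
    A.start (i + 1) = A.start i + I.k i := by
  rw [start, Finset.sum_range_succ, h.k_eq]; rfl

/-- Induction on the remaining blocks `L`, with `L₀` the blocks already done. A universal block is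
treated as the negation of an existential one with negated goal. -/
theorem Fits.play_pick (h : A.Fits I m) {qs : List Bool} {Φ : Finset (Fin I.N) → Prop}
    (hΦ : ∀ a l S, (a.1 : ℕ) = A.total → Picked A.total S (a :: l) →
      (Play (A.move t (m := m)) qs (a :: l) ↔ Φ S)) :
    ∀ (q : Bool) (L L₀ : List (Fin I.r)), List.finRange I.r = L₀ ++ L → ∀ (a) (l)
      (S : Finset (Fin I.N)), (a.1 : ℕ) = A.start L₀.length → Picked (A.start L₀.length) S (a :: l) →
      (Play (A.move t (m := m)) (pickQuants I.k q L ++ qs) (a :: l) ↔ AltWeighted I.k I.blk Φ q L S)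
  | q, [], L₀, hL, a, l, S, ha, hS => by
    have : L₀.length = A.r := by
      have := congrArg List.length hL
      simpa [h.r_eq] using this.symm
    rw [this] at ha hS
    cases q <;> exact hΦ a l S ha hS
  | q, i :: L, L₀, hL, a, l, S, ha, hS => by
    have hlen : L₀.length = i := by
      have h1 : (List.finRange I.r)[L₀.length]? = some i := by
        rw [hL]; simp
      obtain ⟨h2, h3⟩ := List.getElem?_eq_some_iff.1 h1
      rw [← h3]; simp
    have hir : (i : ℕ) < A.r := by rw [h.r_eq]; exact i.2
    have hst := h.start_succ i
    have hle : A.start (i + 1) ≤ A.total :=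
      Finset.sum_le_sum_of_subset (Finset.range_mono hir)
    have htot := h.total_lt
    have hD : ∀ x y : Fin m × Fin m, A.start i ≤ x.1 → (x.1 : ℕ) < A.start i + I.k i →
        (A.move t x y ↔ (y.1 : ℕ) = x.1 + 1 ∧ ∃ v : Fin I.N, (y.2 : ℕ) = v ∧ I.blk v = i ∧
          (A.start i < x.1 → (x.2 : ℕ) < v)) := by
      intro x y h1 h2
      have hturn := A.turn_eq hir h1 (by omega)
      unfold move arc
      rw [hturn]
      constructor
      · intro H
        have H : (y.1 : ℕ) = x.1 + 1 ∧ (y.2 : ℕ) < A.N ∧ A.blk y.2 = i ∧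
            (A.start i < x.1 → (x.2 : ℕ) < y.2) := by omega
        refine ⟨H.1, ⟨y.2, h.N_eq ▸ H.2.1⟩, rfl, ?_, H.2.2.2⟩
        have := h.blk_eq ⟨y.2, h.N_eq ▸ H.2.1⟩
        exact Fin.ext (this.symm.trans H.2.2.1)
      · rintro ⟨H, v, hv, rfl, hlt⟩
        exact .inr (.inl ⟨by omega, H, by rw [hv, h.N_eq]; exact v.2, by rw [hv, h.blk_eq],
          by rw [hv]; exact hlt⟩)
    rw [hlen] at ha hS
    have ih (S') (a') (l') (h1 : (a'.1 : ℕ) = A.start i + I.k i) (h2 : Picked (A.start i + I.k i) S' (a' :: l')) :=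
      h.play_pick hΦ (!q) L (L₀ ++ [i]) (by rw [hL]; simp) a' l' S' (by simpa [hlen, hst] using h1)
        (by simpa [hlen, hst] using h2)
    -- At the first pick of a block no order condition applies.
    have hlo : ∀ T : Finset (Fin I.N), (∀ v ∈ T, A.start i < A.start i → (a.2 : ℕ) < v) ↔ True :=
      fun T => by simp
    cases q
    · rw [pickQuants, List.append_assoc, play_replicate_false,
        steps_pick h.N_le (by omega) hD (Φ := fun S => ¬ AltWeighted I.k I.blk Φ true L S)
          (fun a' l' S' h1 h2 => not_congr (ih S' a' l' h1 h2)) (I.k i) _ a l S le_rfl rfl ha hS]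
      simp only [hlo, true_and, AltWeighted]
      push Not
      rfl
    · rw [pickQuants, List.append_assoc, play_replicate_true,
        steps_pick h.N_le (by omega) hD (Φ := fun S => AltWeighted I.k I.blk Φ false L S)
          (fun a' l' S' h1 h2 => ih S' a' l' h1 h2) (I.k i) _ a l S le_rfl rfl ha hS]
      simp only [hlo, true_and, AltWeighted]

/-! ### The phase in which the formula is evaluated -/

/-- The quantifiers for the evaluation of a formula. -/
def evalQuants : ℕ → Bool → List Bool
  | 0, _ => []
  | l + 1, q => (!q) :: evalQuants l (!q)

/-- The arc to `b` tells whether the literal is positive, and an arc to an older position tells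
whether its variable was picked. A positive literal has arcs to the whole preceding column, so `hl`
must keep the older positions out of it. -/
theorem Fits.play_leaf (h : A.Fits I m) (ht : 1 ≤ t) {S : Finset (Fin I.N)} {hist l}
    {a b : Fin m × Fin m} (hhist : Picked A.total S hist)
    (hl : ∀ x ∈ l, (x.1 : ℕ) + 1 ≠ a.1) (hl' : ∀ x : Fin m × Fin m, (x.1 : ℕ) ≤ A.total → (x ∈ l ↔ x ∈ hist))
    (ha : (a.1 : ℕ) = A.total + 2 + t) (hb : (b.1 : ℕ) + 1 = a.1) {G : Layered I.N 0}
    (hG : h.At 0 G a.2) (q : Bool) :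
    Play (A.move t) [] (a :: b :: l) ↔ Layered.Holds S 0 q G := by
  rw [Play]
  have h1 : A.move t a b ↔ A.pos a.2 := by
    unfold move arc
    constructor
    · rintro (h | h | h | h | ⟨-, h | h⟩) <;> first | omega | exact h.2
    · intro h
      exact .inr (.inr (.inr (.inr ⟨ha, .inr ⟨hb, h⟩⟩)))
  have h2 : (∃ c ∈ l, A.move t a c) ↔ G.2 ∈ S := by
    rw [hhist.2]
    constructor
    · rintro ⟨c, hc, hm⟩
      have hne := hl c hc
      have hm : (1 ≤ (c.1 : ℕ) ∧ (c.1 : ℕ) ≤ A.total) ∧ (c.2 : ℕ) = A.var a.2 := by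
        unfold move arc at hm
        omega
      exact ⟨c, (hl' c hm.1.2).1 hc, hm.1.1, by rw [hm.2, h.var_eq hG]⟩
    · rintro ⟨c, hc, hc1, hc2⟩
      have := hhist.1 c hc
      refine ⟨c, (hl' c this).2 hc, ?_⟩
      exact .inr (.inr (.inr (.inr ⟨ha, .inl ⟨⟨hc1, this⟩, by rw [h.var_eq hG, hc2]⟩⟩)))
  rw [h1, h2, h.pos_iff hG]
  cases q <;> rfl

theorem move_iff_child {l : ℕ} {a b : Fin m × Fin m}
    (hl : (a.1 : ℕ) + l + 1 = A.total + 2 + t) (ha : A.total + 2 ≤ a.1) :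
    A.move t a b ↔ (b.1 : ℕ) = a.1 + 1 ∧ A.child l a.2 b.2 := by
  have e : A.total + 2 + t - 1 - a.1 = l := by omega
  unfold move arc
  rw [e]
  constructor
  · rintro (h | h | h | h | h) <;> first | omega | exact h.2
  · rintro ⟨h1, h2⟩
    exact .inr (.inr (.inr (.inl ⟨by omega, h1, h2⟩)))

/-- Positions visited during the evaluation lie in columns beyond `A.total` and do not alter the
picked set recorded by `hist`. The adjacent predecessor is required only for `l < t`: the root is
entered from two columns before, but with `1 ≤ t` a leaf is entered from the adjacent one. -/
theorem Fits.play_eval (h : A.Fits I m) (ht : 1 ≤ t) {S : Finset (Fin I.N)} {hist}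
    (hhist : Picked A.total S hist) :
    ∀ (l : ℕ) (q : Bool) (a : Fin m × Fin m) (L : List (Fin m × Fin m)) (G : Layered I.N l),
      (a.1 : ℕ) + l = A.total + 2 + t → A.total + 2 ≤ a.1 →
      (∀ x ∈ L, (x.1 : ℕ) < a.1) → (l < t → ∃ b L', L = b :: L' ∧ (b.1 : ℕ) + 1 = a.1 ∧
        ∀ x ∈ L', (x.1 : ℕ) + 1 ≠ a.1) →
      (∀ x : Fin m × Fin m, (x.1 : ℕ) ≤ A.total → (x ∈ L ↔ x ∈ hist)) → h.At l G a.2 →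
      (Play (A.move t) (evalQuants l q) (a :: L) ↔ Layered.Holds S l q G)
  | 0, q, a, L, G, hl, ha, hlt, hb, hL, hG => by
    obtain ⟨b, L', rfl, hb1, hb2⟩ := hb (by omega)
    refine h.play_leaf ht hhist hb2 (fun x hx => ?_) hl hb1 hG q
    rw [← hL x hx, List.mem_cons]
    constructor
    · exact .inr
    · rintro (rfl | h')
      · omega
      · exact h'
  | l + 1, q, a, L, G, hl, ha, hlt, hb, hL, hG => by
    have hm := fun b => move_iff_child (b := b) hl ha
    have htot := h.total_lt
    have ih : ∀ (b : Fin m × Fin m) (H : Layered I.N l), (b.1 : ℕ) = a.1 + 1 → h.At l H b.2 →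
        (Play (A.move t) (evalQuants l (!q)) (b :: a :: L) ↔ Layered.Holds S l (!q) H) := by
      intro b H hb1 hH
      refine h.play_eval ht hhist l (!q) b (a :: L) H (by omega) (by omega) ?_ (fun _ => ⟨a, L, rfl,
        by omega, fun x hx => by have := hlt x hx; omega⟩) (fun x hx => ?_) hH
      · intro x hx
        rcases List.mem_cons.1 hx with rfl | hx
        · omega
        · have := hlt x hx
          omega
      · rw [← hL x hx, List.mem_cons]
        constructor
        · rintro (rfl | h')
          · omega
          · exact h'
        · exact .inr
    have hex : ∀ H ∈ (show List (Layered I.N l) from G), ∃ b, A.move t a b ∧ (b.1 : ℕ) = a.1 + 1 ∧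
        h.At l H b.2 := by
      intro H hH
      obtain ⟨p', h1, h2⟩ := h.child_of_mem hG hH
      exact ⟨(⟨a.1 + 1, by omega⟩, ⟨p', h.at_lt h2⟩), (hm _).2 ⟨rfl, h1⟩, rfl, h2⟩
    cases q
    · simp only [evalQuants, Bool.not_false, Play, Layered.Holds]
      constructor
      · rintro ⟨b, hab, hb⟩
        obtain ⟨h1, h2⟩ := (hm b).1 hab
        obtain ⟨H, hH, hH'⟩ := h.at_of_child hG h2
        exact ⟨H, hH, (ih b H h1 hH').1 hb⟩
      · rintro ⟨H, hH, hb⟩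
        obtain ⟨b, hab, h1, hH'⟩ := hex H hH
        exact ⟨b, hab, (ih b H h1 hH').2 hb⟩
    · simp only [evalQuants, Bool.not_true, Play, Layered.Holds]
      constructor
      · intro hb H hH
        obtain ⟨b, hab, h1, hH'⟩ := hex H hH
        exact (ih b H h1 hH').1 (hb b hab)
      · intro hb b hab
        obtain ⟨h1, h2⟩ := (hm b).1 hab
        obtain ⟨H, hH, hH'⟩ := h.at_of_child hG h2
        exact (ih b H h1 hH').2 (hb H hH)

/-- The move to the root is forced, so the kind of its quantifier is immaterial. -/
theorem Fits.play_root (h : A.Fits I m) (ht : 1 ≤ t) {S : Finset (Fin I.N)} {a : Fin m × Fin m} {l}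
    (ha : (a.1 : ℕ) = A.total) (hS : Picked A.total S (a :: l)) :
    Play (A.move t) (false :: evalQuants t true) (a :: l) ↔ Layered.Holds S t true I.F := by
  have htot := h.total_lt
  have hm : ∀ b : Fin m × Fin m, A.move t a b ↔ (b.1 : ℕ) = A.total + 2 ∧ (b.2 : ℕ) = A.root := by
    intro b
    unfold move arc
    rw [ha]
    omega
  let b : Fin m × Fin m := (⟨A.total + 2, by omega⟩, ⟨A.root, h.at_lt h.at_root⟩)
  have hb : ∀ b', A.move t a b' ↔ b' = b := fun b' => by
    rw [hm]
    constructor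
    · rintro ⟨h1, h2⟩
      exact Prod.ext (Fin.ext h1) (Fin.ext h2)
    · rintro rfl
      exact ⟨rfl, rfl⟩
  simp only [Play, hb, forall_eq]
  exact h.play_eval ht hS t true b (a :: l) I.F rfl le_rfl
    (fun x hx => (hS.1 x hx).trans_lt (by simp [b])) (by simp) (fun x _ => Iff.rfl) h.at_root

theorem evalQuants_eq : ∀ (l : ℕ) (q : Bool),
    evalQuants l q = (List.range l).map fun d => (q != decide (d % 2 = 0))
  | 0, q => rfl
  | l + 1, q => by
    rw [evalQuants, evalQuants_eq l, List.range_succ_eq_map, List.map_cons, List.map_map]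
    congr 1
    · cases q <;> rfl
    · refine List.map_congr_left fun d _ => ?_
      have : decide ((d + 1) % 2 = 0) = !decide (d % 2 = 0) := by
        rcases Nat.mod_two_eq_zero_or_one d with h | h <;> simp [Nat.add_mod, h]
      simp only [Function.comp, Nat.succ_eq_add_one, this]
      cases q <;> cases decide (d % 2 = 0) <;> rfl

theorem Fits.pickQuants_eq (h : A.Fits I m) : ∀ (L L₀ : List (Fin I.r)),
    List.finRange I.r = L₀ ++ L → pickQuants I.k (decide (L₀.length % 2 = 0)) L =
      (List.range' (A.start L₀.length) (A.total - A.start L₀.length)).map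
        fun j => decide (A.turn j % 2 = 0)
  | [], L₀, hL => by
    have : L₀.length = A.r := by
      have := congrArg List.length hL
      simpa [h.r_eq] using this.symm
    simp [this, total, pickQuants]
  | i :: L, L₀, hL => by
    have hlen : L₀.length = i := by
      have h1 : (List.finRange I.r)[L₀.length]? = some i := by
        rw [hL]; simp
      obtain ⟨h2, h3⟩ := List.getElem?_eq_some_iff.1 h1
      rw [← h3]; simp
    have hir : (i : ℕ) < A.r := by rw [h.r_eq]; exact i.2
    have hst := h.start_succ i
    have hle : A.start (i + 1) ≤ A.total :=
      Finset.sum_le_sum_of_subset (Finset.range_mono hir)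
    have ih := h.pickQuants_eq L (L₀ ++ [i]) (by rw [hL]; simp)
    have e : A.total - A.start i = I.k i + (A.total - A.start (i + 1)) := by omega
    simp only [List.length_append, List.length_singleton, hlen] at ih ⊢
    rw [e, ← List.range'_append_1, List.map_append, ← hst, ← ih, pickQuants]
    congr 1
    · symm
      rw [List.eq_replicate_iff]
      refine ⟨by simp, fun b hb => ?_⟩
      obtain ⟨j, hj, rfl⟩ := List.mem_map.1 hb
      rw [List.mem_range'_1] at hj
      rw [A.turn_eq hir hj.1 (by omega)]
    · congr 1
      rcases Nat.mod_two_eq_zero_or_one (i : ℕ) with h | h <;> simp [Nat.add_mod, h]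

-- The recursively defined prefix is expressed through the step number, so that a program can decide
-- each quantifier separately.
open Classical in
theorem Fits.quants_eq (h : A.Fits I m) :
    pickQuants I.k true (List.finRange I.r) ++ false :: evalQuants t true =
      (List.range (A.total + 1 + t)).map fun j => decide (A.player t j) := by
  have h1 := h.pickQuants_eq (List.finRange I.r) [] rfl
  have h0 : A.start 0 = 0 := rfl
  simp only [List.length_nil, h0, Nat.zero_mod, decide_true, Nat.sub_zero] at h1
  rw [h1, evalQuants_eq, add_assoc, List.range_add, List.map_append, add_comm 1 t,
    List.range_succ_eq_map, List.map_cons, List.map_cons, List.map_map, List.map_map]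
  rw [← List.range_eq_range']
  congr 1
  · refine List.map_congr_left fun j hj => ?_
    rw [List.mem_range] at hj
    rw [decide_eq_decide]
    constructor
    · intro hp
      refine .inl ⟨hj, A.turn j / 2, ?_, by omega⟩
      have : A.turn j ≤ A.r := by
        rw [turn, ← Finset.sum_filter, Finset.sum_const, smul_eq_mul, mul_one]
        exact (Finset.card_filter_le _ _).trans (Finset.card_range _).le
      rcases Nat.eq_zero_or_pos A.r with h0 | h0
      · simp [total, h0, start] at hj
      · omega
    · rintro (⟨-, i, -, hi⟩ | ⟨i, -, hi⟩) <;> omega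
  · congr 1
    · symm
      rw [decide_eq_false_iff_not]
      rintro (⟨hj, -⟩ | ⟨i, -, hi⟩) <;> omega
    · refine List.map_congr_left fun d hd => ?_
      rw [List.mem_range] at hd
      have : (A.player t (A.total + d.succ)) ↔ ¬ d % 2 = 0 := by
        constructor
        · rintro (⟨hj, -⟩ | ⟨i, -, hi⟩) <;> omega
        · intro hp
          exact .inr ⟨d / 2, by omega, by omega⟩
      rcases Nat.mod_two_eq_zero_or_one d with h | h <;> simp [this, h]

open Classical in
theorem Fits.play (h : A.Fits I m) (ht : 1 ≤ t) {s : Fin m × Fin m} (hs : (s.1 : ℕ) = 0) :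
    Play (A.move t) ((List.range (A.total + 1 + t)).map fun j => decide (A.player t j)) [s] ↔
      (qbfSat t).yes I := by
  rw [← h.quants_eq]
  exact h.play_pick (fun _ _ _ ha hS => h.play_root ht ha hS) true (List.finRange I.r) [] rfl s [] ∅
    (by simpa [start] using hs) ⟨by simp [hs], by simp [hs]⟩

end Arena

end SepLogic

namespace SepLogic

/-! ### Parsing -/

/-- The position of the first zero of `w` from position `p` on. -/
def nextZero (w : List Bool) (p : ℕ) : ℕ :=
  (fun q => if w.getD q false = true then q + 1 else q)^[w.length] p

/-- The number whose code starts at position `p`. -/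
def numAt (w : List Bool) (p : ℕ) : ℕ := nextZero w p - p

/-- The position after `i` codes of numbers. -/
def numPos (w : List Bool) (i : ℕ) : ℕ := (fun q => nextZero w q + 1)^[i] 0

/-- The position after the code of a formula with `l` layers that starts at position `p`. -/
def formulaEnd (w : List Bool) : ℕ → ℕ → ℕ
  | 0, p => nextZero w (p + 1) + 1
  | l + 1, p => (fun q => if w.getD q false = true then formulaEnd w l (q + 1) else q)^[w.length] p + 1

/-- The position before entry number `i` in the code of a list of formulas with `l` layers that
starts at position `p`. -/
def entryPos (w : List Bool) (l p i : ℕ) : ℕ :=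
  (fun q => if w.getD q false = true then formulaEnd w l (q + 1) else q)^[i] p

/-- The game described by a word. -/
def arenaOf (w : List Bool) : Arena where
  r := min (numAt w 0) w.length
  N := min (numAt w (numPos w 1)) w.length
  root := numPos w (min (2 + min (numAt w 0) w.length + min (numAt w (numPos w 1)) w.length) w.length)
  k i := numAt w (numPos w (min (2 + i) w.length))
  blk v := numAt w (numPos w (min (2 + min (numAt w 0) w.length + v) w.length))
  child l p p' := ∃ i < w.length, w.getD (entryPos w l p i) false = true ∧ p' = entryPos w l p i + 1
  pos p := w.getD p false = true
  var p := numAt w (p + 1)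

theorem getD_of_drop {w l : List Bool} {b : Bool} {p : ℕ} (h : w.drop p = b :: l) :
    w.getD p false = b ∧ w.drop (p + 1) = l := by
  constructor
  · rw [List.getD_eq_getElem?_getD, ← add_zero p, ← List.getElem?_drop, h]
    rfl
  · rw [← List.drop_drop, h]
    rfl

theorem length_le_of_drop {w l : List Bool} {p : ℕ} (h : w.drop p = l) : l.length ≤ w.length := by
  rw [← h, List.length_drop]
  omega

/-- The iteration crosses the `n` ones and then rests on the zero; the length of `w` suffices as
number of rounds because the code lies inside `w`. -/
theorem nextZero_eq {w rest : List Bool} {p n : ℕ} (h : w.drop p = encNat n ++ rest) :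
    nextZero w p = p + n ∧ w.drop (nextZero w p + 1) = rest := by
  have h1 : ∀ i, ∀ j, i + j = n → w.drop (p + i) = encNat j ++ rest := by
    intro i
    induction i with
    | zero => rintro j hj; obtain rfl : j = n := by omega
              exact h
    | succ i ih =>
      intro j hj
      have := ih (j + 1) (by omega)
      rw [encNat, List.replicate_succ, List.cons_append, List.cons_append] at this
      exact (getD_of_drop this).2
  have h2 : ∀ i, (fun q => if w.getD q false = true then q + 1 else q)^[i] p = p + min i n := by
    intro i
    induction i with
    | zero => simp
    | succ i ih =>
      rw [Function.iterate_succ_apply', ih]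
      by_cases hi : i < n
      · have := h1 i (n - i - 1 + 1) (by omega)
        rw [encNat, List.replicate_succ, List.cons_append, List.cons_append] at this
        rw [min_eq_left hi.le, min_eq_left (by omega), if_pos (getD_of_drop this).1]
        rfl
      · have := h1 n 0 (by omega)
        rw [min_eq_right (by omega), min_eq_right (by omega)]
        rw [if_neg]
        rw [(getD_of_drop this).1]
        simp
  have h3 := length_le_of_drop h
  simp only [encNat, List.length_append, List.length_replicate] at h3
  have h4 : nextZero w p = p + n := by rw [nextZero, h2, min_eq_right (by omega)]
  exact ⟨h4, h4 ▸ (getD_of_drop (h1 n 0 rfl)).2⟩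

theorem drop_iterate {w : List Bool} : ∀ (l : List ℕ) (rest : List Bool) (p : ℕ),
    w.drop p = l.flatMap encNat ++ rest →
      (∀ (i : ℕ) (hi : i < l.length), numAt w ((fun q => nextZero w q + 1)^[i] p) = l[i]) ∧
        w.drop ((fun q => nextZero w q + 1)^[l.length] p) = rest
  | [], rest, p, h => ⟨by simp, h⟩
  | n :: l, rest, p, h => by
    rw [List.flatMap_cons, List.append_assoc] at h
    obtain ⟨h1, h2⟩ := nextZero_eq h
    obtain ⟨h3, h4⟩ := drop_iterate l rest _ h2
    refine ⟨fun i hi => ?_, by simpa using h4⟩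
    cases i with
    | zero => simp [numAt, h1]
    | succ i => simpa using h3 i (by simpa using hi)

/-- The iteration rests on the terminating zero just as `L.drop i` stays empty, so no bound on `i`
is needed. Correctness of `formulaEnd` one layer below is a hypothesis because its own proof for the
next layer relies on this lemma. -/
theorem drop_entryPos_of {w : List Bool} {N l : ℕ}
    (ih : ∀ (G : Layered N l) (rest : List Bool) (p : ℕ), w.drop p = Layered.enc l G ++ rest →
      w.drop (formulaEnd w l p) = rest) (L : List (Layered N l)) (rest : List Bool) (p : ℕ)
    (h : w.drop p = encList (Layered.enc l) L ++ rest) (i : ℕ) :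
    w.drop (entryPos w l p i) = encList (Layered.enc l) (L.drop i) ++ rest := by
  induction i with
  | zero => exact h
  | succ i hi =>
    rw [entryPos, Function.iterate_succ_apply', ← entryPos]
    rw [← List.drop_drop]
    cases hL : L.drop i with
    | nil =>
      rw [hL] at hi
      rw [if_neg (by rw [(getD_of_drop hi).1]; simp), hi]
      rfl
    | cons G L' =>
      rw [hL, encList, List.cons_append] at hi
      obtain ⟨h1, h2⟩ := getD_of_drop hi
      rw [if_pos h1]
      rw [List.append_assoc] at h2
      exact ih _ _ _ h2

theorem length_le_length_encList {α : Type} (e : α → List Bool) :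
    ∀ l : List α, l.length + 1 ≤ (encList e l).length
  | [] => le_rfl
  | a :: l => by
    have := length_le_length_encList e l
    simp only [encList, List.length_cons, List.length_append]
    omega

theorem drop_formulaEnd {w : List Bool} {N : ℕ} : ∀ (l : ℕ) (G : Layered N l) (rest : List Bool)
    (p : ℕ), w.drop p = Layered.enc l G ++ rest → w.drop (formulaEnd w l p) = rest
  | 0, G, rest, p, h => by
    rw [Layered.enc, List.cons_append] at h
    exact (nextZero_eq (getD_of_drop h).2).2
  | l + 1, G, rest, p, h => by
    change List (Layered N l) at G
    -- As many rounds as `w` has bits exhaust the list, since each entry costs at least its leading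
    -- one.
    have h1 := drop_entryPos_of (drop_formulaEnd l) G rest p h w.length
    have h2 := length_le_length_encList (Layered.enc l) G
    have h3 : (encList (Layered.enc l) G ++ rest).length ≤ w.length := length_le_of_drop h
    rw [List.length_append] at h3
    rw [List.drop_eq_nil_of_le (as := G) (by omega)] at h1
    exact (getD_of_drop h1).2

theorem drop_entryPos {w : List Bool} {N l : ℕ} (L : List (Layered N l)) (rest : List Bool) (p : ℕ)
    (h : w.drop p = encList (Layered.enc l) L ++ rest) (i : ℕ) :
    w.drop (entryPos w l p i) = encList (Layered.enc l) (L.drop i) ++ rest :=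
  drop_entryPos_of (drop_formulaEnd l) L rest p h i

theorem length_enc_pos {N : ℕ} : ∀ (l : ℕ) (G : Layered N l), 0 < (Layered.enc l G).length
  | 0, G => by simp [Layered.enc]
  | l + 1, G => by
    have := length_le_length_encList (Layered.enc l) (show List (Layered N l) from G)
    exact Nat.lt_of_lt_of_le (Nat.succ_pos _) this

theorem length_flatMap_encNat (l : List ℕ) :
    (l.flatMap encNat).length = l.sum + l.length := by
  induction l with
  | nil => rfl
  | cons n l ih =>
    simp only [List.flatMap_cons, List.length_append, ih, List.sum_cons, List.length_cons, encNat,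
      List.length_replicate, List.length_nil]
    omega

/-- The numbers at the beginning of the code of an instance. -/
def QbfInst.nums {t : ℕ} (I : QbfInst t) : List ℕ :=
  I.r :: I.N :: (List.ofFn I.k ++ List.ofFn fun v => (I.blk v : ℕ))

theorem QbfInst.enc_eq {t : ℕ} (I : QbfInst t) :
    I.enc = I.nums.flatMap encNat ++ Layered.enc t I.F := by
  have h : ∀ {n : ℕ} (f : Fin n → ℕ), (List.ofFn f).flatMap encNat =
      (List.ofFn fun i => encNat (f i)).flatten := fun f => by
    rw [List.flatMap_def, List.map_ofFn]; rfl
  simp only [enc, nums, List.flatMap_cons, List.flatMap_append, h, List.append_assoc, encSeq, encFin]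

theorem arenaOf_fits_aux {t : ℕ} (I : QbfInst t) :
    (arenaOf I.enc).r = I.r ∧ (arenaOf I.enc).N = I.N ∧
    (∀ i : Fin I.r, (arenaOf I.enc).k i = I.k i) ∧
    (∀ v : Fin I.N, (arenaOf I.enc).blk v = I.blk v) ∧
    I.enc.drop (arenaOf I.enc).root = Layered.enc t I.F ∧
    I.N ≤ I.enc.length ∧ ∑ i, I.k i ≤ I.enc.length := by
  obtain ⟨h1, h2⟩ := drop_iterate (w := I.enc) I.nums (Layered.enc t I.F) 0 I.enc_eq
  have hlen : I.nums.length = 2 + I.r + I.N := by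
    simp only [QbfInst.nums, List.length_cons, List.length_append, List.length_ofFn]
    omega
  -- The caps by `w.length` in `arenaOf` keep loops bounded for all words and indices; this
  -- inequality makes them inactive on the code of an instance.
  have hw : I.nums.sum + I.nums.length ≤ I.enc.length := by
    rw [I.enc_eq, List.length_append, length_flatMap_encNat]
    omega
  have hsum : I.r + I.N + ∑ i, I.k i ≤ I.nums.sum := by
    simp only [QbfInst.nums, List.sum_cons, List.sum_append, List.sum_ofFn]
    omega
  have hr : numAt I.enc 0 = I.r := h1 0 (by omega)
  have hN : numAt I.enc (numPos I.enc 1) = I.N := h1 1 (by omega)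
  have er : (arenaOf I.enc).r = I.r := by
    simp only [arenaOf, hr]; omega
  have eN : (arenaOf I.enc).N = I.N := by
    simp only [arenaOf, hN]; omega
  refine ⟨er, eN, fun i => ?_, fun v => ?_, ?_, by omega, by omega⟩
  · simp only [arenaOf]
    rw [min_eq_left (by omega)]
    refine (h1 (2 + i) (by omega)).trans ?_
    simp [QbfInst.nums, add_comm 2]
  · simp only [arenaOf, hr]
    rw [min_eq_left (by omega), min_eq_left (by omega)]
    refine (h1 (2 + I.r + v) (by omega)).trans ?_
    simp [QbfInst.nums, show 2 + I.r + v = I.r + v + 1 + 1 by omega]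
  · simp only [arenaOf, hr, hN]
    rw [min_eq_left (by omega), min_eq_left (by omega), min_eq_left (by omega), numPos, ← hlen]
    exact h2

/-- The word determines the game. -/
def arenaOf_fits {t : ℕ} (I : QbfInst t) : (arenaOf I.enc).Fits I (I.enc.length + (t + 5)) :=
  have h := arenaOf_fits_aux I
  { r_eq := h.1
    N_eq := h.2.1
    k_eq := h.2.2.1
    blk_eq := h.2.2.2.1
    N_le := by have := h.2.2.2.2.2.1; omega
    total_lt := by
      have h1 := h.2.2.2.2.2.2
      have h2 : (arenaOf I.enc).total = ∑ i, I.k i := by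
        rw [Arena.total, Arena.start, h.1, Finset.sum_range]
        exact Finset.sum_congr rfl fun i _ => h.2.2.1 i
      omega
    -- A position in the word stands for the subformula whose code begins there.
    At := fun l G p => ∃ rest, I.enc.drop p = Layered.enc l G ++ rest
    at_root := ⟨[], by rw [h.2.2.2.2.1, List.append_nil]⟩
    at_lt := by
      rintro l G p ⟨rest, h⟩
      have h1 := congrArg List.length h
      have h2 := length_enc_pos l G
      rw [List.length_drop, List.length_append] at h1
      omega
    at_of_child := by
      rintro l p p' G ⟨rest, h⟩ ⟨i, -, hi, rfl⟩
      have h1 := drop_entryPos G rest p h i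
      cases hL : G.drop i with
      | nil =>
        rw [hL] at h1
        rw [(getD_of_drop h1).1] at hi
        simp at hi
      | cons H L' =>
        rw [hL, encList, List.cons_append, List.append_assoc] at h1
        exact ⟨H, List.mem_of_mem_drop (hL ▸ List.mem_cons_self), _, (getD_of_drop h1).2⟩
    child_of_mem := by
      rintro l p G H ⟨rest, h⟩ hH
      obtain ⟨i, hi, rfl⟩ := List.getElem_of_mem hH
      have h1 := drop_entryPos G rest p h i
      rw [List.drop_eq_getElem_cons hi, encList, List.cons_append, List.append_assoc] at h1
      have h2 := length_le_length_encList (Layered.enc l) G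
      have h3 : (encList (Layered.enc l) G ++ rest).length ≤ I.enc.length := length_le_of_drop h
      rw [List.length_append] at h3
      exact ⟨_, ⟨i, by omega, (getD_of_drop h1).1, rfl⟩, _, (getD_of_drop h1).2⟩
    pos_iff := by
      rintro G p ⟨rest, h⟩
      have := (getD_of_drop h).1
      simp only [arenaOf, this]
    var_eq := by
      rintro G p ⟨rest, h⟩
      have := (nextZero_eq (getD_of_drop h).2).1
      simp only [arenaOf, numAt, this]
      omega }

end SepLogic

namespace SepLogic

namespace Ctx

variable {α : Type} {Γ : Ctx α} {f g h k : α → ℕ}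

/-! ### The game is computable -/

theorem Fn.iterate {cnt : α → ℕ} {F : α → ℕ → ℕ} (hf : Γ.Fn f) (hc : Γ.Fn cnt)
    (hle : ∀ a, cnt a ≤ Γ.bnd a) (hF : ∀ n (h : Γ.lvl ≤ n), (Γ.push n h).Fn fun x => F x.1 x.2) :
    Γ.Fn fun a => (F a)^[cnt a] (f a) := by
  refine (Fn.rec hf hc hle (step := fun x => F x.1.1 x.1.2) fun n h => (hF n h).weaken).congr
    fun a => ?_
  generalize cnt a = j
  induction j with
  | zero => rfl
  | succ j ih => rw [Function.iterate_succ_apply', ← ih]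

theorem Fn.iteBit (hf : Γ.Fn f) (hg : Γ.Fn g) (hh : Γ.Fn h) :
    Γ.Fn fun a => if (Γ.word a).getD (f a) false = true then g a else h a :=
  (Fn.ite (Fn.bitDec hf) hg hh).congr fun a => by congr

theorem Fn.nextZero (hb : ∀ a, (Γ.word a).length ≤ Γ.bnd a) (hf : Γ.Fn f) :
    Γ.Fn fun a => nextZero (Γ.word a) (f a) :=
  Fn.iterate hf fn_len hb fun _ _ => Fn.iteBit fn_var (fn_var.add (fn_const 1)) fn_var

theorem Fn.numAt (hb : ∀ a, (Γ.word a).length ≤ Γ.bnd a) (hf : Γ.Fn f) :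
    Γ.Fn fun a => numAt (Γ.word a) (f a) :=
  (hf.nextZero hb).sub hf

theorem Fn.numPos (hb : ∀ a, (Γ.word a).length ≤ Γ.bnd a) (hf : Γ.Fn f)
    (hle : ∀ a, f a ≤ Γ.bnd a) : Γ.Fn fun a => numPos (Γ.word a) (f a) :=
  Fn.iterate (fn_const 0) hf hle fun _ _ => (Fn.nextZero (fun x => hb x.1) fn_var).add (fn_const 1)

/-- Each layer adds one nested loop, so there is a separate program for every fixed `l`. -/
theorem Fn.formulaEnd : ∀ (l : ℕ) {α : Type} {Γ : Ctx α} {f : α → ℕ},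
    (∀ a, (Γ.word a).length ≤ Γ.bnd a) → Γ.Fn f → Γ.Fn fun a => formulaEnd (Γ.word a) l (f a)
  | 0, _, _, _, hb, hf => ((hf.add (fn_const 1)).nextZero hb).add (fn_const 1)
  | l + 1, _, _, _, hb, hf => (Fn.iterate hf fn_len hb fun _ _ => Fn.iteBit fn_var
      (Fn.formulaEnd l (fun x => hb x.1) (fn_var.add (fn_const 1))) fn_var).add (fn_const 1)

theorem Fn.entryPos (l : ℕ) (hb : ∀ a, (Γ.word a).length ≤ Γ.bnd a) (hf : Γ.Fn f) (hg : Γ.Fn g)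
    (hle : ∀ a, g a ≤ Γ.bnd a) : Γ.Fn fun a => entryPos (Γ.word a) l (f a) (g a) :=
  Fn.iterate hf hg hle fun _ _ => Fn.iteBit fn_var
    (Fn.formulaEnd l (fun x => hb x.1) (fn_var.add (fn_const 1))) fn_var

theorem fn_r (hb : ∀ a, (Γ.word a).length ≤ Γ.bnd a) :
    Γ.Fn fun a => (arenaOf (Γ.word a)).r :=
  (Fn.numAt hb (fn_const 0)).inf fn_len

theorem arenaOf_r_le (w : List Bool) : (arenaOf w).r ≤ w.length := min_le_right _ _

theorem fn_N (hb : ∀ a, (Γ.word a).length + 2 ≤ Γ.bnd a) :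
    Γ.Fn fun a => (arenaOf (Γ.word a)).N :=
  (Fn.numAt (fun a => by have := hb a; omega) (Fn.numPos (fun a => by have := hb a; omega)
    (fn_const 1) fun a => by have := hb a; omega)).inf fn_len

theorem fn_root (hb : ∀ a, (Γ.word a).length + 2 ≤ Γ.bnd a) :
    Γ.Fn fun a => (arenaOf (Γ.word a)).root := by
  have hb' : ∀ a, (Γ.word a).length ≤ Γ.bnd a := fun a => by have := hb a; omega
  exact Fn.numPos hb' ((((fn_const 2).add (fn_r hb')).add (fn_N hb)).inf fn_len)
    fun a => (min_le_right _ _).trans (hb' a)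

theorem Fn.arena_k (hb : ∀ a, (Γ.word a).length ≤ Γ.bnd a) (hf : Γ.Fn f) :
    Γ.Fn fun a => (arenaOf (Γ.word a)).k (f a) :=
  Fn.numAt hb (Fn.numPos hb (((fn_const 2).add hf).inf fn_len)
    fun a => (min_le_right _ _).trans (hb a))

theorem Fn.arena_blk (hb : ∀ a, (Γ.word a).length ≤ Γ.bnd a) (hf : Γ.Fn f) :
    Γ.Fn fun a => (arenaOf (Γ.word a)).blk (f a) :=
  Fn.numAt hb (Fn.numPos hb ((((fn_const 2).add (fn_r hb)).add hf).inf fn_len)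
    fun a => (min_le_right _ _).trans (hb a))

theorem Fn.arena_var (hb : ∀ a, (Γ.word a).length ≤ Γ.bnd a) (hf : Γ.Fn f) :
    Γ.Fn fun a => (arenaOf (Γ.word a)).var (f a) :=
  Fn.numAt hb (hf.add (fn_const 1))

theorem Fn.arena_child (l : ℕ) (hb : ∀ a, (Γ.word a).length ≤ Γ.bnd a) (hf : Γ.Fn f)
    (hg : Γ.Fn g) : Γ.Dec fun a => (arenaOf (Γ.word a)).child l (f a) (g a) := by
  refine Dec.ex (P := fun x => (Γ.word x.1).getD (SepLogic.entryPos (Γ.word x.1) l (f x.1)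
    (min x.2 (Γ.word x.1).length)) false = true ∧ g x.1 = SepLogic.entryPos (Γ.word x.1) l (f x.1)
      (min x.2 (Γ.word x.1).length) + 1)
    fn_len hb (fun n h => ?_) |>.congr fun a => ?_
  · have hw : (Γ.push n h).Fn fun x => (Γ.word x.1).length := fn_len
    have e := Fn.entryPos l (Γ := Γ.push n h) (fun x => hb x.1) hf.weaken (fn_var.inf hw)
      fun x => (min_le_right _ _).trans (hb x.1)
    exact (Fn.bitDec e).and (hg.weaken.eqDec (e.add (fn_const 1)))
  · refine exists_congr fun i => and_congr_right fun hi => ?_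
    dsimp only
    rw [min_eq_left hi.le]

theorem Fn.arena_start (hb : ∀ a, (Γ.word a).length ≤ Γ.bnd a) (hf : Γ.Fn f)
    (hle : ∀ a, f a ≤ Γ.bnd a) : Γ.Fn fun a => (arenaOf (Γ.word a)).start (f a) :=
  Fn.sum (F := fun x => (arenaOf (Γ.word x.1)).k x.2) hf hle fun n h =>
    Fn.arena_k (Γ := Γ.push n h) (fun x => hb x.1) fn_var

theorem fn_total (hb : ∀ a, (Γ.word a).length ≤ Γ.bnd a) :
    Γ.Fn fun a => (arenaOf (Γ.word a)).total :=
  Fn.arena_start hb (fn_r hb) fun a => (arenaOf_r_le _).trans (hb a)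

theorem Fn.arena_turn (hb : ∀ a, (Γ.word a).length ≤ Γ.bnd a) (hf : Γ.Fn f) :
    Γ.Fn fun a => (arenaOf (Γ.word a)).turn (f a) := by
  refine (Fn.sum (F := fun x => if (arenaOf (Γ.word x.1)).start
    (min (x.2 + 1) (Γ.word x.1).length) ≤ f x.1 then 1 else 0) (fn_r hb)
    (fun a => (arenaOf_r_le _).trans (hb a)) fun n h => ?_).congr fun a => ?_
  · have hw : (Γ.push n h).Fn fun x => (Γ.word x.1).length := fn_len
    exact (Fn.ite ((Fn.arena_start (Γ := Γ.push n h) (fun x => hb x.1)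
      ((fn_var.add (fn_const 1)).inf hw) fun x => (min_le_right _ _).trans (hb x.1)).leDec
        hf.weaken) (fn_const 1) (fn_const 0)).congr fun x => by
        simp only [push]
        congr
  · refine Finset.sum_congr rfl fun i hi => ?_
    have h1 := Finset.mem_range.1 hi
    have h2 := arenaOf_r_le (Γ.word a)
    dsimp only
    rw [min_eq_left (by omega)]

theorem arenaOf_turn_le (w : List Bool) (c : ℕ) : (arenaOf w).turn c ≤ w.length := by
  rw [Arena.turn, ← Finset.sum_filter, Finset.sum_const, smul_eq_mul, mul_one]
  exact ((Finset.card_filter_le _ _).trans (Finset.card_range _).le).trans (arenaOf_r_le w)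

/-- The layer `f a` is known only at run time, while the programs for `child` depend on it; a case
distinction over the finitely many layers below `t` selects the right one. -/
theorem Dec.arena_child_lt (t : ℕ) (hb : ∀ a, (Γ.word a).length ≤ Γ.bnd a) (hf : Γ.Fn f)
    (hg : Γ.Fn g) (hh : Γ.Fn h) :
    Γ.Dec fun a => f a < t ∧ (arenaOf (Γ.word a)).child (f a) (g a) (h a) := by
  induction t with
  | zero => exact Dec.bot.congr fun a => by simp
  | succ t ih =>
    refine (ih.or ((hf.eqDec (fn_const t)).and (Fn.arena_child t hb hg hh))).congr fun a => ?_
    rw [Nat.lt_succ_iff_lt_or_eq]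
    constructor
    · rintro (h | ⟨h, h'⟩)
      · exact ⟨.inl h.1, h.2⟩
      · exact ⟨.inr h, by rwa [h]⟩
    · rintro ⟨h | h, h'⟩
      · exact .inl ⟨h, h'⟩
      · exact .inr ⟨h, by rwa [h] at h'⟩

theorem Dec.arc (t : ℕ) (hb : ∀ a, (Γ.word a).length + 2 ≤ Γ.bnd a) (hf : Γ.Fn f)
    (hg : Γ.Fn g) (hh : Γ.Fn h) (hk : Γ.Fn k) :
    Γ.Dec fun a => (arenaOf (Γ.word a)).arc t (f a) (g a) (h a) (k a) := by
  have hb' : ∀ a, (Γ.word a).length ≤ Γ.bnd a := fun a => by have := hb a; omega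
  have T := fn_total hb'
  have c (n : ℕ) : Γ.Fn fun _ => n := fn_const n
  have tu := Fn.arena_turn hb' hf
  have st := Fn.arena_start hb' tu fun a => (arenaOf_turn_le _ _).trans (hb' a)
  refine Dec.or ((hf.eqDec (T.add (c 1))).and (((hh.eqDec (c 0)).not.or (hk.eqDec (c 0)).not).and
    ((hh.eqDec hf).not.or (hk.eqDec hg).not))) ?_
  refine Dec.or ((hf.ltDec T).and ((hh.eqDec (hf.add (c 1))).and ((hk.ltDec (fn_N hb)).and
    (((Fn.arena_blk hb' hk).eqDec tu).and ((st.ltDec hf).imp (hg.ltDec hk)))))) ?_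
  refine Dec.or ((hf.eqDec T).and ((hh.eqDec (hf.add (c 2))).and (hk.eqDec (fn_root hb)))) ?_
  refine Dec.or ?_ ((hf.eqDec ((T.add (c 2)).add (c t))).and ((((c 1).leDec hh).and
    (hh.leDec T) |>.and (hk.eqDec (Fn.arena_var hb' hg))).or
      (((hh.add (c 1)).eqDec hf).and (Fn.bitDec hg))))
  refine ((((T.add (c 2)).leDec hf).and (hf.ltDec ((T.add (c 2)).add (c t)))).and
    ((hh.eqDec (hf.add (c 1))).and (Dec.arena_child_lt t hb'
      (((((T.add (c 2)).add (c t)).sub (c 1))).sub hf) hg hk))).congr fun a => ?_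
  constructor
  · rintro ⟨h1, h2, h3, h4⟩
    exact ⟨h1, h2, h4⟩
  · rintro ⟨h1, h2, h3⟩
    exact ⟨h1, h2, by omega, h3⟩

theorem Dec.player (t : ℕ) (hb : ∀ a, (Γ.word a).length + t ≤ Γ.bnd a) (hf : Γ.Fn f) :
    Γ.Dec fun a => (arenaOf (Γ.word a)).player t (f a) := by
  have hb' : ∀ a, (Γ.word a).length ≤ Γ.bnd a := fun a => by have := hb a; omega
  refine Dec.or ((hf.ltDec (fn_total hb')).and
    (Dec.ex (P := fun x => (arenaOf (Γ.word x.1)).turn (f x.1) = 2 * x.2) (fn_r hb')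
      (fun a => (arenaOf_r_le _).trans (hb' a)) fun n h =>
      (((Fn.arena_turn hb' hf).weaken.eqDec (fn_var.add fn_var)).congr fun x => by rw [two_mul])))
    (Dec.ex (P := fun x => f x.1 = (arenaOf (Γ.word x.1)).total + 1 + (2 * x.2 + 1))
      (fn_const t) (fun a => by have := hb a; omega) fun n h =>
      ((hf.weaken.eqDec (((fn_total hb').weaken.add (fn_const 1)).add
        ((fn_var.add fn_var).add (fn_const 1)))).congr fun x => by rw [two_mul]))

end Ctx

end SepLogic

namespace SepLogic

open FirstOrder Language

/-! ### Transfer along isomorphisms -/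

theorem Conn.of_iso {V W : Type} {G : SimpleGraph V} {H : SimpleGraph W} (e : G ≃g H) {k : ℕ}
    {s t : V} {u : Fin k → V} (h : Conn G s t u) : Conn H (e s) (e t) (e ∘ u) := by
  obtain ⟨p, hp, h⟩ := h
  refine ⟨p.map e.toHom, hp.map e.injective, fun i hi => ?_⟩
  rw [SimpleGraph.Walk.support_map, List.mem_map] at hi
  obtain ⟨x, hx, hx'⟩ := hi
  exact h i (e.injective hx' ▸ hx)

theorem models_iff_of_iso {V W : Type} {G : SimpleGraph V} {H : SimpleGraph W} (e : G ≃g H)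
    (φ : sepLang.Sentence) : Models G φ ↔ Models H φ := by
  let _ := sepStructure G
  let _ := sepStructure H
  let f : V ≃[sepLang] W :=
    { e.toEquiv with
      map_fun' := fun f => Empty.elim f
      map_rel' := fun R x => by
        cases R with
        | adj => exact e.map_adj_iff
        | conn k =>
          constructor
          · intro h
            have h' : Conn G (e.symm (e (x 0))) (e.symm (e (x 1)))
                (fun i => e.symm (e (x i.succ.succ))) := Conn.of_iso e.symm h
            simp only [RelIso.symm_apply_apply] at h'
            exact h'
          · exact Conn.of_iso e }
  exact StrongHomClass.realize_sentence f φ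

/-! ### Numerical description of the graph -/

/-- Tuples of numbers that describe vertices. -/
abbrev Tup : Type := ℕ × ℕ × ℕ × ℕ × ℕ × ℕ

/-- The description of a vertex. -/
def Vtx.tup {m L : ℕ} : Vtx (Fin m × Fin m) L → Tup
  | .R => (0, 0, 0, 0, 0, 0)
  | .Z => (1, 0, 0, 0, 0, 0)
  | .q => (2, 0, 0, 0, 0, 0)
  | .br a => (3, a.1, a.2, 0, 0, 0)
  | .pt a b i => (4, a.1, a.2, b.1, b.2, i)

/-- The condition for a tuple to describe a vertex. -/
def IsVtx (x : Tup) : Prop :=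
  x.1 = 4 ∨ (x.2.2.2.1 = 0 ∧ x.2.2.2.2.1 = 0 ∧ x.2.2.2.2.2 = 0) ∧
    (x.1 = 3 ∨ (x.2.1 = 0 ∧ x.2.2.1 = 0))

/-- Adjacency in one direction. -/
def halfTup (D : ℕ → ℕ → ℕ → ℕ → Prop) (L : ℕ) (x y : Tup) : Prop :=
  (x.1 = 0 ∧ y.1 = 1) ∨ (x.1 = 0 ∧ y.1 = 2) ∨ (x.1 = 1 ∧ y.1 = 2) ∨ (x.1 = 0 ∧ y.1 = 3) ∨
  (x.1 = 3 ∧ y.1 = 4 ∧ x.2.1 = y.2.1 ∧ x.2.2.1 = y.2.2.1 ∧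
    D y.2.1 y.2.2.1 y.2.2.2.1 y.2.2.2.2.1 ∧ y.2.2.2.2.2 = 0) ∨
  ((x.1 = 4 ∧ D x.2.1 x.2.2.1 x.2.2.2.1 x.2.2.2.2.1) ∧
    ((y.1 = 4 ∧ x.2.1 = y.2.1 ∧ x.2.2.1 = y.2.2.1 ∧ x.2.2.2.1 = y.2.2.2.1 ∧
      x.2.2.2.2.1 = y.2.2.2.2.1 ∧ x.2.2.2.2.2 + 1 = y.2.2.2.2.2) ∨
    (x.2.2.2.2.2 + 1 = L ∧ ((y.1 = 3 ∧ x.2.2.2.1 = y.2.1 ∧ x.2.2.2.2.1 = y.2.2.1) ∨ y.1 = 1))))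

/-- Adjacency. -/
def AdjTup (D : ℕ → ℕ → ℕ → ℕ → Prop) (L : ℕ) (x y : Tup) : Prop :=
  halfTup D L x y ∨ halfTup D L y x

theorem halfAdj_iff {m L : ℕ} {D : ℕ → ℕ → ℕ → ℕ → Prop} (v w : Vtx (Fin m × Fin m) L) :
    halfAdj (fun x y => D x.1 x.2 y.1 y.2) v w ↔ halfTup D L v.tup w.tup := by
  cases v <;> cases w <;>
    simp [halfAdj, halfTup, Vtx.tup, Prod.ext_iff, Fin.ext_iff] <;> tauto

theorem tup_injective {m L : ℕ} : Function.Injective (Vtx.tup (m := m) (L := L)) := by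
  intro v w h
  cases v <;> cases w <;> simp [Vtx.tup] at h ⊢
  · exact Prod.ext (Fin.ext h.1) (Fin.ext h.2)
  · exact ⟨Prod.ext (Fin.ext h.1) (Fin.ext h.2.1), Prod.ext (Fin.ext h.2.2.1) (Fin.ext h.2.2.2.1),
      Fin.ext h.2.2.2.2⟩

open Classical in
/-- The list of all vertices. -/
noncomputable def vertexList (m L : ℕ) : List Tup :=
  (List.range 5 ×ˢ List.range m ×ˢ List.range m ×ˢ List.range m ×ˢ List.range m ×ˢ
    List.range L).filter fun x => IsVtx x

theorem nodup_vertexList (m L : ℕ) : (vertexList m L).Nodup := by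
  refine List.Nodup.filter _ ?_
  have := @List.nodup_range
  exact .product this (.product this (.product this (.product this (.product this this))))

theorem mem_sprod_iff {β γ : Type} {l : List β} {l' : List γ} {x : β} {y : γ} :
    (x, y) ∈ l ×ˢ l' ↔ x ∈ l ∧ y ∈ l' :=
  List.pair_mem_product

-- Positivity of `m` and `L` puts the zeros that fill unused coordinates into the ranges.
open Classical in
theorem mem_vertexList {m L : ℕ} (hm : 0 < m) (hL : 0 < L) (x : Tup) :
    x ∈ vertexList m L ↔ x ∈ Set.range (Vtx.tup (m := m) (L := L)) := by
  obtain ⟨k, c, u, c', u', i⟩ := x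
  rw [vertexList, List.mem_filter, decide_eq_true_iff]
  simp only [mem_sprod_iff, List.mem_range, IsVtx, Set.mem_range]
  constructor
  · rintro ⟨⟨h1, h2, h3, h4, h5, h6⟩, h⟩
    by_cases h4' : k = 4
    · exact ⟨.pt (⟨c, h2⟩, ⟨u, h3⟩) (⟨c', h4⟩, ⟨u', h5⟩) ⟨i, h6⟩, by simp [Vtx.tup, h4']⟩
    · obtain ⟨⟨rfl, rfl, rfl⟩, hk⟩ := h.resolve_left h4'
      by_cases h3' : k = 3
      · exact ⟨.br (⟨c, h2⟩, ⟨u, h3⟩), by simp [Vtx.tup, h3']⟩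
      · obtain ⟨rfl, rfl⟩ := hk.resolve_left h3'
        obtain rfl | rfl | rfl : k = 0 ∨ k = 1 ∨ k = 2 := by omega
        · exact ⟨.R, rfl⟩
        · exact ⟨.Z, rfl⟩
        · exact ⟨.q, rfl⟩
  · rintro ⟨v, hv⟩
    cases v <;> simp only [Vtx.tup, Prod.mk.injEq] at hv <;>
      obtain ⟨rfl, rfl, rfl, rfl, rfl, rfl⟩ := hv <;> simp [hm, hL]

/-- The vertices are the entries of the list. -/
noncomputable def vertexEquiv {m L : ℕ} (hm : 0 < m) (hL : 0 < L) :
    Fin (vertexList m L).length ≃ Vtx (Fin m × Fin m) L :=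
  ((nodup_vertexList m L).getEquiv _).trans
    ((Equiv.subtypeEquivRight (mem_vertexList hm hL)).trans (Equiv.ofInjective _ tup_injective).symm)

theorem tup_vertexEquiv {m L : ℕ} (hm : 0 < m) (hL : 0 < L) (i) :
    (vertexEquiv hm hL i).tup = (vertexList m L)[i] := by
  have := Equiv.apply_ofInjective_symm (tup_injective (m := m) (L := L))
    (Equiv.subtypeEquivRight (mem_vertexList hm hL) ((nodup_vertexList m L).getEquiv _ i))
  exact this

/-- The graph on the entries of the list. -/
noncomputable def listGraph (D : ℕ → ℕ → ℕ → ℕ → Prop) {m L : ℕ} (hm : 0 < m) (hL : 0 < L) :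
    SimpleGraph (Fin (vertexList m L).length) :=
  (arcGraph L fun x y : Fin m × Fin m => D x.1 x.2 y.1 y.2).comap (vertexEquiv hm hL)

theorem listGraph_adj (D : ℕ → ℕ → ℕ → ℕ → Prop) {m L : ℕ} (hm : 0 < m) (hL : 0 < L) (i j) :
    (listGraph D hm hL).Adj i j ↔ AdjTup D L (vertexList m L)[i] (vertexList m L)[j] := by
  rw [← tup_vertexEquiv hm hL, ← tup_vertexEquiv hm hL, AdjTup, ← halfAdj_iff, ← halfAdj_iff]
  rfl

theorem encSeq_getElem {β : Type} (l : List β) (F : β → List Bool) {γ : Type} (e : γ → List Bool)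
    (f : Fin l.length → γ) (h : ∀ i, e (f i) = F l[i]) : encSeq e f = l.flatMap F := by
  rw [encSeq, List.flatMap_def]
  congr 1
  refine List.ext_getElem (by simp) fun i h1 h2 => ?_
  simp only [List.getElem_ofFn, List.getElem_map]
  exact h _

open Classical in
theorem encGraph_listGraph (D : ℕ → ℕ → ℕ → ℕ → Prop) {m L : ℕ} (hm : 0 < m) (hL : 0 < L) :
    encGraph (listGraph D hm hL) = ((vertexList m L).flatMap (fun _ => [true]) ++ [false]) ++
      (vertexList m L).flatMap fun x => (vertexList m L).flatMap fun y => [decide (AdjTup D L x y)] := by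
  rw [encGraph]
  congr 1
  · rw [encNat]
    congr 1
    generalize vertexList m L = l
    induction l with
    | nil => rfl
    | cons a l ih => rw [List.length_cons, List.replicate_succ, ih]; rfl
  · refine encSeq_getElem _ _ _ _ fun i => ?_
    refine encSeq_getElem _ _ _ _ fun j => ?_
    simp only [listGraph_adj]

end SepLogic

namespace SepLogic

/-! ### Writing the code of the graph -/

theorem flatMap_filter_eq {β γ : Type} (l : List β) (p : β → Bool) (g : β → List γ) :
    (l.filter p).flatMap g = l.flatMap fun x => if p x then g x else [] := by
  induction l with
  | nil => rfl
  | cons a l ih =>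
    rw [List.filter_cons, List.flatMap_cons, ← ih]
    by_cases h : p a = true <;> simp [h]

theorem flatMap_sprod {β β' γ : Type} (l : List β) (l' : List β') (g : β × β' → List γ) :
    (l ×ˢ l').flatMap g = l.flatMap fun x => l'.flatMap fun y => g (x, y) := by
  change (l.flatMap fun a => l'.map (Prod.mk a)).flatMap g = _
  simp only [List.flatMap_assoc, List.flatMap_map]

/-- Points with six additional numbers. -/
abbrev Six (α : Type) : Type := (((((α × ℕ) × ℕ) × ℕ) × ℕ) × ℕ) × ℕ

/-- Forget the six numbers. -/
abbrev Six.base {α : Type} (x : Six α) : α := x.1.1.1.1.1.1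

/-- The six numbers. -/
abbrev Six.tup {α : Type} (x : Six α) : Tup :=
  (x.1.1.1.1.1.2, x.1.1.1.1.2, x.1.1.1.2, x.1.1.2, x.1.2, x.2)

namespace Ctx

variable {α : Type} {Γ : Ctx α}

/-- The context `Γ'` extends `Γ` by six variables. -/
structure Extends (Γ : Ctx α) (Γ' : Ctx (Six α)) : Prop where
  word_eq : ∀ x, Γ'.word x = Γ.word x.base
  bnd_eq : ∀ x, Γ'.bnd x = Γ.bnd x.base
  fn : ∀ {f : α → ℕ}, Γ.Fn f → Γ'.Fn fun x => f x.base
  fn₁ : Γ'.Fn fun x => x.tup.1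
  fn₂ : Γ'.Fn fun x => x.tup.2.1
  fn₃ : Γ'.Fn fun x => x.tup.2.2.1
  fn₄ : Γ'.Fn fun x => x.tup.2.2.2.1
  fn₅ : Γ'.Fn fun x => x.tup.2.2.2.2.1
  fn₆ : Γ'.Fn fun x => x.tup.2.2.2.2.2

theorem Extends.isVtx {Γ' : Ctx (Six α)} (h : Γ.Extends Γ') : Γ'.Dec fun x => IsVtx x.tup := by
  have c (n : ℕ) : Γ'.Fn fun _ => n := fn_const n
  exact (h.fn₁.eqDec (c 4)).or (((h.fn₄.eqDec (c 0)).and ((h.fn₅.eqDec (c 0)).and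
    (h.fn₆.eqDec (c 0)))).and ((h.fn₁.eqDec (c 3)).or ((h.fn₂.eqDec (c 0)).and
      (h.fn₃.eqDec (c 0)))))

/-- Six nested loops with a filter; the list itself is never stored. Allowing any extension of `Γ`
in `hG` hides the registers used and lets the construction be nested in itself for pairs of
vertices. -/
theorem Gen.vertexList {m L : α → ℕ} {G : α → Tup → List Bool} (hm : Γ.Fn m) (hL : Γ.Fn L)
    (hm' : ∀ a, m a ≤ Γ.bnd a) (hL' : ∀ a, L a ≤ Γ.bnd a) (h5 : ∀ a, 5 ≤ Γ.bnd a)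
    (hG : ∀ Γ' : Ctx (Six α), Γ.Extends Γ' → Γ'.Gen fun x => G x.base x.tup) :
    Γ.Gen fun a => (vertexList (m a) (L a)).flatMap (G a) := by
  classical
  refine (Gen.flatMap (fn_const 5) h5 fun n₁ h₁ => Gen.flatMap (cnt := fun x => m x.1) hm.weaken
    (fun x => hm' x.1) fun n₂ h₂ => Gen.flatMap (cnt := fun x => m x.1.1) hm.weaken.weaken
    (fun x => hm' x.1.1) fun n₃ h₃ => Gen.flatMap (cnt := fun x => m x.1.1.1) hm.weaken.weaken.weaken
    (fun x => hm' x.1.1.1) fun n₄ h₄ => Gen.flatMap (cnt := fun x => m x.1.1.1.1)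
    hm.weaken.weaken.weaken.weaken
    (fun x => hm' x.1.1.1.1) fun n₅ h₅ => Gen.flatMap (cnt := fun x => L x.1.1.1.1.1)
    hL.weaken.weaken.weaken.weaken.weaken
    (fun x => hL' x.1.1.1.1.1) (G := fun x => if IsVtx (Six.tup x) then G (Six.base x) (Six.tup x) else [])
      fun n₆ h₆ => ?_).congr fun a => ?_
  · have h : Γ.Extends ((((((Γ.push n₁ h₁).push n₂ h₂).push n₃ h₃).push n₄ h₄).push n₅ h₅).push n₆ h₆) :=
      { word_eq := fun _ => rfl
        bnd_eq := fun _ => rfl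
        fn := fun h => h.weaken.weaken.weaken.weaken.weaken.weaken
        fn₁ := fn_var.weaken.weaken.weaken.weaken.weaken
        fn₂ := fn_var.weaken.weaken.weaken.weaken
        fn₃ := fn_var.weaken.weaken.weaken
        fn₄ := fn_var.weaken.weaken
        fn₅ := fn_var.weaken
        fn₆ := fn_var }
    exact (Gen.ite h.isVtx (hG _ h) gen_nil).congr fun x => by congr
  · simp only [SepLogic.vertexList, flatMap_filter_eq, flatMap_sprod, decide_eq_true_eq]

theorem decHalfTup {D : α → ℕ → ℕ → ℕ → ℕ → Prop} {β : Type} {Δ : Ctx β}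
    {L : β → ℕ} {π : β → α} {x y : β → Tup} (hL : Δ.Fn L)
    (x₁ : Δ.Fn fun b => (x b).1) (x₂ : Δ.Fn fun b => (x b).2.1) (x₃ : Δ.Fn fun b => (x b).2.2.1)
    (x₄ : Δ.Fn fun b => (x b).2.2.2.1) (x₅ : Δ.Fn fun b => (x b).2.2.2.2.1)
    (x₆ : Δ.Fn fun b => (x b).2.2.2.2.2)
    (y₁ : Δ.Fn fun b => (y b).1) (y₂ : Δ.Fn fun b => (y b).2.1) (y₃ : Δ.Fn fun b => (y b).2.2.1)
    (y₄ : Δ.Fn fun b => (y b).2.2.2.1) (y₅ : Δ.Fn fun b => (y b).2.2.2.2.1)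
    (y₆ : Δ.Fn fun b => (y b).2.2.2.2.2)
    (hx : Δ.Dec fun b => D (π b) (x b).2.1 (x b).2.2.1 (x b).2.2.2.1 (x b).2.2.2.2.1)
    (hy : Δ.Dec fun b => D (π b) (y b).2.1 (y b).2.2.1 (y b).2.2.2.1 (y b).2.2.2.2.1) :
    Δ.Dec fun b => halfTup (D (π b)) (L b) (x b) (y b) := by
  have c (n : ℕ) : Δ.Fn fun _ => n := fn_const n
  refine ((x₁.eqDec (c 0)).and (y₁.eqDec (c 1))).or (((x₁.eqDec (c 0)).and (y₁.eqDec (c 2))).or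
    (((x₁.eqDec (c 1)).and (y₁.eqDec (c 2))).or (((x₁.eqDec (c 0)).and (y₁.eqDec (c 3))).or
    (((x₁.eqDec (c 3)).and ((y₁.eqDec (c 4)).and ((x₂.eqDec y₂).and ((x₃.eqDec y₃).and
      (hy.and (y₆.eqDec (c 0))))))).or (((x₁.eqDec (c 4)).and hx).and
    (((y₁.eqDec (c 4)).and ((x₂.eqDec y₂).and ((x₃.eqDec y₃).and ((x₄.eqDec y₄).and ((x₅.eqDec y₅).and
    ((x₆.add (c 1)).eqDec y₆)))))).or (((x₆.add (c 1)).eqDec hL).and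
    (((y₁.eqDec (c 3)).and ((x₄.eqDec y₂).and (x₅.eqDec y₃))).or (y₁.eqDec (c 1))))))))))

theorem decAdjTup {t : ℕ} {L : α → ℕ} {Γ' : Ctx (Six α)} {Δ : Ctx (Six (Six α))}
    (h : Γ.Extends Γ') (k : Γ'.Extends Δ) (hL : Γ.Fn L)
    (hb : ∀ a, (Γ.word a).length + 2 ≤ Γ.bnd a) :
    Δ.Dec fun x => AdjTup ((arenaOf (Γ.word x.base.base)).arc t) (L x.base.base) x.base.tup
      x.tup := by
  have hw : ∀ x, Δ.word x = Γ.word x.base.base := fun x => by rw [k.word_eq, h.word_eq]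
  have hb' : ∀ x, (Δ.word x).length + 2 ≤ Δ.bnd x := fun x => by
    rw [hw, k.bnd_eq, h.bnd_eq]; exact hb _
  have x₁ := k.fn h.fn₁
  have x₂ := k.fn h.fn₂
  have x₃ := k.fn h.fn₃
  have x₄ := k.fn h.fn₄
  have x₅ := k.fn h.fn₅
  have x₆ := k.fn h.fn₆
  have hx := Dec.arc t hb' x₂ x₃ x₄ x₅
  have hy := Dec.arc t hb' k.fn₂ k.fn₃ k.fn₄ k.fn₅
  simp only [hw] at hx hy
  have hL' := k.fn (h.fn hL)
  have h₁ := decHalfTup (D := fun a => (arenaOf (Γ.word a)).arc t) (π := fun x => x.base.base)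
    (x := fun x => x.base.tup) (y := fun x => x.tup) hL'
    x₁ x₂ x₃ x₄ x₅ x₆ k.fn₁ k.fn₂ k.fn₃ k.fn₄ k.fn₅ k.fn₆ hx hy
  have h₂ := decHalfTup (D := fun a => (arenaOf (Γ.word a)).arc t) (π := fun x => x.base.base)
    (y := fun x => x.base.tup) (x := fun x => x.tup) hL'
    k.fn₁ k.fn₂ k.fn₃ k.fn₄ k.fn₅ k.fn₆ x₁ x₂ x₃ x₄ x₅ x₆ hy hx
  exact h₁.or h₂

open Classical in
theorem gen_encGraph {t : ℕ} {m L : α → ℕ} (hm : Γ.Fn m) (hL : Γ.Fn L)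
    (hm' : ∀ a, m a ≤ Γ.bnd a) (hL' : ∀ a, L a ≤ Γ.bnd a) (h5 : ∀ a, 5 ≤ Γ.bnd a)
    (hb : ∀ a, (Γ.word a).length + 2 ≤ Γ.bnd a) :
    Γ.Gen fun a => ((vertexList (m a) (L a)).flatMap (fun _ => [true]) ++ [false]) ++
      (vertexList (m a) (L a)).flatMap fun x => (vertexList (m a) (L a)).flatMap fun y =>
        [decide (AdjTup ((arenaOf (Γ.word a)).arc t) (L a) x y)] := by
  have h₁ : Γ.Gen fun a => (vertexList (m a) (L a)).flatMap (fun _ => [true]) ++ [false] :=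
    (Gen.vertexList (G := fun _ _ => [true]) hm hL hm' hL' h5 fun _ _ => gen_const _).append
      (gen_const _)
  refine h₁.append (Gen.vertexList (G := fun a x => (vertexList (m a) (L a)).flatMap fun y =>
    [decide (AdjTup ((arenaOf (Γ.word a)).arc t) (L a) x y)]) hm hL hm' hL' h5 fun Γ' h => ?_)
  exact Gen.vertexList (Γ := Γ') (m := fun x => m x.base) (L := fun x => L x.base)
    (G := fun x y => [decide (AdjTup ((arenaOf (Γ.word x.base)).arc t) (L x.base) x.tup y)])
    (h.fn hm) (h.fn hL) (fun x => by rw [h.bnd_eq]; exact hm' _)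
    (fun x => by rw [h.bnd_eq]; exact hL' _) (fun x => by rw [h.bnd_eq]; exact h5 _)
    fun Δ k => (decAdjTup h k hL hb).gen

end Ctx

end SepLogic

namespace SepLogic

open FirstOrder Language Ctx

/-! ### The reduction from `qbfSat t` -/

/-- The side length of the grid of positions. -/
def gridSize (t : ℕ) (w : List Bool) : ℕ := w.length + (t + 5)

/-- The number of quantifiers along arcs. -/
def moveCount (t : ℕ) (w : List Bool) : ℕ := min ((arenaOf w).total + 1 + t) (gridSize t w)

open Classical in
/-- The sentence for the instance with the code `w`. -/
noncomputable def sentenceOf (t : ℕ) (w : List Bool) : sepLang.Sentence :=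
  mainF ((List.range (moveCount t w)).map fun j => decide ((arenaOf w).player t j))

theorem gridSize_pos (t : ℕ) (w : List Bool) : 0 < gridSize t w := by
  unfold gridSize
  omega

/-- The graph for the instance with the code `w`. -/
noncomputable def graphOf (t : ℕ) (w : List Bool) :
    SimpleGraph (Fin (vertexList (gridSize t w) (gridSize t w * gridSize t w)).length) :=
  listGraph ((arenaOf w).arc t) (gridSize_pos t w) (Nat.mul_pos (gridSize_pos t w) (gridSize_pos t w))

/-- The isomorphism with the graph of the relation `Arena.move`. -/
noncomputable def graphOfIso (t : ℕ) (w : List Bool) : graphOf t w ≃g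
    arcGraph (gridSize t w * gridSize t w) ((arenaOf w).move t (m := gridSize t w)) :=
  SimpleGraph.Iso.comap _ _

/-- The instance of the model-checking problem for an instance of `qbfSat t`. -/
noncomputable def mcInst {t : ℕ} (I : QbfInst t) : McInst sparseClass where
  n := _
  G := graphOf t I.enc
  -- The path length was chosen as the square of the grid size, which is the number of positions.
  mem := (sparse_arcGraph (by simp)).of_iso (graphOfIso t I.enc).symm
  φ := sentenceOf t I.enc

theorem moveCount_eq {t : ℕ} (I : QbfInst t) :
    moveCount t I.enc = (arenaOf I.enc).total + 1 + t := by
  have := (arenaOf_fits I).total_lt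
  exact min_eq_left (by unfold gridSize; omega)

theorem models_mcInst {t : ℕ} (ht : 1 ≤ t) (I : QbfInst t) :
    (modelChecking sparseClass).yes (mcInst I) ↔ (qbfSat t).yes I := by
  have hfit := arenaOf_fits I
  have htot := hfit.total_lt
  have h6 : 6 ≤ gridSize t I.enc := by unfold gridSize; omega
  have htot' : (arenaOf I.enc).total + 2 + t < gridSize t I.enc := htot
  let s : Fin (gridSize t I.enc) × Fin (gridSize t I.enc) := (⟨0, by omega⟩, ⟨0, by omega⟩)
  have hs : ∀ b : Fin (gridSize t I.enc) × Fin (gridSize t I.enc), b ≠ s →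
      (b.1 : ℕ) ≠ 0 ∨ (b.2 : ℕ) ≠ 0 := by
    intro b hb
    by_contra! h
    exact hb (Prod.ext (Fin.ext h.1) (Fin.ext h.2))
  rw [← hfit.play ht (s := s) rfl, ← moveCount_eq]
  refine (models_iff_of_iso (graphOfIso t I.enc) _).trans ?_
  refine models_mainF (D := (arenaOf I.enc).move t) (s := s) (by nlinarith) (fun a => Arena.not_arc_self _ _ _ _)
    (fun a => Arena.not_arc_zero _ ht _ _) (fun b hb => ?_)
    ⟨((⟨1, by omega⟩, ⟨0, by omega⟩) : Fin (gridSize t I.enc) × Fin (gridSize t I.enc)), fun h => by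
      simpa [s] using congrArg (fun x => (x.1 : ℕ)) h⟩ ?_
  -- A predecessor is taken from column `total + 1`, in a row different from that of `b` to avoid a
  -- loop.
  · by_cases h0 : (b.2 : ℕ) = 0
    · exact ⟨(⟨(arenaOf I.enc).total + 1, by omega⟩, ⟨1, by omega⟩),
        .inl ⟨rfl, hs b hb, .inr (by simp [h0])⟩⟩
    · exact ⟨(⟨(arenaOf I.enc).total + 1, by omega⟩, ⟨0, by omega⟩),
        .inl ⟨rfl, hs b hb, .inr h0⟩⟩
  · rw [moveCount_eq]
    simp

theorem param_mcInst {t : ℕ} (I : QbfInst t) :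
    (modelChecking sparseClass).param (mcInst I) ≤ 2000 * ((qbfSat t).param I + t + 11) ^ 2 := by
  have h := arenaOf_fits_aux I
  have h1 : (arenaOf I.enc).total = ∑ i, I.k i := by
    rw [Arena.total, Arena.start, h.1, Finset.sum_range]
    exact Finset.sum_congr rfl fun i _ => h.2.2.1 i
  refine (length_encFormula_mainF _ _).trans ?_
  rw [moveCount_eq, h1]
  have : (qbfSat t).param I = I.r + ∑ i, I.k i := rfl
  exact Nat.mul_le_mul_left _ (Nat.pow_le_pow_left (by omega) 2)

theorem exists_program_mcInst (t : ℕ) : ∃ p C d, ∀ (I : QbfInst t) σ k, IsOutput σ I.enc k →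
    ∃ τ c, Exec p σ τ c ∧ c ≤ C * (I.enc.length + 1) ^ d ∧
      IsOutput τ (mcInst I).enc (encFormula (mcInst I).φ).length := by
  have hb : ∀ I : QbfInst t, gridSize t I.enc + 7 ≤ gridSize t I.enc * gridSize t I.enc := by
    intro I
    have : 5 ≤ gridSize t I.enc := by unfold gridSize; omega
    nlinarith
  let Γ := baseCtx (QbfInst.enc (t := t)) fun I => gridSize t I.enc * gridSize t I.enc
  have hm : Γ.Fn fun I => gridSize t I.enc := fn_len.add (fn_const _)
  have hlen : ∀ I : QbfInst t, I.enc.length + (t + 5) = gridSize t I.enc := fun _ => rfl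
  have hm' : ∀ I : QbfInst t, gridSize t I.enc ≤ gridSize t I.enc * gridSize t I.enc :=
    fun I => by have := hb I; omega
  have hL : Γ.Fn fun I => gridSize t I.enc * gridSize t I.enc := fn_bnd
  have h₁ : Γ.Gen fun I => encGraph (mcInst I).G :=
    (gen_encGraph (t := t) hm hL hm' (fun I => le_rfl)
      (fun I => by have := hb I; have := hlen I; change 5 ≤ gridSize t I.enc * gridSize t I.enc; omega)
      (fun I => by have := hb I; have := hlen I; change I.enc.length + 2 ≤ gridSize t I.enc * gridSize t I.enc; omega)).congr
        fun I => (encGraph_listGraph _ _ _).symm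
  have hw : ∀ I : QbfInst t, I.enc.length + t ≤ gridSize t I.enc * gridSize t I.enc :=
    fun I => by have := hb I; have := hlen I; omega
  have h₂ : Γ.Gen fun I => encFormula (mcInst I).φ :=
    gen_mainF (Γ := Γ) (cnt := fun I => moveCount t I.enc)
      (Q := fun I j => (arenaOf I.enc).player t j)
      (((((fn_total fun I => (Nat.le_add_right _ t).trans (hw I)).add (fn_const 1)).add
        (fn_const t))).inf hm) (fun I => (Nat.add_le_add_right (min_le_right _ _) 7).trans (hb I))
      fun n h => Dec.player (Γ := Γ.push n h) t (fun x => hw x.1) fn_var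
  exact exists_program _ _ _ (t + 5) h₁ h₂

/-! ### Time bounds the length of the output -/

/-- A step writes at most one cell, so the set of possibly nonzero cells of array 1 grows by at most
one per step. -/
theorem Exec.exists_support {p : Prog} {σ τ : State} {c : ℕ} (h : Exec p σ τ c) (S : Finset ℕ)
    (hS : ∀ i ∉ S, σ.arr 1 i = 0) :
    ∃ T : Finset ℕ, T.card ≤ S.card + c ∧ ∀ i ∉ T, τ.arr 1 i = 0 := by
  induction h generalizing S with
  | store σ a s r =>
    refine ⟨insert (σ.reg s) S, Finset.card_insert_le _ _, fun i hi => ?_⟩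
    rw [Finset.mem_insert, not_or] at hi
    by_cases ha : a = 1
    · subst ha
      simp [State.setArr, hi.1, hS i hi.2]
    · simp [State.setArr, (Ne.symm ha), hS i hi.2]
  | seq _ _ ih₁ ih₂ =>
    obtain ⟨T, h1, h2⟩ := ih₁ S hS
    obtain ⟨T', h3, h4⟩ := ih₂ T h2
    exact ⟨T', by omega, h4⟩
  | ite_true _ _ ih =>
    obtain ⟨T, h1, h2⟩ := ih S hS
    exact ⟨T, by omega, h2⟩
  | ite_false _ _ ih =>
    obtain ⟨T, h1, h2⟩ := ih S hS
    exact ⟨T, by omega, h2⟩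
  | loop_step _ _ _ ih₁ ih₂ =>
    obtain ⟨T, h1, h2⟩ := ih₁ S hS
    obtain ⟨T', h3, h4⟩ := ih₂ T h2
    exact ⟨T', by omega, h4⟩
  | _ => exact ⟨S, by omega, hS⟩

theorem count_le_card : ∀ (y : List Bool) (T : Finset ℕ), (∀ i < y.length, y.getD i false = true → i ∈ T) →
    y.count true ≤ T.card := by
  intro y T h
  have : y.count true = ((Finset.range y.length).filter fun i => y.getD i false = true).card := by
    clear h
    induction y using List.reverseRecOn with
    | nil => rfl
    | append_singleton y b ih =>
      rw [List.count_append, List.length_append, List.length_singleton, Finset.range_add_one,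
        Finset.filter_insert, ih]
      have e : (Finset.range y.length).filter (fun i => (y ++ [b]).getD i false = true) =
          (Finset.range y.length).filter fun i => y.getD i false = true :=
        Finset.filter_congr fun i hi => by
          rw [List.getD_append _ _ _ _ (Finset.mem_range.1 hi)]
      rw [e, List.getD_append_right _ _ _ _ le_rfl]
      cases b
      · simp
      · simp
  rw [this]
  refine Finset.card_le_card fun i hi => ?_
  rw [Finset.mem_filter, Finset.mem_range] at hi
  exact h i hi.1 hi.2

/-- The length of the output admits no such bound: additions can double register 0 in one step, and
untouched cells read as zeros. Ones, however, have to be written, as array 1 is empty at the start.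
-/
theorem count_le_steps {p : Prog} {x y : List Bool} {k k' c : ℕ} {σ : State}
    (h : Exec p (initState x k) σ c) (hy : IsOutput σ y k') : y.count true ≤ c := by
  obtain ⟨T, h1, h2⟩ := h.exists_support ∅ fun i _ => by simp [initState]
  refine (count_le_card y T fun i hi hb => ?_).trans (by simpa using h1)
  by_contra hT
  have h3 := hy.2.2 i hi
  rw [h2 i hT, hb] at h3
  simp at h3

/-- In a list each entry is preceded by a one, which pays for itself and for the excess `2` of the
code of the entry. -/
theorem length_enc_le {N : ℕ} : ∀ (l : ℕ) (G : Layered N l),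
    (Layered.enc l G).length ≤ 3 * (Layered.enc l G).count true + 2
  | 0, (b, v) => by
    simp only [Layered.enc, encFin, encNat, List.length_cons, List.length_append,
      List.length_replicate, List.count_cons, List.count_append, List.count_replicate]
    simp
    omega
  | l + 1, G => by
    have : ∀ L : List (Layered N l), (encList (Layered.enc l) L).length ≤
        3 * (encList (Layered.enc l) L).count true + 1 := by
      intro L
      induction L with
      | nil => simp [encList]
      | cons H L ih =>
        have := length_enc_le l H
        simp only [encList, List.length_cons, List.length_append, List.count_cons,
          List.count_append, beq_self_eq_true, if_true]
        omega
    exact (this G).trans (by change _ ≤ 3 * (encList (Layered.enc l) _).count true + 2; omega)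

theorem count_flatMap_encNat (l : List ℕ) : (l.flatMap encNat).count true = l.sum := by
  induction l with
  | nil => rfl
  | cons n l ih => simp [ih, encNat]

/-- The header has one zero for each of its `2 + r + N` numbers, and `r` and `N` are themselves
written there in unary. -/
theorem QbfInst.length_enc_le {t : ℕ} (I : QbfInst t) :
    I.enc.length ≤ 3 * I.enc.count true + 4 := by
  have h := SepLogic.length_enc_le t I.F
  have h1 : I.nums.length = 2 + I.r + I.N := by
    simp only [nums, List.length_cons, List.length_append, List.length_ofFn]
    omega
  have h2 : I.r + I.N ≤ I.nums.sum := by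
    simp only [nums, List.sum_cons]
    omega
  rw [I.enc_eq, List.length_append, List.count_append, length_flatMap_encNat, count_flatMap_encNat]
  omega

/-! ### Composition -/

theorem primrec_pow (d : ℕ) : Primrec fun x : ℕ => x ^ d := by
  induction d with
  | zero => exact (Primrec.const 1).of_eq fun x => (pow_zero x).symm
  | succ d ih => exact (Primrec.nat_mul.comp ih .id).of_eq fun x => (pow_succ x d).symm

theorem awStarHard_modelChecking : AWStarHard (modelChecking sparseClass) := by
  rintro P ⟨t, ht, p₁, f, g, e, hf, hg, h⟩
  obtain ⟨p₂, C, d, h₂⟩ := exists_program_mcInst t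
  have hF : Primrec fun x : ℕ => x + C * (5 * (x + 1)) ^ d :=
    Primrec.nat_add.comp .id (Primrec.nat_mul.comp (.const C) ((primrec_pow d).comp
      (Primrec.nat_mul.comp (.const 5) .succ)))
  have hG : Primrec fun x : ℕ => 2000 * (x + t + 11) ^ 2 :=
    Primrec.nat_mul.comp (.const 2000) ((primrec_pow 2).comp
      (Primrec.nat_add.comp (Primrec.nat_add.comp .id (.const t)) (.const 11)))
  -- The exponent `e + e * d` dominates both `e`, from the given reduction, and `e * d`, from a
  -- polynomial of degree `d` in its output length.
  refine ⟨.seq p₁ p₂, fun k => f k + C * (5 * (f k + 1)) ^ d,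
    fun k => 2000 * (g k + t + 11) ^ 2, e + e * d, hF.to_comp.comp hf, hG.to_comp.comp hg,
    fun a => ?_⟩
  obtain ⟨I, σ, c, hexec, hout, hc, hpar, hyes⟩ := h a
  obtain ⟨τ, c', hexec', hc', hout'⟩ := h₂ I σ _ hout
  refine ⟨mcInst I, τ, c + c', hexec.seq hexec', hout', ?_, ?_, hyes.trans (models_mcInst ht I).symm⟩
  · have h1 := count_le_steps hexec hout
    have h2 : I.enc.length ≤ 3 * I.enc.count true + 4 := I.length_enc_le
    have h3 : I.enc.count true ≤ c := h1
    set n := (P.enc a).length + 1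
    set F := f (P.param a)
    have hn : 1 ≤ n ^ e := Nat.one_le_pow _ _ (Nat.succ_pos _)
    -- `3 * c + 5 ≤ 5 * (c + 1)`, and `c + 1` is at most `(F + 1) * n ^ e`.
    have h4 : I.enc.length + 1 ≤ 5 * (F + 1) * n ^ e := by
      have : c + 1 ≤ (F + 1) * n ^ e := by rw [add_mul, one_mul]; omega
      rw [mul_assoc]
      omega
    calc c + c' ≤ F * n ^ e + C * (5 * (F + 1) * n ^ e) ^ d :=
          add_le_add hc (hc'.trans (Nat.mul_le_mul_left _ (Nat.pow_le_pow_left h4 _)))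
      _ ≤ F * n ^ (e + e * d) + C * (5 * (F + 1)) ^ d * n ^ (e + e * d) := by
          rw [mul_pow, ← pow_mul, ← mul_assoc]
          gcongr
          · exact Nat.succ_pos _
          · omega
          · exact Nat.succ_pos _
          · omega
      _ = _ := by rw [add_mul]
  · refine (param_mcInst I).trans (Nat.mul_le_mul_left _ (Nat.pow_le_pow_left ?_ 2))
    omega

end SepLogic

theorem mainTheorem12 :
    ∃ C : SepLogic.GraphClass, C.BoundedExpansion ∧
      SepLogic.AWStarHard (SepLogic.modelChecking C) :=
  ⟨SepLogic.sparseClass, SepLogic.sparseClass_boundedExpansion, SepLogic.awStarHard_modelChecking⟩
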